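/- **Model.** Let $p\ge 1$ and let $\{\varepsilon_t\}_{t\in\mathbb Z}$ be i.i.d. with density $g$. Fix $\beta_a>0$ with $E\varepsilon_1^2\ge\beta_a$ and put $\Theta=\{\mathbf a\in\mathbb R^p: a_1,\dots,a_p\ge 0,\ \|\mathbf a\|_1\le\beta_a^{-1}\}$. Fix $\mathbf b\in\Theta$ and $\eta>0$ with $E\varepsilon_1^2(\|\mathbf b\|_1+\eta)<1$, and put $\Theta^\eta=\{\mathbf a\in\Theta:\|\mathbf a-\mathbf b\|_1\le\eta\}$. For $\mathbf U\in\mathbb R^p$ let $s(\theta,\mathbf U)=1+\theta_1U_1^2+\dots+\theta_pU_p^2$. For $\mathbf a\in\Theta^\eta$ let $\{y^a_t\}_{t\in\mathbb Z}$ be the strictly stationary solution of $y_t=\varepsilon_t\,s(\mathbf a,\mathbf Y_{t-1})^{1/2}$, where $\mathbf Y_t=(y_t,\dots,y_{t-p+1})$. For any path $y$ put $\varepsilon_t(\theta)=y_t/s(\theta,\mathbf Y_{t-1})^{1/2}$. Let $\varphi:\mathbb R^p\times\Theta\to\mathbb R^p$, let $F$ be a distribution function (or, more generally, the distribution function of a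 finite measure) and let $\psi:\mathbb R\to\mathbb R$ have bounded variation on $\mathbb R$. Put $$\mathbf b^a(x,\theta)=E\,\varphi(\mathbf Y^a_0,\theta)I\{\varepsilon^a_1(\theta)\le x\}-E\,\varphi(\mathbf Y^a_0,\theta)\,P(\varepsilon^a_1(\theta)\le x).$$ **Estimators.** From observations $y_{1-p},\dots,y_n$ form $G_n(x,\theta)=n^{-1}\sum_{t=1}^nI\{\varepsilon_t(\theta)\le x\}$ and $\mathbf W_n(x,\theta)=n^{-1/2}\sum_{t=1}^n\varphi(\mathbf Y_{t-1},\theta)[I\{\varepsilon_t(\theta)\le x\}-G_n(x,\theta)]$. An MD estimate is a minimizer over $\theta\in\Theta$ of $\int\|\mathbf W_n(x,\theta)\|^2dF(x)$. A GM estimate is a solution $\theta\in\Theta$ of $$\sum_{t=1}^n\varphi(\mathbf Y_{t-1},\theta)\psi(\varepsilon_t(\theta))-n^{-1}\sum_{t=1}^n\varphi(\mathbf Y_{t-1},\theta)\sum_{t=1}^n\psi(\varepsilon_t(\theta))=\mathbf 0.$$ **Contamination.** For $\mathbf a_n\in\Theta^\eta$, a rate $\gamma\in[0,1]$ and a probability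 distribution $\mu_\xi$ on $\mathbb R$, one observes $y^{\gamma n}_t=y^{a_n}_t+z_t\xi_t$, $t=1-p,\dots,n$, where the $z_t$ are i.i.d. Bernoulli($\gamma$), the $\xi_t$ are i.i.d. with distribution $\mu_\xi$, and the sequences $\{z_t\},\{\xi_t\},\{y^{a_n}_t\}$ are independent of each other. Let $\hat{\mathbf a}^\gamma_{n,MD}$, $\hat{\mathbf a}^\gamma_{n,GM}$ denote the MD and GM estimates computed from $y^{\gamma n}_{1-p},\dots,y^{\gamma n}_n$. **Assumptions.** 1. $E\varepsilon_1=0$, $E|\varepsilon_1|^{8+\beta_0}<\infty$ for some $\beta_0>0$; $g>0$ is differentiable, $xg(x)\to0$ as $|x|\to\infty$, $\sup_x(1+x^2)|g'(x)|<\infty$, $\int|xg'(x)|dx<\infty$. 2. There are functions $\Phi,M$ and $\beta_0>0$ such that $|\varphi_j(\mathbf U,\theta)|\le\Phi(\mathbf U)$ for all $\mathbf U$, all $\theta\in\Theta$ and all $j$, $\sup_{\mathbf a\in\Theta^\eta}E\Phi^{4+\beta_0}(\mathbf Y^a_0)<\infty$; for almost every $\mathbf U$ the partial derivatives $\partial\varphi_j(\mathbf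 U,\theta)/\partial\theta_k$ exist on $\Theta$ (one-sided where necessary), are continuous in $\theta\in\Theta$ and are bounded in absolute value by $M(\mathbf U)$; and $\sup_{\mathbf a\in\Theta^\eta}EM^{2+\beta_0}(\mathbf Y^a_0)<\infty$. 3. $\sup_{\mathbf U\in\mathbb R^p,\theta\in\Theta}\|\varphi(\mathbf U,\theta)\|<\infty$. 4. For some $\delta_0>0$ and all $\mathbf a\in\Theta^\eta$, $\theta\in\Theta$: $\int\|\mathbf b^a(x,\theta)\|^2dF(x)\ge\delta_0\|\theta-\mathbf a\|^2$ and $\bigl\|\int\mathbf b^a(x,\theta)\,d\psi(x)\bigr\|\ge\delta_0\|\theta-\mathbf a\|$. **Theorem.** For every $\delta>0$ there exist $\gamma_0>0$ and $N$ such that for all $n>N$, all $0\le\gamma<\gamma_0$, all sequences $\{\mathbf a_n\}\subset\Theta^\eta$ and all outlier distributions $\mu_\xi$, $$P\bigl(\|\hat{\mathbf a}^\gamma_{n,MD}-\mathbf a_n\|>\delta\bigr)<\delta,\qquad P\bigl(\|\hat{\mathbf a}^\gamma_{n,GM}-\mathbf a_n\|>\delta\bigr)<\delta .$$ Here, since the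 minimizer or solution need not exist or be unique, the event on the left means that some MD (respectively GM) estimate lies at distance more than $\delta$ from $\mathbf a_n$, and $P$ is outer probability if that event is not measurable. -/

import Mathlib

open MeasureTheory ProbabilityTheory Filter Topology

noncomputable section

namespace RobustARCH

/-- Parameters `(a_1, …, a_p)` and lag vectors, with the Euclidean norm. -/
abbrev Vec (p : ℕ) : Type := EuclideanSpace ℝ (Fin p)

variable {p : ℕ}

/-- The norm `‖a‖₁ = |a_1| + … + |a_p|`. -/
def l1Norm (a : Vec p) : ℝ := ∑ k, |a k|

/-- The parameter set `Θ = {a : a_k ≥ 0, ‖a‖₁ ≤ β⁻¹}`. -/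
def Theta (p : ℕ) (β : ℝ) : Set (Vec p) :=
  {a | (∀ k, 0 ≤ a k) ∧ l1Norm a ≤ β⁻¹}

/-- The set `{a : ‖a - b‖₁ ≤ η} ∩ Θ` of admissible true parameters. -/
def ThetaLoc (β : ℝ) (b : Vec p) (η : ℝ) : Set (Vec p) :=
  {a | l1Norm (a - b) ≤ η} ∩ Theta p β

/-- `s(θ, U) = 1 + θ_1 U_1² + … + θ_p U_p²`. -/
def volSq (θ U : Vec p) : ℝ := 1 + ∑ k, θ k * U k ^ 2

/-- The lag vector `Y_t = (y_t, y_{t-1}, …, y_{t-p+1})` of a path `y`. -/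
def lag (p : ℕ) (y : ℤ → ℝ) (t : ℤ) : Vec p :=
  WithLp.toLp 2 fun k : Fin p => y (t - ((k : ℕ) : ℤ))

/-- The residual `ε_t(θ) = y_t / √s(θ, Y_{t-1})`. -/
def resid (y : ℤ → ℝ) (θ : Vec p) (t : ℤ) : ℝ :=
  y t / √(volSq θ (lag p y (t - 1)))

open Classical in
/-- The indicator `I{u ≤ x}`. -/
def leInd (u x : ℝ) : ℝ := if u ≤ x then 1 else 0

/-- The residual empirical distribution function `G_n(x, θ)`. -/
def residEDF (n : ℕ) (y : ℤ → ℝ) (x : ℝ) (θ : Vec p) : ℝ :=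
  (n : ℝ)⁻¹ * ∑ t ∈ Finset.Icc (1 : ℤ) n, leInd (resid y θ t) x

/-- The (vector) residual empirical process `W_n(x, θ)` of a path `y`; it depends only on
`y_{1-p}, …, y_n`. -/
def residProc (φ : Vec p → Vec p → Vec p) (n : ℕ) (y : ℤ → ℝ) (x : ℝ) (θ : Vec p) : Vec p :=
  (√(n : ℝ))⁻¹ • ∑ t ∈ Finset.Icc (1 : ℤ) n,
    (leInd (resid y θ t) x - residEDF n y x θ) • φ (lag p y (t - 1)) θ

/-- The minimum distance functional `K_n(θ) = ∫ ‖W_n(x, θ)‖² dF(x)`. -/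
def mdFunctional (φ : Vec p → Vec p → Vec p) (F : Measure ℝ) (n : ℕ) (y : ℤ → ℝ)
    (θ : Vec p) : ℝ :=
  ∫ x, ‖residProc φ n y x θ‖ ^ 2 ∂F

/-- The left-hand side `l_n(θ)` of the generalized M equation. -/
def gmFunctional (φ : Vec p → Vec p → Vec p) (ψ : ℝ → ℝ) (n : ℕ) (y : ℤ → ℝ)
    (θ : Vec p) : Vec p :=
  (∑ t ∈ Finset.Icc (1 : ℤ) n, ψ (resid y θ t) • φ (lag p y (t - 1)) θ)
    - ((n : ℝ)⁻¹ * ∑ t ∈ Finset.Icc (1 : ℤ) n, ψ (resid y θ t)) •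
      ∑ t ∈ Finset.Icc (1 : ℤ) n, φ (lag p y (t - 1)) θ

/-- `θ` is a minimum distance (MD) estimate computed from the observations `y_{1-p}, …, y_n`. -/
def IsMDEstimate (β : ℝ) (φ : Vec p → Vec p → Vec p) (F : Measure ℝ) (n : ℕ) (y : ℤ → ℝ)
    (θ : Vec p) : Prop :=
  θ ∈ Theta p β ∧ ∀ θ' ∈ Theta p β, mdFunctional φ F n y θ ≤ mdFunctional φ F n y θ'

/-- `θ` is a generalized M (GM) estimate computed from the observations `y_{1-p}, …, y_n`. -/
def IsGMEstimate (β : ℝ) (φ : Vec p → Vec p → Vec p) (ψ : ℝ → ℝ) (n : ℕ) (y : ℤ → ℝ)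
    (θ : Vec p) : Prop :=
  θ ∈ Theta p β ∧ gmFunctional φ ψ n y θ = 0

variable {Ω : Type*} [MeasurableSpace Ω]

/-- The distribution on `ℝ` with Lebesgue density `g`. -/
def densityLaw (g : ℝ → ℝ) : Measure ℝ := volume.withDensity fun x => ENNReal.ofReal (g x)

/-- The `ε_t`, `t ∈ ℤ`, are i.i.d. with density `g`. -/
structure IsInnovation (P : Measure Ω) (g : ℝ → ℝ) (ε : ℤ → Ω → ℝ) : Prop where
  measurable : ∀ t, Measurable (ε t)
  indep : iIndepFun ε P
  law : ∀ t, P.map (ε t) = densityLaw g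

/-- `y` is a strictly stationary solution of
`y_t = ε_t √(1 + a_1 y_{t-1}² + … + a_p y_{t-p}²)`, `t ∈ ℤ`. -/
structure IsStationarySolution (P : Measure Ω) (ε : ℤ → Ω → ℝ) (a : Vec p)
    (y : ℤ → Ω → ℝ) : Prop where
  measurable : ∀ t, Measurable (y t)
  stationary : P.map (fun ω (t : ℤ) => y (t + 1) ω) = P.map (fun ω (t : ℤ) => y t ω)
  equation : ∀ t, ∀ᵐ ω ∂P, y t ω = √(volSq a (lag p (fun i => y i ω) (t - 1))) * ε t ω

/-- The second moment `E ε_1²`. -/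
def innovVar (g : ℝ → ℝ) : ℝ := ∫ x, x ^ 2 ∂(densityLaw g)

/-- `E ε_1 = 0`, `E ε_1² < ∞`, `g > 0`, `E ε_1² ≥ β > 0`, and the observation scheme: `b ∈ Θ`,
`η > 0`, `E ε_1² (‖b‖₁ + η) < 1` (whence `E ε_1² ‖a‖₁ < 1` for all `a` in `ThetaLoc β b η`). -/
structure StationarityCondition (g : ℝ → ℝ) (β : ℝ) (b : Vec p) (η : ℝ) : Prop where
  pos : ∀ x, 0 < g x
  sq_integrable : Integrable (fun x : ℝ => x ^ 2) (densityLaw g)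
  mean_zero : ∫ x, x ∂(densityLaw g) = 0
  beta_pos : 0 < β
  beta_le : β ≤ innovVar g
  b_mem : b ∈ Theta p β
  eta_pos : 0 < η
  contraction : innovVar g * (l1Norm b + η) < 1

/-- `x g(x) → 0` as `|x| → ∞`, `sup (1 + x²)|g'(x)| < ∞`, `∫ |x g'(x)| dx < ∞`. -/
structure DensityCondition (g : ℝ → ℝ) : Prop where
  differentiable : Differentiable ℝ g
  tendsto : Tendsto (fun x => x * g x) (cocompact ℝ) (𝓝 0)
  deriv_bound : ∃ C : ℝ, ∀ x, (1 + x ^ 2) * |deriv g x| ≤ C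
  deriv_integrable : Integrable (fun x => x * deriv g x) volume

/-- `E |ε_1|^{8 + β₀} < ∞` for some `β₀ > 0`. -/
def InnovationMomentCondition (g : ℝ → ℝ) : Prop :=
  ∃ β₀ : ℝ, 0 < β₀ ∧ Integrable (fun x : ℝ => |x| ^ (8 + β₀)) (densityLaw g)

/-- Moment and smoothness conditions on the weight function `φ`. Here `y a` is the stationary
solution with parameter `a`. The partial derivative in `θ_k` is taken along the
part of the coordinate line through `θ` that lies in `Θ`. -/
def WeightCondition (P : Measure Ω) (y : Vec p → ℤ → Ω → ℝ) (β : ℝ) (b : Vec p) (η : ℝ)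
    (φ : Vec p → Vec p → Vec p) : Prop :=
  (∀ θ ∈ Theta p β, Measurable fun U => φ U θ) ∧
  ∃ (Φ M : Vec p → ℝ) (β₀ : ℝ), Measurable Φ ∧ Measurable M ∧ 0 < β₀ ∧
    (∀ U, ∀ θ ∈ Theta p β, ∀ j, |φ U θ j| ≤ Φ U) ∧
    (∃ C : ℝ, ∀ a ∈ ThetaLoc β b η,
      Integrable (fun ω => Φ (lag p (fun i => y a i ω) 0) ^ (4 + β₀)) P ∧
      ∫ ω, Φ (lag p (fun i => y a i ω) 0) ^ (4 + β₀) ∂P ≤ C) ∧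
    (∀ᵐ U : Vec p, ∃ d : Fin p → Fin p → Vec p → ℝ, ∀ j k,
      ContinuousOn (d j k) (Theta p β) ∧
      ∀ θ ∈ Theta p β,
        HasDerivWithinAt (fun s : ℝ => φ U (WithLp.toLp 2 (Function.update (θ : Fin p → ℝ) k s)) j)
          (d j k θ) {s : ℝ | WithLp.toLp 2 (Function.update (θ : Fin p → ℝ) k s) ∈ Theta p β} (θ k) ∧
        |d j k θ| ≤ M U) ∧
    (∃ C : ℝ, ∀ a ∈ ThetaLoc β b η,
      Integrable (fun ω => M (lag p (fun i => y a i ω) 0) ^ (2 + β₀)) P ∧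
      ∫ ω, M (lag p (fun i => y a i ω) 0) ^ (2 + β₀) ∂P ≤ C)

/-- `sup_{U, θ} ‖φ(U, θ)‖ < ∞`. -/
def BoundedWeight (β : ℝ) (φ : Vec p → Vec p → Vec p) : Prop :=
  ∃ L : ℝ, ∀ U, ∀ θ ∈ Theta p β, ‖φ U θ‖ ≤ L

/-- `b^a(x, θ) = E φ(Y_0, θ) I{ε_1(θ) ≤ x} - E φ(Y_0, θ) P(ε_1(θ) ≤ x)`, for the process `y`. -/
def drift (P : Measure Ω) (φ : Vec p → Vec p → Vec p) (y : ℤ → Ω → ℝ) (x : ℝ)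
    (θ : Vec p) : Vec p :=
  (∫ ω, leInd (resid (fun i => y i ω) θ 1) x • φ (lag p (fun i => y i ω) 0) θ ∂P)
    - P.real {ω | resid (fun i => y i ω) θ 1 ≤ x} • ∫ ω, φ (lag p (fun i => y i ω) 0) θ ∂P

/-- Identifiability condition for the MD estimate. -/
def MDIdentifiable (P : Measure Ω) (y : Vec p → ℤ → Ω → ℝ) (β : ℝ) (b : Vec p) (η : ℝ)
    (φ : Vec p → Vec p → Vec p) (F : Measure ℝ) : Prop :=
  ∃ δ₀ : ℝ, 0 < δ₀ ∧ ∀ a ∈ ThetaLoc β b η, ∀ θ ∈ Theta p β,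
    δ₀ * ‖θ - a‖ ^ 2 ≤ ∫ x, ‖drift P φ (y a) x θ‖ ^ 2 ∂F

/-- Identifiability condition for the GM estimate; the integral is the Lebesgue–Stieltjes integral
`∫ b^a(x, θ) dψ(x)` with respect to a function `ψ` of bounded variation. -/
def GMIdentifiable (P : Measure Ω) (y : Vec p → ℤ → Ω → ℝ) (β : ℝ) (b : Vec p) (η : ℝ)
    (φ : Vec p → Vec p → Vec p) {ψ : ℝ → ℝ} (hψ : BoundedVariationOn ψ Set.univ) : Prop :=
  ∃ δ₀ : ℝ, 0 < δ₀ ∧ ∀ a ∈ ThetaLoc β b η, ∀ θ ∈ Theta p β,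
    δ₀ * ‖θ - a‖ ≤ ‖hψ.vectorMeasure.integral (fun x => drift P φ (y a) x θ)
      (ContinuousLinearMap.lsmul ℝ ℝ).flip‖

/-- For `1 - p ≤ t ≤ n`: the `z_t` are i.i.d. Bernoulli with parameter `γ`, the `ξ_t` are i.i.d.
with distribution `μξ`, and the sequences `z`, `ξ`, `y` are mutually independent. -/
structure IsContamination (p : ℕ) (P : Measure Ω) (n : ℕ) (γ : ℝ) (μξ : Measure ℝ)
    (y z ξ : ℤ → Ω → ℝ) : Prop where
  z_measurable : ∀ t ∈ Set.Icc (1 - (p : ℤ)) n, Measurable (z t)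
  ξ_measurable : ∀ t ∈ Set.Icc (1 - (p : ℤ)) n, Measurable (ξ t)
  z_indep : iIndepFun (fun t : Set.Icc (1 - (p : ℤ)) n => z t) P
  ξ_indep : iIndepFun (fun t : Set.Icc (1 - (p : ℤ)) n => ξ t) P
  z_law : ∀ t ∈ Set.Icc (1 - (p : ℤ)) n,
    P.map (z t) = ENNReal.ofReal (1 - γ) • Measure.dirac 0 + ENNReal.ofReal γ • Measure.dirac 1
  ξ_law : ∀ t ∈ Set.Icc (1 - (p : ℤ)) n, P.map (ξ t) = μξ
  indep_z_ξ : IndepFun (fun ω (t : Set.Icc (1 - (p : ℤ)) n) => z t ω)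
    (fun ω (t : Set.Icc (1 - (p : ℤ)) n) => ξ t ω) P
  indep_y : IndepFun (fun ω (t : ℤ) => y t ω)
    (fun ω (t : Set.Icc (1 - (p : ℤ)) n) => (z t ω, ξ t ω)) P

/-- The contaminated path `y_t + z_t ξ_t`. -/
def contaminated (y z ξ : ℤ → Ω → ℝ) (ω : Ω) : ℤ → ℝ := fun t => y t ω + z t ω * ξ t ω

end RobustARCH

end

open MeasureTheory ProbabilityTheory Filter Topology

noncomputable section

set_option linter.unusedSectionVars false

namespace RobustARCH

/-! ### The ARCH recursion on pasts and its pathwise stability -/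

variable {p : ℕ}
variable {Ω : Type*} [MeasurableSpace Ω]

/-! Both estimates depend on the data only through empirical covariances of a bounded score of the
residual with a bounded weight of the lag vector (`empCov`). The coordinates of W_n(x, θ) are √n
times such covariances for the score I{u ≤ x}, and the GM equation says that those for the score ψ
vanish. The core is a uniform law of large numbers, `eventually_uniform_empCov_contaminated`: with
probability near one the empirical covariances are close in L¹(F) to the population ones (`popCov`)
for all θ ∈ Θ at once, with thresholds for n and γ that depend neither on the true parameter nor on
the outliers. At the true parameter the residual is independent of the lag vector, so the population
covariance is zero (`popCov_self`). Identifiability keeps it away from zero at distance more than δ.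
For GM this uses that the Stieltjes integral of the drift against ψ is minus the covariance with ψ
of the residual (`integral_drift_apply`).

The law of large numbers must be uniform in the true parameter, so it is proved quantitatively.
Running the recursion from zero m steps back gives an approximation by finitely many innovations
whose error decays geometrically, with a rate set by the contraction factor alone (`sq_sim_sub_le`,
`integral_lin_le`, `exists_trunc`). As the volatility is at least 1, finite windows of the process
have densities bounded by powers of the bound on g (`lintegral_window_le`). A merely measurable
function of a window is therefore close in mean to a continuous function of m innovations, uniformly
over the processes (`exists_approx`). Distant summands are then almost uncorrelated, and a second
moment bound gives `exists_lln`. A finite net in Θ and an oscillation bound (`exists_oscillation`)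
give uniformity in θ. Jumps of the score do no harm: a short interval around the residual has small
mass on average, because the residual has a conditional density with integrable bound.

An outlier spoils at most p + 1 windows and changes each bounded summand by a bounded amount,
whatever its size. The expected proportion of spoiled windows is at most (p + 1)γ, which yields
robustness for every outlier law. -/

/-- The infinite past `(y_t, y_{t-1}, …)` of a path `y`. -/
def past (y : ℤ → ℝ) (t : ℤ) : ℕ → ℝ := fun k => y (t - k)

/-- One step of the ARCH recursion, acting on infinite pasts. -/
def step (a : Vec p) (e : ℝ) (π : ℕ → ℝ) : ℕ → ℝ
  | 0 => √(1 + ∑ k : Fin p, a k * π k ^ 2) * e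
  | k + 1 => π k

/-- `n` steps of the ARCH recursion with innovations `e 0, e 1, …`, started from the past `π`. -/
def sim (a : Vec p) (e : ℕ → ℝ) (π : ℕ → ℝ) : ℕ → ℕ → ℝ
  | 0 => π
  | n + 1 => step a (e n) (sim a e π n)

/-- One step of the linear recursion that governs the squares. -/
def linStep (a : Vec p) (e : ℝ) (π : ℕ → ℝ) : ℕ → ℝ
  | 0 => e ^ 2 * ∑ k : Fin p, a k * π k
  | k + 1 => π k

/-- `n` steps of the linear recursion that governs the squares, started from `1`. -/
def lin (a : Vec p) (e : ℕ → ℝ) : ℕ → ℕ → ℝ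
  | 0 => fun _ => 1
  | n + 1 => linStep a (e n) (lin a e n)

/-- The sum of squares of the first `p + 1` entries of a past. -/
def pastSq (p : ℕ) (π : ℕ → ℝ) : ℝ := ∑ k ∈ Finset.range (p + 1), π k ^ 2

lemma lin_nonneg {a : Vec p} (ha : ∀ k, 0 ≤ a k) (e : ℕ → ℝ) (n k : ℕ) : 0 ≤ lin a e n k := by
  induction n generalizing k with
  | zero => simp [lin]
  | succ n ih =>
    cases k with
    | zero =>
      simp only [lin, linStep]
      exact mul_nonneg (sq_nonneg _) (Finset.sum_nonneg fun j _ => mul_nonneg (ha j) (ih j))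
    | succ k => exact ih k

lemma pastSq_nonneg (p : ℕ) (π : ℕ → ℝ) : 0 ≤ pastSq p π :=
  Finset.sum_nonneg fun _ _ => sq_nonneg _

lemma step_zero_sq {a : Vec p} (ha : ∀ k, 0 ≤ a k) (e : ℝ) (π : ℕ → ℝ) :
    step a e π 0 ^ 2 = e ^ 2 * (1 + ∑ k : Fin p, a k * π k ^ 2) := by
  have h : 0 ≤ 1 + ∑ k : Fin p, a k * π k ^ 2 :=
    add_nonneg zero_le_one (Finset.sum_nonneg fun j _ => mul_nonneg (ha j) (sq_nonneg _))
  simp only [step]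
  rw [mul_pow, Real.sq_sqrt h, mul_comm]

/-- Squares satisfy an affine recursion with nonnegative coefficients. For two trajectories with the
same innovations the constant term cancels, and the difference of squares follows the linear part,
which is what `lin` iterates. -/
lemma abs_sq_sim_sub_le {a : Vec p} (ha : ∀ k, 0 ≤ a k) (e π : ℕ → ℝ) (n k : ℕ) (hk : k ≤ p) :
    |sim a e π n k ^ 2 - sim a e 0 n k ^ 2| ≤ pastSq p π * lin a e n k := by
  induction n generalizing k with
  | zero =>
    simp only [sim, lin, Pi.zero_apply, mul_one]
    rw [zero_pow two_ne_zero, sub_zero, abs_of_nonneg (sq_nonneg _)]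
    exact Finset.single_le_sum (f := fun k => π k ^ 2) (fun i _ => sq_nonneg _)
      (Finset.mem_range.2 (by omega))
  | succ n ih =>
    cases k with
    | zero =>
      simp only [sim, lin, linStep]
      rw [step_zero_sq ha, step_zero_sq ha, ← mul_sub, add_sub_add_left_eq_sub,
        ← Finset.sum_sub_distrib, abs_mul, abs_of_nonneg (sq_nonneg (e n)), mul_left_comm,
        Finset.mul_sum]
      refine mul_le_mul_of_nonneg_left ?_ (sq_nonneg _)
      refine (Finset.abs_sum_le_sum_abs _ _).trans (Finset.sum_le_sum fun j _ => ?_)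
      rw [← mul_sub, abs_mul, abs_of_nonneg (ha j), mul_left_comm]
      exact mul_le_mul_of_nonneg_left (ih j (by omega)) (ha j)
    | succ k => exact ih k (by omega)

/-- The volatility is nonnegative, so both trajectories carry the sign of the current innovation.
Entries not yet overwritten are zero in the second one. -/
lemma sim_mul_sim_nonneg (a : Vec p) (e π : ℕ → ℝ) (n k : ℕ) :
    0 ≤ sim a e π n k * sim a e 0 n k := by
  induction n generalizing k with
  | zero => simp [sim]
  | succ n ih =>
    cases k with
    | zero =>
      simp only [sim, step]
      rw [mul_mul_mul_comm]
      exact mul_nonneg (mul_nonneg (Real.sqrt_nonneg _) (Real.sqrt_nonneg _)) (mul_self_nonneg _)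
    | succ k => exact ih k

/-- Numbers of equal sign satisfy |u - v| ≤ |u + v|. This turns control of squares, where the
recursion is affine, into control of values. -/
lemma sq_sub_le_abs_sq_sub_sq {u v : ℝ} (h : 0 ≤ u * v) : (u - v) ^ 2 ≤ |u ^ 2 - v ^ 2| := by
  have : |u - v| ≤ |u + v| := by
    rw [← sq_le_sq]; nlinarith
  rw [sq_sub_sq, abs_mul, ← sq_abs, sq]
  exact mul_le_mul_of_nonneg_right this (abs_nonneg _)

lemma sq_sim_sub_le {a : Vec p} (ha : ∀ k, 0 ≤ a k) (e π : ℕ → ℝ) (n k : ℕ) (hk : k ≤ p) :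
    (sim a e π n k - sim a e 0 n k) ^ 2 ≤ pastSq p π * lin a e n k :=
  (sq_sub_le_abs_sq_sub_sq (sim_mul_sim_nonneg a e π n k)).trans (abs_sq_sim_sub_le ha e π n k hk)

lemma past_eq_sim {a : Vec p} {y ε : ℤ → ℝ}
    (h : ∀ t, y t = √(volSq a (lag p y (t - 1))) * ε t) (t : ℤ) (n : ℕ) :
    past y (t + n) = sim a (fun i => ε (t + 1 + i)) (past y t) n := by
  induction n with
  | zero => simp [sim]
  | succ n ih =>
    funext k
    simp only [sim]
    rw [← ih]
    cases k with
    | zero =>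
      simp only [past, step]
      have e1 : t + ((n + 1 : ℕ) : ℤ) - ((0 : ℕ) : ℤ) = t + 1 + n := by push_cast; ring
      have e2 : t + 1 + (n : ℤ) - 1 = t + n := by ring
      rw [e1, h, volSq, e2]
      rfl
    | succ k =>
      simp only [past, step]
      congr 1
      push_cast; ring

lemma measurable_past {Ω : Type*} {m : MeasurableSpace Ω} {y : ℤ → Ω → ℝ} {t : ℤ}
    (h : ∀ s ≤ t, Measurable (y s)) : Measurable fun ω => past (fun i => y i ω) t :=
  measurable_pi_lambda _ fun k => h _ (by simp)

lemma measurable_sim_of_le {Ω : Type*} {m : MeasurableSpace Ω} (a : Vec p) {e : ℕ → Ω → ℝ} {n : ℕ}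
    (he : ∀ i < n, Measurable (e i)) (k : ℕ) :
    Measurable fun ω => sim a (fun i => e i ω) 0 n k := by
  induction n generalizing k with
  | zero => simp only [sim]; exact measurable_const
  | succ n ih =>
    have ih' := fun k => ih (fun i hi => he i (by omega)) k
    cases k with
    | zero =>
      simp only [sim, step]
      have := he n (by omega)
      fun_prop
    | succ k => exact ih' k

lemma measurable_lin_of_le {Ω : Type*} {m : MeasurableSpace Ω} (a : Vec p) {e : ℕ → Ω → ℝ} {n : ℕ}
    (he : ∀ i < n, Measurable (e i)) (k : ℕ) :
    Measurable fun ω => lin a (fun i => e i ω) n k := by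
  induction n generalizing k with
  | zero => simp only [lin]; exact measurable_const
  | succ n ih =>
    have ih' := fun k => ih (fun i hi => he i (by omega)) k
    cases k with
    | zero =>
      simp only [lin, linStep]
      have := he n (by omega)
      fun_prop
    | succ k => exact ih' k

/-! ### Independent innovations: moment bounds for the recursions -/

/-- Independent innovations with second moment `v`, whose laws have densities bounded by `K`. -/
structure IsNoise (P : Measure Ω) (ε : ℤ → Ω → ℝ) (v : ℝ) (K : ℝ) : Prop where
  measurable : ∀ t, Measurable (ε t)
  indep : iIndepFun ε P
  sq_integrable : ∀ t, Integrable (fun ω => ε t ω ^ 2) P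
  sq_integral : ∀ t, ∫ ω, ε t ω ^ 2 ∂P = v
  law_le : ∀ t, P.map (ε t) ≤ ENNReal.ofReal K • volume

/-- The σ-algebra generated by the innovations up to time `t`. -/
abbrev pastSigma (ε : ℤ → Ω → ℝ) (t : ℤ) : MeasurableSpace Ω :=
  ⨆ s ∈ Set.Iic t, MeasurableSpace.comap (ε s) inferInstance

/-- The σ-algebra generated by the innovations after time `t`. -/
abbrev futureSigma (ε : ℤ → Ω → ℝ) (t : ℤ) : MeasurableSpace Ω :=
  ⨆ s ∈ Set.Ioi t, MeasurableSpace.comap (ε s) inferInstance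

lemma measurable_pastSigma (ε : ℤ → Ω → ℝ) {s t : ℤ} (h : s ≤ t) :
    Measurable[pastSigma ε t] (ε s) :=
  Measurable.mono (comap_measurable (ε s))
    (le_iSup₂_of_le (f := fun s (_ : s ∈ Set.Iic t) => MeasurableSpace.comap (ε s) inferInstance)
      s h le_rfl) le_rfl

lemma measurable_futureSigma (ε : ℤ → Ω → ℝ) {s t : ℤ} (h : t < s) :
    Measurable[futureSigma ε t] (ε s) :=
  Measurable.mono (comap_measurable (ε s))
    (le_iSup₂_of_le (f := fun s (_ : s ∈ Set.Ioi t) => MeasurableSpace.comap (ε s) inferInstance)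
      s h le_rfl) le_rfl

lemma pastSigma_mono (ε : ℤ → Ω → ℝ) {s t : ℤ} (h : s ≤ t) : pastSigma ε s ≤ pastSigma ε t :=
  biSup_mono fun _ hi => le_trans hi h

namespace IsNoise

variable {P : Measure Ω} {ε : ℤ → Ω → ℝ} {v K : ℝ}

lemma indep_past_future (h : IsNoise P ε v K) (t : ℤ) :
    Indep (pastSigma ε t) (futureSigma ε t) P :=
  indep_iSup_of_disjoint (fun s => (h.measurable s).comap_le) h.indep
    (Set.Iic_disjoint_Ioi le_rfl)

lemma indepFun_of_measurable (h : IsNoise P ε v K) (t : ℤ) {α β : Type*} [MeasurableSpace α]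
    [MeasurableSpace β] {X : Ω → α} {Y : Ω → β} (hX : Measurable[pastSigma ε t] X)
    (hY : Measurable[futureSigma ε t] Y) : IndepFun X Y P := by
  rw [IndepFun_iff_Indep]
  exact indep_of_indep_of_le_right (indep_of_indep_of_le_left (h.indep_past_future t) hX.comap_le)
    hY.comap_le

lemma variance_nonneg (h : IsNoise P ε v K) : 0 ≤ v := by
  rw [← h.sq_integral 0]; exact integral_nonneg fun _ => sq_nonneg _

end IsNoise

/-- A rate of decay of the ARCH(p) recursion with contraction factor `ρ`. -/
def decay (p : ℕ) (ρ : ℝ) : ℝ := 1 - (1 - ρ) / (p + 1)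

lemma decay_pos {ρ : ℝ} (h0 : 0 < ρ) : 0 < decay p ρ := by
  unfold decay
  rw [sub_pos, div_lt_one (by positivity)]
  have : (0 : ℝ) ≤ p := Nat.cast_nonneg p
  linarith

lemma decay_lt_one {ρ : ℝ} (h1 : ρ < 1) : decay p ρ < 1 := by
  unfold decay
  have : 0 < (1 - ρ) / (p + 1) := div_pos (by linarith) (by positivity)
  linarith

/-- Bernoulli's inequality gives ρ ≤ `decay p ρ ^ p`, and lower powers of a number below 1 are
larger. -/
lemma le_decay_pow {ρ : ℝ} (h0 : 0 < ρ) (h1 : ρ < 1) {k : ℕ} (hk : k < p) :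
    ρ ≤ decay p ρ ^ (k + 1) := by
  have hp : ρ ≤ decay p ρ ^ p := by
    have hb := one_add_mul_le_pow (a := -((1 - ρ) / ((p : ℝ) + 1))) (by
      have : (1 - ρ) / ((p : ℝ) + 1) ≤ 1 := by
        rw [div_le_one (by positivity)]
        have : (0 : ℝ) ≤ p := Nat.cast_nonneg p
        linarith
      linarith) p
    have e : (1 : ℝ) + -((1 - ρ) / ((p : ℝ) + 1)) = decay p ρ := by unfold decay; ring
    rw [e] at hb
    refine le_trans ?_ hb
    have : (p : ℝ) * ((1 - ρ) / (p + 1)) ≤ 1 - ρ := by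
      rw [← mul_div_assoc, div_le_iff₀ (by positivity)]
      nlinarith
    linarith
  exact hp.trans (pow_le_pow_of_le_one (decay_pos h0).le (decay_lt_one h1).le hk)

namespace IsNoise

variable {P : Measure Ω} [IsProbabilityMeasure P] {ε : ℤ → Ω → ℝ} {v K ρ : ℝ} {a : Vec p}

lemma integral_mul_sq (h : IsNoise P ε v K) {t : ℤ} {X : Ω → ℝ}
    (hX : Measurable[pastSigma ε t] X) (hXi : Integrable X P) :
    Integrable (fun ω => ε (t + 1) ω ^ 2 * X ω) P ∧
      ∫ ω, ε (t + 1) ω ^ 2 * X ω ∂P = v * ∫ ω, X ω ∂P := by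
  have hm : Measurable[futureSigma ε t] fun ω => ε (t + 1) ω ^ 2 :=
    (measurable_futureSigma ε (lt_add_one t)).pow_const 2
  have hi : IndepFun (fun ω => ε (t + 1) ω ^ 2) X P := (h.indepFun_of_measurable t hX hm).symm
  refine ⟨hi.integrable_mul (h.sq_integrable _) hXi, ?_⟩
  rw [hi.integral_fun_mul_eq_mul_integral (h.sq_integrable _).1 hXi.1, h.sq_integral]

lemma measurable_sim (ε : ℤ → Ω → ℝ) (a : Vec p) (t : ℤ) (n k : ℕ) :
    Measurable[pastSigma ε (t + n)] fun ω => sim a (fun i => ε (t + 1 + i) ω) 0 n k :=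
  @measurable_sim_of_le p Ω (pastSigma ε (t + n)) a (fun i => ε (t + 1 + i)) n
    (fun i hi => measurable_pastSigma ε (by omega)) k

lemma measurable_lin (ε : ℤ → Ω → ℝ) (a : Vec p) (t : ℤ) (n k : ℕ) :
    Measurable[pastSigma ε (t + n)] fun ω => lin a (fun i => ε (t + 1 + i) ω) n k :=
  @measurable_lin_of_le p Ω (pastSigma ε (t + n)) a (fun i => ε (t + 1 + i)) n
    (fun i hi => measurable_pastSigma ε (by omega)) k

lemma measurable_sim_future (ε : ℤ → Ω → ℝ) (a : Vec p) (t : ℤ) (n k : ℕ) :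
    Measurable[futureSigma ε t] fun ω => sim a (fun i => ε (t + 1 + i) ω) 0 n k :=
  @measurable_sim_of_le p Ω (futureSigma ε t) a (fun i => ε (t + 1 + i)) n
    (fun i hi => measurable_futureSigma ε (by omega)) k

/-- In mean, the new entry is v ∑ a_j times the means of the last p entries. With d the decay rate,
d^(n-k) is a supersolution of this recursion because ρ ≤ d^(j+1) for every lag j < p. -/
lemma integral_lin_le (h : IsNoise P ε v K) (ha : ∀ k, 0 ≤ a k) (hρ : v * ∑ k, a k ≤ ρ)
    (h0 : 0 < ρ) (h1 : ρ < 1) (t : ℤ) (n k : ℕ) :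
    Integrable (fun ω => lin a (fun i => ε (t + 1 + i) ω) n k) P ∧
      ∫ ω, lin a (fun i => ε (t + 1 + i) ω) n k ∂P ≤ decay p ρ ^ n / decay p ρ ^ k := by
  have hd := decay_pos (p := p) h0
  induction n generalizing k with
  | zero =>
    simp only [lin]
    refine ⟨integrable_const _, ?_⟩
    simp only [integral_const, probReal_univ, smul_eq_mul, mul_one, pow_zero]
    rw [le_div_iff₀ (pow_pos hd _), one_mul]
    exact pow_le_one₀ hd.le (decay_lt_one h1).le
  | succ n ih =>
    cases k with
    | zero =>
      simp only [lin, linStep]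
      have hX : Measurable[pastSigma ε (t + n)]
          fun ω => ∑ j : Fin p, a j * lin a (fun i => ε (t + 1 + i) ω) n j :=
        Finset.measurable_fun_sum _ fun j _ => (measurable_lin ε a t n j).const_mul _
      have hXi : Integrable (fun ω => ∑ j : Fin p, a j * lin a (fun i => ε (t + 1 + i) ω) n j) P :=
        integrable_finsetSum _ fun j _ => ((ih j).1).const_mul _
      have hm := h.integral_mul_sq hX hXi
      rw [show t + (n : ℤ) + 1 = t + 1 + n by ring] at hm
      refine ⟨hm.1, hm.2.trans_le ?_⟩
      rw [integral_finsetSum _ fun (j : Fin p) _ => ((ih j).1).const_mul _]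
      have hle : ∑ j : Fin p, ∫ ω, a j * lin a (fun i => ε (t + 1 + i) ω) n j ∂P ≤
          ∑ j : Fin p, a j * (decay p ρ ^ (n + 1) / ρ) := by
        refine Finset.sum_le_sum fun j _ => ?_
        rw [integral_const_mul]
        refine mul_le_mul_of_nonneg_left ((ih j).2.trans ?_) (ha j)
        rw [div_le_div_iff₀ (pow_pos hd _) h0, pow_succ, mul_assoc, ← pow_succ']
        exact mul_le_mul_of_nonneg_left (le_decay_pow h0 h1 j.2) (pow_nonneg hd.le _)
      refine (mul_le_mul_of_nonneg_left hle h.variance_nonneg).trans ?_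
      rw [← Finset.sum_mul, ← mul_assoc, pow_zero, div_one]
      calc (v * ∑ j, a j) * (decay p ρ ^ (n + 1) / ρ) ≤ ρ * (decay p ρ ^ (n + 1) / ρ) :=
            mul_le_mul_of_nonneg_right hρ (by positivity)
        _ = decay p ρ ^ (n + 1) := mul_div_cancel₀ _ h0.ne'
    | succ k =>
      have := ih k
      refine ⟨this.1, this.2.trans ?_⟩
      rw [pow_succ, pow_succ, mul_div_mul_right _ _ hd.ne']

/-- The bound v / (1 - ρ) is the fixed point of C ↦ v + ρ C. Second moments started at zero cannot
cross it. -/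
lemma integral_sq_sim_le (h : IsNoise P ε v K) (ha : ∀ k, 0 ≤ a k) (hρ : v * ∑ k, a k ≤ ρ)
    (h1 : ρ < 1) (t : ℤ) (n k : ℕ) :
    Integrable (fun ω => sim a (fun i => ε (t + 1 + i) ω) 0 n k ^ 2) P ∧
      ∫ ω, sim a (fun i => ε (t + 1 + i) ω) 0 n k ^ 2 ∂P ≤ v / (1 - ρ) := by
  have hC : 0 ≤ v / (1 - ρ) := div_nonneg h.variance_nonneg (by linarith)
  induction n generalizing k with
  | zero => simp [sim, hC]
  | succ n ih =>
    cases k with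
    | zero =>
      simp only [sim]
      simp_rw [step_zero_sq ha]
      have hX : Measurable[pastSigma ε (t + n)]
          fun ω => 1 + ∑ j : Fin p, a j * sim a (fun i => ε (t + 1 + i) ω) 0 n j ^ 2 :=
        (Finset.measurable_fun_sum _ fun (j : Fin p) _ =>
          ((measurable_sim ε a t n j).pow_const 2).const_mul _).const_add _
      have hXi' : Integrable (fun ω => ∑ j : Fin p, a j *
          sim a (fun i => ε (t + 1 + i) ω) 0 n j ^ 2) P :=
        integrable_finsetSum _ fun j _ => ((ih j).1).const_mul _
      have hXi : Integrable (fun ω => 1 + ∑ j : Fin p, a j *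
          sim a (fun i => ε (t + 1 + i) ω) 0 n j ^ 2) P := (integrable_const _).add hXi'
      have hm := h.integral_mul_sq hX hXi
      rw [show t + (n : ℤ) + 1 = t + 1 + n by ring] at hm
      refine ⟨hm.1, hm.2.trans_le ?_⟩
      rw [integral_add (integrable_const _) hXi', integral_const, probReal_univ,
        integral_finsetSum _ fun (j : Fin p) _ => ((ih j).1).const_mul _, one_smul]
      have hle : ∑ j : Fin p, ∫ ω, a j * sim a (fun i => ε (t + 1 + i) ω) 0 n j ^ 2 ∂P ≤
          ∑ j : Fin p, a j * (v / (1 - ρ)) := by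
        refine Finset.sum_le_sum fun j _ => ?_
        rw [integral_const_mul]
        exact mul_le_mul_of_nonneg_left (ih j).2 (ha j)
      rw [← Finset.sum_mul] at hle
      calc v * (1 + ∑ j : Fin p, ∫ ω, a j * sim a (fun i => ε (t + 1 + i) ω) 0 n j ^ 2 ∂P)
          ≤ v * (1 + (∑ j, a j) * (v / (1 - ρ))) :=
            mul_le_mul_of_nonneg_left (by linarith) h.variance_nonneg
        _ = v + (v * ∑ j, a j) * (v / (1 - ρ)) := by ring
        _ ≤ v + ρ * (v / (1 - ρ)) := by
            have := mul_le_mul_of_nonneg_right hρ hC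
            linarith
        _ = v / (1 - ρ) := by
            have : (1 - ρ) ≠ 0 := by linarith
            field_simp; ring
    | succ k => exact ih k

end IsNoise

/-! ### Stationary solutions: causality, second moments, independence of the future -/

/-- A strictly stationary ARCH process with contraction factor at most `ρ < 1`. -/
structure IsARCH (P : Measure Ω) (ε : ℤ → Ω → ℝ) (v K ρ : ℝ) (a : Vec p) (y : ℤ → Ω → ℝ) :
    Prop where
  noise : IsNoise P ε v K
  nonneg : ∀ k, 0 ≤ a k
  contraction : v * ∑ k, a k ≤ ρ
  rho_pos : 0 < ρ
  rho_lt : ρ < 1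
  solution : IsStationarySolution P ε a y

/-- The approximation of `y_{t-k}` obtained by running the recursion for `m` steps from `0`. -/
def trunc (a : Vec p) (ε : ℤ → Ω → ℝ) (t : ℤ) (m k : ℕ) (ω : Ω) : ℝ :=
  sim a (fun i => ε (t - m + 1 + i) ω) 0 m k

lemma tendsto_measureReal_lt_atTop {P : Measure Ω} [IsFiniteMeasure P] {f : Ω → ℝ}
    (hf : Measurable f) : Tendsto (fun n : ℕ => P.real {ω | (n : ℝ) < f ω}) atTop (𝓝 0) := by
  have h := tendsto_measure_iInter_atTop (μ := P) (s := fun n : ℕ => {ω | (n : ℝ) < f ω})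
    (fun n => (measurableSet_lt measurable_const hf).nullMeasurableSet)
    (fun m n hmn ω hω => by
      change (m : ℝ) < f ω
      exact lt_of_le_of_lt (Nat.cast_le.2 hmn) (show (n : ℝ) < f ω from hω))
    ⟨0, measure_ne_top _ _⟩
  have he : (⋂ n : ℕ, {ω | (n : ℝ) < f ω}) = ∅ := by
    ext ω
    simp only [Set.mem_iInter, Set.mem_ofPred_eq, Set.mem_empty_iff_false, iff_false, not_forall,
      not_lt]
    exact exists_nat_ge (f ω)
  rw [he, measure_empty] at h
  exact (ENNReal.tendsto_toReal ENNReal.zero_ne_top).comp h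

namespace IsARCH

variable {P : Measure Ω} [IsProbabilityMeasure P] {ε : ℤ → Ω → ℝ} {v K ρ : ℝ} {a : Vec p}
  {y : ℤ → Ω → ℝ}

lemma measurable_past (h : IsARCH P ε v K ρ a y) (t : ℤ) :
    Measurable fun ω => past (fun i => y i ω) t :=
  RobustARCH.measurable_past fun s _ => h.solution.measurable s

lemma measurable_past_apply (h : IsARCH P ε v K ρ a y) (t : ℤ) (k : ℕ) :
    Measurable fun ω => past (fun i => y i ω) t k :=
  h.solution.measurable _

lemma measurable_pastSq (h : IsARCH P ε v K ρ a y) (t : ℤ) :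
    Measurable fun ω => pastSq p (past (fun i => y i ω) t) :=
  Finset.measurable_fun_sum _ fun k _ => (h.measurable_past_apply t k).pow_const 2

lemma ae_past_eq_sim (h : IsARCH P ε v K ρ a y) : ∀ᵐ ω ∂P, ∀ (t : ℤ) (n : ℕ),
    past (fun i => y i ω) (t + n) =
      sim a (fun i => ε (t + 1 + i) ω) (past (fun i => y i ω) t) n := by
  filter_upwards [ae_all_iff.2 h.solution.equation] with ω hω t n
  exact past_eq_sim (y := fun i => y i ω) (ε := fun i => ε i ω) hω t n

lemma map_shift (h : IsARCH P ε v K ρ a y) (t : ℤ) :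
    P.map (fun ω (i : ℤ) => y (i + t) ω) = P.map (fun ω (i : ℤ) => y i ω) := by
  have hm : ∀ t : ℤ, Measurable fun ω (i : ℤ) => y (i + t) ω := fun t =>
    measurable_pi_lambda _ fun i => h.solution.measurable _
  have hs : ∀ s : ℤ, Measurable fun (u : ℤ → ℝ) (i : ℤ) => u (i + s) := fun s =>
    measurable_pi_lambda _ fun i => measurable_pi_apply _
  have hc : ∀ s t : ℤ, P.map (fun ω (i : ℤ) => y (i + (t + s)) ω) =
      (P.map (fun ω (i : ℤ) => y (i + t) ω)).map (fun u i => u (i + s)) := by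
    intro s t
    rw [Measure.map_map (hs s) (hm t)]
    congr 1
    funext ω i
    simp only [Function.comp]
    congr 1
    ring
  induction t using Int.induction_on with
  | zero => simp
  | succ n ih =>
    rw [hc, ih, ← h.solution.stationary]
    have := hc 1 0
    simp only [zero_add, add_zero] at this
    rw [h.solution.stationary]
    exact this.symm.trans h.solution.stationary
  | pred n ih =>
    rw [sub_eq_add_neg, hc, ih, ← h.solution.stationary, ← hc (-1) 1, h.solution.stationary]
    simp

lemma map_past (h : IsARCH P ε v K ρ a y) (t : ℤ) :
    P.map (fun ω => past (fun i => y i ω) t) = P.map (fun ω => past (fun i => y i ω) 0) := by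
  have hs : Measurable fun (u : ℤ → ℝ) => past u 0 :=
    measurable_pi_lambda _ fun i => measurable_pi_apply _
  have h1 := congrArg (Measure.map fun u : ℤ → ℝ => past u 0) (h.map_shift t)
  rw [Measure.map_map hs (measurable_pi_lambda _ fun i => h.solution.measurable _),
    Measure.map_map hs (measurable_pi_lambda _ fun i => h.solution.measurable _)] at h1
  rw [show (fun ω => past (fun i => y i ω) 0) = (fun u => past u 0) ∘ fun ω i => y i ω from rfl,
    ← h1]
  congr 1
  funext ω k
  simp only [past, Function.comp]
  congr 1
  ring

lemma measurable_trunc (h : IsARCH P ε v K ρ a y) (t : ℤ) (m k : ℕ) :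
    Measurable (trunc a ε t m k) :=
  measurable_sim_of_le a (fun _ _ => h.noise.measurable _) k

/-- The squared error is at most the size of the past at t - m times the linear recursion. The first
factor is tight because its law does not depend on t - m, and the second is small in mean, so
Markov's inequality applies. No moment of y is needed, which matters since its second moment is
derived from this bound. -/
lemma measureReal_le_sq_sub_trunc (h : IsARCH P ε v K ρ a y) (t : ℤ) (m : ℕ) {k : ℕ} (hk : k ≤ p)
    {κ R : ℝ} (hκ : 0 < κ) (hR : 0 < R) :
    P.real {ω | κ ≤ (past (fun i => y i ω) t k - trunc a ε t m k ω) ^ 2} ≤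
      P.real {ω | R < pastSq p (past (fun i => y i ω) 0)} +
        R / κ * (decay p ρ ^ m / decay p ρ ^ k) := by
  have hlin := h.noise.integral_lin_le h.nonneg h.contraction h.rho_pos h.rho_lt (t - m) m k
  have hsub : {ω | κ ≤ (past (fun i => y i ω) t k - trunc a ε t m k ω) ^ 2} ≤ᵐ[P]
      ({ω | R < pastSq p (past (fun i => y i ω) (t - m))} ∪
        {ω | κ / R ≤ lin a (fun i => ε (t - m + 1 + i) ω) m k} : Set Ω) := by
    filter_upwards [h.ae_past_eq_sim] with ω hω hmem
    have h1 : past (fun i => y i ω) t = sim a (fun i => ε (t - m + 1 + i) ω)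
        (past (fun i => y i ω) (t - m)) m := by
      have := hω (t - m) m
      rwa [sub_add_cancel] at this
    have h2 : κ ≤ (past (fun i => y i ω) t k - trunc a ε t m k ω) ^ 2 := hmem
    rw [h1] at h2
    have h3 := h2.trans (sq_sim_sub_le h.nonneg (fun i => ε (t - m + 1 + i) ω)
      (past (fun i => y i ω) (t - m)) m k hk)
    by_cases hlt : R < pastSq p (past (fun i => y i ω) (t - m))
    · exact Or.inl hlt
    · refine Or.inr ?_
      change κ / R ≤ _
      rw [div_le_iff₀ hR, mul_comm]
      exact h3.trans (mul_le_mul_of_nonneg_right (not_lt.1 hlt) (lin_nonneg h.nonneg _ _ _))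
  have hmeas : P.real {ω | R < pastSq p (past (fun i => y i ω) (t - m))} =
      P.real {ω | R < pastSq p (past (fun i => y i ω) 0)} := by
    have hS : MeasurableSet {π : ℕ → ℝ | R < pastSq p π} :=
      measurableSet_lt measurable_const
        (Finset.measurable_fun_sum _ fun k _ => (measurable_pi_apply k).pow_const 2)
    have := congrArg (fun μ : Measure (ℕ → ℝ) => μ.real {π : ℕ → ℝ | R < pastSq p π})
      (h.map_past (t - m))
    simpa [map_measureReal_apply (h.measurable_past _) hS] using this
  have hmarkov : P.real {ω | κ / R ≤ lin a (fun i => ε (t - m + 1 + i) ω) m k} ≤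
      R / κ * (decay p ρ ^ m / decay p ρ ^ k) := by
    have := (mul_meas_ge_le_integral_of_nonneg
      (ae_of_all P fun ω => lin_nonneg h.nonneg (fun i => ε (t - m + 1 + i) ω) m k)
      hlin.1 (κ / R)).trans hlin.2
    rw [div_mul_eq_mul_div, div_le_iff₀ hR] at this
    rw [div_mul_eq_mul_div, le_div_iff₀ hκ]
    linarith
  calc _ ≤ P.real ({ω | R < pastSq p (past (fun i => y i ω) (t - m))} ∪
        {ω | κ / R ≤ lin a (fun i => ε (t - m + 1 + i) ω) m k}) :=
        ENNReal.toReal_mono (measure_ne_top _ _) (measure_mono_ae hsub)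
    _ ≤ _ := (measureReal_union_le _ _).trans (by rw [hmeas]; gcongr)

lemma tendstoInMeasure_trunc (h : IsARCH P ε v K ρ a y) (t : ℤ) :
    TendstoInMeasure P (fun m => trunc a ε t m 0) atTop (y t) := by
  rw [tendstoInMeasure_iff_measureReal_norm]
  intro κ hκ
  rw [Metric.tendsto_atTop]
  intro δ hδ
  -- Tightness fixes R first; only then is m taken large enough for the geometric factor to beat R.
  have htight := tendsto_measureReal_lt_atTop (P := P) (h.measurable_pastSq 0)
  obtain ⟨N, hN⟩ := (Metric.tendsto_atTop.1 htight) (δ / 2) (by linarith)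
  set R : ℝ := ((N + 1 : ℕ) : ℝ) with hRdef
  have hR : 0 < R := by positivity
  have hlim : Tendsto (fun m : ℕ => R / κ ^ 2 * (decay p ρ ^ m / decay p ρ ^ 0)) atTop (𝓝 0) := by
    have := (tendsto_pow_atTop_nhds_zero_of_lt_one (decay_pos (p := p) h.rho_pos).le
      (decay_lt_one (p := p) h.rho_lt)).const_mul (R / κ ^ 2)
    simpa using this
  obtain ⟨M, hM⟩ := (Metric.tendsto_atTop.1 hlim) (δ / 2) (by linarith)
  refine ⟨M, fun m hm => ?_⟩
  have h1 := h.measureReal_le_sq_sub_trunc t m (Nat.zero_le p) (pow_pos hκ 2) hR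
  have h2 := hN (N + 1) (Nat.le_succ N)
  have h3 := hM m hm
  rw [Real.dist_eq, sub_zero] at h2 h3 ⊢
  have h4 := (abs_lt.1 h2).2
  have h5 := (abs_lt.1 h3).2
  rw [abs_of_nonneg measureReal_nonneg]
  have hset : {ω | κ ≤ ‖trunc a ε t m 0 ω - y t ω‖} =
      {ω | κ ^ 2 ≤ (past (fun i => y i ω) t 0 - trunc a ε t m 0 ω) ^ 2} := by
    ext ω
    simp only [Set.mem_ofPred_eq, past, Nat.cast_zero, sub_zero]
    rw [← sq_abs (y t ω - _), abs_sub_comm, Real.norm_eq_abs]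
    exact (pow_le_pow_iff_left₀ hκ.le (abs_nonneg _) two_ne_zero).symm
  rw [hset]
  linarith

lemma measurable_trunc_pastSigma (ε : ℤ → Ω → ℝ) (a : Vec p) (t : ℤ) (m k : ℕ) :
    Measurable[pastSigma ε t] (trunc a ε t m k) := by
  have := IsNoise.measurable_sim ε a (t - m) m k
  rwa [sub_add_cancel] at this

/-- Causality: y_t is an almost sure limit of truncations that use only innovations up to time t. A
`limsup` picks a version that is exactly measurable. -/
lemma exists_pastSigma_version (h : IsARCH P ε v K ρ a y) (t : ℤ) :
    ∃ y' : Ω → ℝ, Measurable[pastSigma ε t] y' ∧ y t =ᵐ[P] y' := by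
  obtain ⟨ns, -, hns⟩ := (h.tendstoInMeasure_trunc t).exists_seq_tendsto_ae
  refine ⟨fun ω => limsup (fun i => trunc a ε t (ns i) 0 ω) atTop,
    @Measurable.limsup _ _ _ _ _ (pastSigma ε t) _ _ _ _
      (fun i => measurable_trunc_pastSigma ε a t (ns i) 0), ?_⟩
  filter_upwards [hns] with ω hω
  exact hω.limsup_eq.symm

/-- Fatou's lemma along an almost surely convergent subsequence of truncations, whose second moments
are bounded uniformly. -/
lemma integral_sq_le (h : IsARCH P ε v K ρ a y) (t : ℤ) :
    Integrable (fun ω => y t ω ^ 2) P ∧ ∫ ω, y t ω ^ 2 ∂P ≤ v / (1 - ρ) := by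
  obtain ⟨ns, -, hns⟩ := (h.tendstoInMeasure_trunc t).exists_seq_tendsto_ae
  have hC : 0 ≤ v / (1 - ρ) := div_nonneg h.noise.variance_nonneg (by linarith [h.rho_lt])
  have hm : Measurable fun ω => y t ω ^ 2 := (h.solution.measurable t).pow_const 2
  have hle : ∫⁻ ω, ENNReal.ofReal (y t ω ^ 2) ∂P ≤ ENNReal.ofReal (v / (1 - ρ)) := by
    calc ∫⁻ ω, ENNReal.ofReal (y t ω ^ 2) ∂P
        = ∫⁻ ω, liminf (fun i => ENNReal.ofReal (trunc a ε t (ns i) 0 ω ^ 2)) atTop ∂P := by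
          refine lintegral_congr_ae ?_
          filter_upwards [hns] with ω hω
          exact ((ENNReal.continuous_ofReal.tendsto _).comp (hω.pow 2)).liminf_eq.symm
      _ ≤ liminf (fun i => ∫⁻ ω, ENNReal.ofReal (trunc a ε t (ns i) 0 ω ^ 2) ∂P) atTop :=
          lintegral_liminf_le fun i =>
            ENNReal.measurable_ofReal.comp ((h.measurable_trunc t _ _).pow_const 2)
      _ ≤ ENNReal.ofReal (v / (1 - ρ)) := by
          refine liminf_le_of_le (by isBoundedDefault) fun b hb => ?_
          obtain ⟨i, hi⟩ := hb.exists
          refine hi.trans ?_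
          have := h.noise.integral_sq_sim_le h.nonneg h.contraction h.rho_lt (t - ns i) (ns i) 0
          unfold trunc
          rw [← ofReal_integral_eq_lintegral_ofReal this.1 (ae_of_all _ fun _ => sq_nonneg _)]
          exact ENNReal.ofReal_le_ofReal this.2
  have hi : Integrable (fun ω => y t ω ^ 2) P := by
    refine ⟨hm.aestronglyMeasurable, ?_⟩
    rw [hasFiniteIntegral_iff_ofReal (ae_of_all _ fun _ => sq_nonneg _)]
    exact hle.trans_lt ENNReal.ofReal_lt_top
  refine ⟨hi, ?_⟩
  rw [← ENNReal.ofReal_le_ofReal_iff hC,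
    ofReal_integral_eq_lintegral_ofReal hi (ae_of_all _ fun _ => sq_nonneg _)]
  exact hle

lemma integral_pastSq_le (h : IsARCH P ε v K ρ a y) (t : ℤ) :
    Integrable (fun ω => pastSq p (past (fun i => y i ω) t)) P ∧
      ∫ ω, pastSq p (past (fun i => y i ω) t) ∂P ≤ (p + 1) * (v / (1 - ρ)) := by
  unfold pastSq past
  refine ⟨integrable_finsetSum _ fun k _ => (h.integral_sq_le _).1, ?_⟩
  rw [integral_finsetSum _ fun k _ => (h.integral_sq_le _).1]
  refine (Finset.sum_le_sum fun k _ => (h.integral_sq_le _).2).trans ?_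
  simp

lemma measureReal_pastSq_le (h : IsARCH P ε v K ρ a y) (t : ℤ) {R : ℝ} (hR : 0 < R) :
    P.real {ω | R < pastSq p (past (fun i => y i ω) t)} ≤ (p + 1) * (v / (1 - ρ)) / R := by
  have := (mul_meas_ge_le_integral_of_nonneg
    (ae_of_all P fun ω => pastSq_nonneg p (past (fun i => y i ω) t))
    (h.integral_pastSq_le t).1 R).trans (h.integral_pastSq_le t).2
  rw [le_div_iff₀ hR, mul_comm]
  refine le_trans ?_ this
  refine mul_le_mul_of_nonneg_left (measureReal_mono (fun ω hω => ?_) (measure_ne_top _ _)) hR.le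
  exact le_of_lt (show R < pastSq p (past (fun i => y i ω) t) from hω)

/-- The process is a function of past innovations only up to null sets. Independence is proved for
causal versions and transferred by almost sure equality. -/
lemma indepFun_past (h : IsARCH P ε v K ρ a y) (t : ℤ) {β : Type*} [MeasurableSpace β]
    {Z : Ω → β} (hZ : Measurable[futureSigma ε t] Z) :
    IndepFun (fun ω => past (fun i => y i ω) t) Z P := by
  choose y' hy' hyy' using h.exists_pastSigma_version
  have hm : Measurable[pastSigma ε t] fun ω => past (fun i => y' i ω) t :=
    @RobustARCH.measurable_past Ω (pastSigma ε t) y' t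
      fun s hs => (hy' s).mono (pastSigma_mono ε hs) le_rfl
  refine (h.noise.indepFun_of_measurable t hm hZ).congr ?_ (ae_eq_refl _)
  filter_upwards [ae_all_iff.2 hyy'] with ω hω
  funext k
  exact (hω _).symm

end IsARCH

/-! ### Bounded densities of finite windows -/

/-- The first `q` entries of a past. -/
def window (q : ℕ) (π : ℕ → ℝ) : Fin q → ℝ := fun k => π k

lemma measurable_window (q : ℕ) : Measurable (window q) :=
  measurable_pi_lambda _ fun _ => measurable_pi_apply _

/-- Here c will be the volatility: scaling an innovation by a factor at least 1 does not increase
the bound on its density. -/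
lemma lintegral_comp_const_mul_le {c : ℝ} (hc : 1 ≤ c) {f : ℝ → ENNReal} (hf : Measurable f) :
    ∫⁻ z, f (c * z) ≤ ∫⁻ z, f z := by
  have hc0 : c ≠ 0 := by linarith
  rw [← lintegral_map hf (measurable_const_mul c), Real.map_volume_mul_left hc0,
    lintegral_smul_measure, smul_eq_mul]
  refine mul_le_of_le_one_left zero_le ?_
  rw [← ENNReal.ofReal_one]
  refine ENNReal.ofReal_le_ofReal ?_
  rw [abs_of_nonneg (inv_nonneg.2 (by linarith))]
  exact inv_le_one_of_one_le₀ hc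

namespace IsARCH

variable {P : Measure Ω} [IsProbabilityMeasure P] {ε : ℤ → Ω → ℝ} {v K ρ : ℝ} {a : Vec p}
  {y : ℤ → Ω → ℝ}

lemma ae_eq_vol_mul (h : IsARCH P ε v K ρ a y) (t : ℤ) : ∀ᵐ ω ∂P,
    y (t + 1) ω =
      √(1 + ∑ k : Fin p, a k * past (fun i => y i ω) t k ^ 2) * ε (t + 1) ω := by
  filter_upwards [h.solution.equation (t + 1)] with ω hω
  rw [hω, volSq, add_sub_cancel_right]
  rfl

lemma one_le_vol (h : IsARCH P ε v K ρ a y) (π : ℕ → ℝ) :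
    1 ≤ √(1 + ∑ k : Fin p, a k * π k ^ 2) := by
  rw [Real.one_le_sqrt]
  have : 0 ≤ ∑ k : Fin p, a k * π k ^ 2 :=
    Finset.sum_nonneg fun j _ => mul_nonneg (h.nonneg j) (sq_nonneg _)
  linarith

lemma indepFun_past_succ (h : IsARCH P ε v K ρ a y) (t : ℤ) :
    IndepFun (fun ω => past (fun i => y i ω) t) (ε (t + 1)) P :=
  h.indepFun_past t (measurable_futureSigma ε (lt_add_one t))

/-- Conditionally on the past, `y_{t+1}` has a density bounded by `K`. -/
lemma lintegral_succ_past_le (h : IsARCH P ε v K ρ a y) (t : ℤ) {f : ℝ × (ℕ → ℝ) → ENNReal}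
    (hf : Measurable f) :
    ∫⁻ ω, f (y (t + 1) ω, past (fun i => y i ω) t) ∂P ≤
      ENNReal.ofReal K * ∫⁻ ω, ∫⁻ z, f (z, past (fun i => y i ω) t) ∂volume ∂P := by
  set vol : (ℕ → ℝ) → ℝ := fun π => √(1 + ∑ k : Fin p, a k * π k ^ 2) with hvol
  have hvolm : Measurable vol := by fun_prop
  set F : (ℕ → ℝ) × ℝ → ENNReal := fun z => f (vol z.1 * z.2, z.1) with hF
  have hFm : Measurable F := hf.comp
    (((hvolm.comp measurable_fst).mul measurable_snd).prodMk measurable_fst)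
  have hεm := h.noise.measurable (t + 1)
  have hpm := h.measurable_past t
  have : IsProbabilityMeasure (P.map (ε (t + 1))) := Measure.isProbabilityMeasure_map hεm.aemeasurable
  have : IsProbabilityMeasure (P.map fun ω => past (fun i => y i ω) t) :=
    Measure.isProbabilityMeasure_map hpm.aemeasurable
  calc ∫⁻ ω, f (y (t + 1) ω, past (fun i => y i ω) t) ∂P
      = ∫⁻ ω, F (past (fun i => y i ω) t, ε (t + 1) ω) ∂P := by
        refine lintegral_congr_ae ?_
        filter_upwards [h.ae_eq_vol_mul t] with ω hω
        rw [hω]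
    _ = ∫⁻ z, F z ∂(P.map fun ω => (past (fun i => y i ω) t, ε (t + 1) ω)) :=
        (lintegral_map hFm (hpm.prodMk hεm)).symm
    _ = ∫⁻ π, ∫⁻ e, F (π, e) ∂(P.map (ε (t + 1))) ∂(P.map fun ω => past (fun i => y i ω) t) := by
        rw [(h.indepFun_past_succ t).map_prod_eq_prod_map_map hpm.aemeasurable hεm.aemeasurable,
          lintegral_prod _ hFm.aemeasurable]
    _ ≤ ∫⁻ π, ENNReal.ofReal K * ∫⁻ z, f (z, π) ∂volume
          ∂(P.map fun ω => past (fun i => y i ω) t) := by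
        refine lintegral_mono fun π => ?_
        refine (lintegral_mono' (h.noise.law_le (t + 1)) le_rfl).trans ?_
        rw [lintegral_smul_measure, smul_eq_mul]
        refine mul_le_mul_right ?_ _
        exact lintegral_comp_const_mul_le (f := fun z => f (z, π)) (h.one_le_vol π)
          (hf.comp (measurable_id.prodMk measurable_const))
    _ = _ := by
        have hm : Measurable fun π : ℕ → ℝ => ∫⁻ z, f (z, π) ∂volume := hf.lintegral_prod_left'
        rw [lintegral_const_mul _ hm, lintegral_map hm hpm]

/-- Finite windows of the process have a density bounded by a power of `K`. -/
lemma lintegral_window_le (h : IsARCH P ε v K ρ a y) (q : ℕ) (t : ℤ) {f : (Fin q → ℝ) → ENNReal}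
    (hf : Measurable f) :
    ∫⁻ ω, f (window q (past (fun i => y i ω) t)) ∂P ≤ ENNReal.ofReal K ^ q * ∫⁻ u, f u := by
  induction q generalizing t with
  | zero =>
    have : ∀ u : Fin 0 → ℝ, f u = f default := fun u => by rw [Subsingleton.elim u default]
    simp [this, volume_pi]
  | succ q ih =>
    have hcons : Measurable fun z : ℝ × (Fin q → ℝ) => (Fin.cons z.1 z.2 : Fin (q + 1) → ℝ) :=
      measurable_pi_lambda _ fun k => by
        refine Fin.cases ?_ (fun j => ?_) k
        · simpa using measurable_fst
        · simp only [Fin.cons_succ]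
          exact (measurable_pi_apply j).comp measurable_snd
    have hfc := hf.comp hcons
    -- The newest observation is coordinate 0. Integrating it out conditionally on the past costs
    -- one factor K and leaves a window of length q ending at t - 1.
    have hvol : ∫⁻ u, f u = ∫⁻ U : Fin q → ℝ, ∫⁻ z : ℝ, f (Fin.cons z U : Fin (q + 1) → ℝ) := by
      have h1 := (volume_preserving_piFinSuccAbove (fun _ : Fin (q + 1) => ℝ) 0).symm
        |>.lintegral_comp hf
      rw [← h1]
      rw [show (volume : Measure (ℝ × (Fin q → ℝ))) = volume.prod volume from rfl,
        lintegral_prod_symm]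
      · refine lintegral_congr fun U => lintegral_congr fun z => congrArg f ?_
        exact Fin.insertNth_zero' z U
      · exact (hf.comp (MeasurableEquiv.measurable _)).aemeasurable
    have hwin : ∀ ω, window (q + 1) (past (fun i => y i ω) t) =
        Fin.cons (y (t - 1 + 1) ω) (window q (past (fun i => y i ω) (t - 1))) := by
      intro ω
      funext k
      refine Fin.cases ?_ (fun j => ?_) k
      · simp [window, past]
      · simp only [window, past, Fin.val_succ, Fin.cons_succ]
        congr 1
        push_cast; ring
    simp_rw [hwin]
    have hwm : Measurable fun z : ℝ × (ℕ → ℝ) => (z.1, window q z.2) :=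
      measurable_fst.prodMk ((measurable_window q).comp measurable_snd)
    have h2 := h.lintegral_succ_past_le (t - 1) (hfc.comp hwm)
    refine h2.trans ?_
    have hm : Measurable fun U : Fin q → ℝ => ∫⁻ z : ℝ, f (Fin.cons z U : Fin (q + 1) → ℝ) :=
      hfc.lintegral_prod_left'
    have h3 := ih (t - 1) hm
    rw [hvol, pow_succ', mul_assoc]
    gcongr
    exact h3

/-- Windows of the process avoid Lebesgue null sets. -/
lemma ae_window (h : IsARCH P ε v K ρ a y) (q : ℕ) (t : ℤ) {s : (Fin q → ℝ) → Prop}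
    (hs : ∀ᵐ u, s u) : ∀ᵐ ω ∂P, s (window q (past (fun i => y i ω) t)) := by
  obtain ⟨N, hsub, hNm, hN0⟩ := exists_measurable_superset_of_null (ae_iff.1 hs)
  have h1 := h.lintegral_window_le q t (f := N.indicator fun _ => 1)
    (measurable_const.indicator hNm)
  rw [lintegral_indicator_const hNm, hN0, mul_zero, mul_zero, nonpos_iff_eq_zero] at h1
  have hm : Measurable fun ω => window q (past (fun i => y i ω) t) :=
    (measurable_window q).comp (h.measurable_past t)
  have h1 := (lintegral_eq_zero_iff ((measurable_const.indicator hNm).comp hm)).1 h1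
  filter_upwards [h1] with ω hω
  by_contra hc
  have : window q (past (fun i => y i ω) t) ∈ N := hsub hc
  simp [this] at hω

end IsARCH

/-! ### Approximation of the observed window by finitely many innovations -/

/-- The observed window `(y_t, …, y_{t-p})`. -/
def obs (p : ℕ) (y : ℤ → Ω → ℝ) (t : ℤ) (ω : Ω) : Fin (p + 1) → ℝ :=
  window (p + 1) (past (fun i => y i ω) t)

/-- The approximation of `obs` by a function of the last `m` innovations. -/
def obsTrunc (a : Vec p) (ε : ℤ → Ω → ℝ) (t : ℤ) (m : ℕ) (ω : Ω) : Fin (p + 1) → ℝ :=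
  fun k => trunc a ε t m k ω

lemma measurable_obsTrunc_futureSigma (a : Vec p) (ε : ℤ → Ω → ℝ) (t : ℤ) (m : ℕ) :
    Measurable[futureSigma ε (t - m)] (obsTrunc a ε t m) :=
  @measurable_pi_lambda _ _ _ (futureSigma ε (t - m)) _ _
    fun k => IsNoise.measurable_sim_future ε a (t - m) m k

namespace IsARCH

variable {P : Measure Ω} [IsProbabilityMeasure P] {ε : ℤ → Ω → ℝ} {v K ρ : ℝ} {a : Vec p}
  {y : ℤ → Ω → ℝ}

lemma measurable_obs (h : IsARCH P ε v K ρ a y) (t : ℤ) : Measurable (obs p y t) :=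
  (measurable_window (p + 1)).comp (h.measurable_past t)

lemma measurable_obsTrunc (h : IsARCH P ε v K ρ a y) (t : ℤ) (m : ℕ) :
    Measurable (obsTrunc a ε t m) :=
  measurable_pi_lambda _ fun k => h.measurable_trunc t m k

/-- The truncated window uses only innovations after t - m, all of which lie in the future of s. -/
lemma indepFun_obs (h : IsARCH P ε v K ρ a y) {s t : ℤ} {m : ℕ} (hst : s ≤ t - m) :
    IndepFun (obs p y s) (obsTrunc a ε t m) P := by
  have hm := measurable_obsTrunc_futureSigma a ε t m
  have hle : futureSigma ε (t - m) ≤ futureSigma ε s :=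
    biSup_mono fun _ hi => lt_of_le_of_lt hst hi
  exact (h.indepFun_past s (hm.mono hle le_rfl)).comp (measurable_window (p + 1)) measurable_id

lemma map_obs (h : IsARCH P ε v K ρ a y) (t : ℤ) : P.map (obs p y t) = P.map (obs p y 1) := by
  have e : ∀ t, P.map (obs p y t) =
      (P.map fun ω => past (fun i => y i ω) t).map (window (p + 1)) := fun t =>
    (Measure.map_map (measurable_window _) (h.measurable_past t)).symm
  rw [e, e, h.map_past t, h.map_past 1]

lemma pastSq_le_of_norm (π : ℕ → ℝ) {R : ℝ} (hR : 0 ≤ R) (h : R < ‖window (p + 1) π‖) :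
    R ^ 2 < pastSq p π := by
  by_contra hc
  refine absurd h (not_lt.2 ((pi_norm_le_iff_of_nonneg hR).2 fun k => ?_))
  rw [Real.norm_eq_abs]
  refine abs_le_of_sq_le_sq (le_trans ?_ (not_lt.1 hc)) hR
  exact Finset.single_le_sum (f := fun k => π k ^ 2) (fun i _ => sq_nonneg _)
    (Finset.mem_range.2 k.2)

lemma measureReal_norm_obs_le (h : IsARCH P ε v K ρ a y) (t : ℤ) {R : ℝ} (hR : 0 < R) :
    P.real {ω | R < ‖obs p y t ω‖} ≤ (p + 1) * (v / (1 - ρ)) / R ^ 2 := by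
  refine le_trans (measureReal_mono (fun ω hω => ?_) (measure_ne_top _ _))
    (h.measureReal_pastSq_le t (pow_pos hR 2))
  exact pastSq_le_of_norm _ hR.le (show R < ‖obs p y t ω‖ from hω)

/-- The truncation error tends to zero in probability, uniformly over all ARCH processes with
contraction factor at most `ρ`. -/
lemma exists_trunc (p : ℕ) (P : Measure Ω) [IsProbabilityMeasure P] (ε : ℤ → Ω → ℝ) (v K ρ : ℝ)
    {κ δ : ℝ} (hκ : 0 < κ) (hδ : 0 < δ) :
    ∃ m : ℕ, ∀ (a : Vec p) (y : ℤ → Ω → ℝ), IsARCH P ε v K ρ a y → ∀ t,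
      P.real {ω | κ ≤ ‖obs p y t ω - obsTrunc a ε t m ω‖} ≤ δ := by
  -- Outside this range no process satisfies `IsARCH`, so the claim is vacuous.
  by_cases hex : 0 < ρ ∧ ρ < 1
  swap
  · exact ⟨0, fun a y h => (hex ⟨h.rho_pos, h.rho_lt⟩).elim⟩
  obtain ⟨h0, h1⟩ := hex
  set C : ℝ := (p + 1) * (v / (1 - ρ)) with hC
  -- Makes each of the p + 1 tail probabilities at most δ / (2(p + 1)), half of the budget in total;
  -- the summand 1 keeps R positive.
  set R : ℝ := 2 * (p + 1) * |C| / δ + 1 with hRdef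
  have hR : 0 < R := by positivity
  have hd := decay_pos (p := p) h0
  have hlim : Tendsto (fun m : ℕ => (p + 1) * (R / κ ^ 2 * (decay p ρ ^ m / decay p ρ ^ p)))
      atTop (𝓝 0) := by
    have := (tendsto_pow_atTop_nhds_zero_of_lt_one hd.le
      (decay_lt_one (p := p) h1)).const_mul ((p + 1) * (R / κ ^ 2) / decay p ρ ^ p)
    rw [mul_zero] at this
    refine this.congr fun m => ?_
    ring
  obtain ⟨m, hm⟩ := ((tendsto_order.1 hlim).2 (δ / 2) (by linarith)).exists
  refine ⟨m, fun a y h t => ?_⟩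
  have hsub : {ω | κ ≤ ‖obs p y t ω - obsTrunc a ε t m ω‖} ⊆
      ⋃ k : Fin (p + 1), {ω | κ ^ 2 ≤ (past (fun i => y i ω) t k - trunc a ε t m k ω) ^ 2} := by
    intro ω hω
    have hω' : κ ≤ ‖obs p y t ω - obsTrunc a ε t m ω‖ := hω
    by_contra hc
    refine absurd hω' (not_le.2 ((pi_norm_lt_iff hκ).2 fun k => ?_))
    rw [Set.mem_iUnion, not_exists] at hc
    have hck : ¬ κ ^ 2 ≤ (past (fun i => y i ω) t k - trunc a ε t m k ω) ^ 2 := hc k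
    rw [Real.norm_eq_abs]
    exact abs_lt_of_sq_lt_sq (not_le.1 hck) hκ.le
  have hCR : C / R ≤ δ / (2 * (p + 1)) := by
    rw [div_le_div_iff₀ hR (by positivity), hRdef]
    have : δ * (2 * (p + 1) * |C| / δ + 1) = 2 * (p + 1) * |C| + δ := by field_simp
    rw [this]
    have := le_abs_self C
    have hp : (0 : ℝ) ≤ 2 * (p + 1) := by positivity
    nlinarith
  calc _ ≤ P.real (⋃ k : Fin (p + 1),
        {ω | κ ^ 2 ≤ (past (fun i => y i ω) t k - trunc a ε t m k ω) ^ 2}) :=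
        measureReal_mono hsub (measure_ne_top _ _)
    _ ≤ ∑ k : Fin (p + 1), P.real
        {ω | κ ^ 2 ≤ (past (fun i => y i ω) t k - trunc a ε t m k ω) ^ 2} :=
        measureReal_iUnion_fintype_le _
    _ ≤ ∑ k : Fin (p + 1), (δ / (2 * (p + 1)) + R / κ ^ 2 * (decay p ρ ^ m / decay p ρ ^ p)) := by
        refine Finset.sum_le_sum fun k _ => ?_
        refine (h.measureReal_le_sq_sub_trunc t m (Nat.lt_succ_iff.1 k.2) (pow_pos hκ 2) hR).trans ?_
        refine add_le_add ((h.measureReal_pastSq_le 0 hR).trans hCR) ?_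
        have : decay p ρ ^ p ≤ decay p ρ ^ (k : ℕ) :=
          pow_le_pow_of_le_one hd.le (decay_lt_one (p := p) h1).le (Nat.lt_succ_iff.1 k.2)
        gcongr
    _ = δ / 2 + (p + 1) * (R / κ ^ 2 * (decay p ρ ^ m / decay p ρ ^ p)) := by
        rw [Finset.sum_const, Finset.card_univ, Fintype.card_fin, nsmul_eq_mul]
        push_cast
        field_simp
    _ ≤ δ := by linarith

end IsARCH

/-! ### Weak law of large numbers for a fixed function, uniform over the processes -/

/-- A quantitative weak law of large numbers for bounded, asymptotically orthogonal sequences. -/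
lemma integral_abs_avg_le {α : Type*} [MeasurableSpace α] (μ : Measure α) [IsFiniteMeasure μ]
    {H : ℤ → α → ℝ} {B δ τ : ℝ} {m n : ℕ} (hH : ∀ t, Measurable (H t)) (hB : ∀ t z, |H t z| ≤ B)
    (hδ : 0 ≤ δ) (hτ : 0 < τ) (hn : 0 < n)
    (horth : ∀ s t : ℤ, s ≤ t - m → |∫ z, H s z * H t z ∂μ| ≤ δ) :
    ∫ z, |(n : ℝ)⁻¹ * ∑ t ∈ Finset.Icc (1 : ℤ) n, H t z| ∂μ ≤
      τ * μ.real Set.univ + (δ + 2 * m * (B ^ 2 * μ.real Set.univ) / n) / τ := by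
  set T := Finset.Icc (1 : ℤ) n with hT
  have hcard : T.card = n := by simp [hT]
  set Z : α → ℝ := fun z => (n : ℝ)⁻¹ * ∑ t ∈ T, H t z with hZ
  have hn' : (0 : ℝ) < n := Nat.cast_pos.2 hn
  have hBsq : ∀ s t z, |H s z * H t z| ≤ B ^ 2 := fun s t z => by
    rw [abs_mul, sq]
    exact mul_le_mul (hB s z) (hB t z) (abs_nonneg _) ((abs_nonneg _).trans (hB s z))
  have hint : ∀ s t, Integrable (fun z => H s z * H t z) μ := fun s t =>
    Integrable.of_bound ((hH s).mul (hH t)).aestronglyMeasurable (B ^ 2)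
      (ae_of_all _ fun z => hBsq s t z)
  have hZsq : ∀ z, Z z ^ 2 = (n : ℝ)⁻¹ ^ 2 * ∑ s ∈ T, ∑ t ∈ T, H s z * H t z := fun z => by
    simp only [hZ, mul_pow]
    rw [sq (∑ t ∈ T, H t z), Finset.sum_mul_sum]
  have hZi : Integrable (fun z => Z z ^ 2) μ := by
    simp_rw [hZsq]
    exact (integrable_finsetSum _ fun s _ => integrable_finsetSum _ fun t _ => hint s t).const_mul _
  -- Pairs at distance at least m use near orthogonality. The remaining pairs, at most 2m for each
  -- s, get the trivial bound and are negligible after division by n².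
  have hterm : ∀ s t, ∫ z, H s z * H t z ∂μ ≤
      δ + if t - s < m ∧ s - t < m then B ^ 2 * μ.real Set.univ else 0 := by
    intro s t
    split_ifs with hst
    · have := norm_integral_le_of_norm_le_const (μ := μ)
        (f := fun z => H s z * H t z) (C := B ^ 2) (ae_of_all _ fun z => hBsq s t z)
      have := (le_abs_self _).trans this
      linarith
    · rw [add_zero]
      rw [not_and_or, not_lt, not_lt] at hst
      rcases hst with h | h
      · exact (le_abs_self _).trans (horth s t (by omega))
      · simp_rw [mul_comm (H s _)]
        exact (le_abs_self _).trans (horth t s (by omega))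
  have hcount : ∀ s : ℤ, ((T.filter fun t => t - s < m ∧ s - t < m).card : ℝ) ≤ 2 * m := by
    intro s
    have hsub : (T.filter fun t => t - s < m ∧ s - t < m) ⊆ Finset.Ico (s - m) (s + m) := by
      intro t ht
      rw [Finset.mem_filter] at ht
      rw [Finset.mem_Ico]
      omega
    have := Finset.card_le_card hsub
    rw [Int.card_Ico] at this
    have h2 : (s + (m : ℤ) - (s - m)).toNat = 2 * m := by omega
    rw [h2] at this
    exact_mod_cast this
  have hBF : 0 ≤ B ^ 2 * μ.real Set.univ := by positivity
  have hZint : ∫ z, Z z ^ 2 ∂μ ≤ δ + 2 * m * (B ^ 2 * μ.real Set.univ) / n := by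
    simp_rw [hZsq]
    rw [integral_const_mul, integral_finsetSum _ fun s _ => integrable_finsetSum _ fun t _ => hint s t]
    simp_rw [integral_finsetSum T fun t _ => hint _ t]
    calc _ ≤ (n : ℝ)⁻¹ ^ 2 * ∑ s ∈ T, (n * δ + 2 * m * (B ^ 2 * μ.real Set.univ)) := by
          gcongr with s hs
          calc ∑ t ∈ T, ∫ z, H s z * H t z ∂μ
              ≤ ∑ t ∈ T, (δ + if t - s < m ∧ s - t < m then B ^ 2 * μ.real Set.univ else 0) :=
                Finset.sum_le_sum fun t _ => hterm s t
            _ = n * δ + (T.filter fun t => t - s < m ∧ s - t < m).card *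
                  (B ^ 2 * μ.real Set.univ) := by
                rw [Finset.sum_add_distrib, Finset.sum_const, hcard, nsmul_eq_mul,
                  ← Finset.sum_filter, Finset.sum_const, nsmul_eq_mul]
            _ ≤ _ := by
                have := mul_le_mul_of_nonneg_right (hcount s) hBF
                linarith
      _ = _ := by
          rw [Finset.sum_const, hcard, nsmul_eq_mul]
          field_simp
  -- Passes from the second moment to the first; the free parameter τ replaces a square root.
  have hpt : ∀ z, |Z z| ≤ τ + Z z ^ 2 / τ := by
    intro z
    rw [← sq_abs (Z z)]
    have hs := abs_nonneg (Z z)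
    rw [← sub_le_iff_le_add', le_div_iff₀ hτ]
    nlinarith [sq_nonneg (|Z z| - τ)]
  calc ∫ z, |Z z| ∂μ ≤ ∫ z, (τ + Z z ^ 2 / τ) ∂μ :=
        integral_mono_of_nonneg (ae_of_all _ fun z => abs_nonneg _)
          ((integrable_const _).add (hZi.div_const _)) (ae_of_all _ hpt)
    _ = τ * μ.real Set.univ + (∫ z, Z z ^ 2 ∂μ) / τ := by
        rw [integral_add (integrable_const _) (hZi.div_const _), integral_const, integral_div,
          smul_eq_mul, mul_comm]
    _ ≤ _ := by gcongr

namespace IsARCH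

variable {P : Measure Ω} [IsProbabilityMeasure P] {ε : ℤ → Ω → ℝ} {v K ρ : ℝ} {a : Vec p}
  {y : ℤ → Ω → ℝ}

lemma measurable_obs_prod (h : IsARCH P ε v K ρ a y) (t : ℤ) :
    Measurable fun z : Ω × ℝ => (obs p y t z.1, z.2) :=
  ((h.measurable_obs t).comp measurable_fst).prodMk measurable_snd

lemma measurable_obsTrunc_prod (h : IsARCH P ε v K ρ a y) (t : ℤ) (m : ℕ) :
    Measurable fun z : Ω × ℝ => (obsTrunc a ε t m z.1, z.2) :=
  ((h.measurable_obsTrunc t m).comp measurable_fst).prodMk measurable_snd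

lemma lintegral_obs_prod_le (h : IsARCH P ε v K ρ a y) (F : Measure ℝ) [IsFiniteMeasure F] (t : ℤ)
    {f : (Fin (p + 1) → ℝ) × ℝ → ENNReal} (hf : Measurable f) :
    ∫⁻ z, f (obs p y t z.1, z.2) ∂(P.prod F) ≤
      ENNReal.ofReal K ^ (p + 1) * ∫⁻ z, f z ∂(volume.prod F) := by
  refine (lintegral_prod_symm _ (hf.comp (h.measurable_obs_prod t)).aemeasurable).trans_le ?_
  rw [lintegral_prod_symm _ hf.aemeasurable,
    ← lintegral_const_mul _ hf.lintegral_prod_left']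
  exact lintegral_mono fun x => h.lintegral_window_le (p + 1) t
    (hf.comp (measurable_id.prodMk measurable_const))

/-- A bounded measurable function of the observed window is close in mean to a continuous function
of finitely many innovations, uniformly over all ARCH processes. -/
lemma exists_approx (P : Measure Ω) [IsProbabilityMeasure P] (ε : ℤ → Ω → ℝ) (v K ρ : ℝ)
    (F : Measure ℝ) [IsFiniteMeasure F] {h : (Fin (p + 1) → ℝ) × ℝ → ℝ} (hm : Measurable h)
    {C : ℝ} (hC : ∀ z, |h z| ≤ C) {δ : ℝ} (hδ : 0 < δ) :
    ∃ (m : ℕ) (Q : (Fin (p + 1) → ℝ) × ℝ → ℝ) (B : ℝ), Continuous Q ∧ (∀ z, |Q z| ≤ B) ∧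
      ∀ (a : Vec p) (y : ℤ → Ω → ℝ), IsARCH P ε v K ρ a y → ∀ t,
        ∫ z, |h (obs p y t z.1, z.2) - Q (obsTrunc a ε t m z.1, z.2)| ∂(P.prod F) ≤ δ := by
  have hC0 : 0 ≤ C := (abs_nonneg _).trans (hC 0)
  set f := F.real Set.univ with hf
  have hf0 : 0 ≤ f := measureReal_nonneg
  set D : ℝ := (p + 1) * (v / (1 - ρ)) with hD
  -- a cut-off radius
  obtain ⟨R, hR, hRD⟩ : ∃ R : ℝ, 0 < R ∧ C * f * (D / R ^ 2) ≤ δ / 4 := by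
    have hlim : Tendsto (fun R : ℝ => C * f * (D / R ^ 2)) atTop (𝓝 0) := by
      have : Tendsto (fun R : ℝ => D / R ^ 2) atTop (𝓝 0) :=
        tendsto_const_nhds.div_atTop (tendsto_pow_atTop two_ne_zero)
      simpa using this.const_mul (C * f)
    obtain ⟨R, h1, h2⟩ := (((tendsto_order.1 hlim).2 (δ / 4) (by linarith)).and
      (eventually_gt_atTop 0)).exists
    exact ⟨R, h2, h1.le⟩
  set S : Set ((Fin (p + 1) → ℝ) × ℝ) := Metric.closedBall 0 R ×ˢ Set.univ with hS
  have hSm : MeasurableSet S := measurableSet_closedBall.prod MeasurableSet.univ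
  have hSfin : (volume.prod F) S < ⊤ := by
    rw [hS, Measure.prod_prod]
    exact ENNReal.mul_lt_top measure_closedBall_lt_top (measure_lt_top _ _)
  have hint : Integrable (S.indicator h) (volume.prod F) := by
    rw [integrable_indicator_iff hSm]
    exact IntegrableOn.of_bound hSfin hm.aestronglyMeasurable C (ae_of_all _ hC)
  -- Offsets the factor K^(p+1) incurred when an integral over the window is bounded by a Lebesgue
  -- integral.
  set κ' : ℝ := δ / 4 / (|K| + 1) ^ (p + 1) with hκ'
  have hκ'0 : 0 < κ' := by positivity
  obtain ⟨Q, hQc, hQd, hQcont, hQi⟩ := hint.exists_hasCompactSupport_lintegral_sub_le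
    (ε := ENNReal.ofReal κ') (by simpa using hκ'0)
  obtain ⟨B, hB⟩ := hQc.exists_bound_of_continuous hQcont
  have hB0 : 0 ≤ B := (norm_nonneg _).trans (hB 0)
  -- By uniform continuity, exchanging the window for its truncation costs little unless the two are
  -- at least r apart, an event that is rare for large m.
  have huc : UniformContinuous Q := hQc.uniformContinuous_of_continuous hQcont
  obtain ⟨r, hr, hQr⟩ := Metric.uniformContinuous_iff.1 huc (δ / 4 / (f + 1)) (by positivity)
  obtain ⟨m, hmt⟩ := exists_trunc p P ε v K ρ hr (δ := δ / 4 / (2 * B * f + 1)) (by positivity)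
  refine ⟨m, Q, B, hQcont, hB, fun a y hy t => ?_⟩
  have hX := hy.measurable_obs_prod t
  have hXm := hy.measurable_obsTrunc_prod t m
  have hindm : Measurable (S.indicator h) := hm.indicator hSm
  have hindC : ∀ z, |S.indicator h z| ≤ C := fun z => by
    by_cases hz : z ∈ S <;> simp [hz, hC z, hC0]
  have i1 : Integrable (fun z : Ω × ℝ => |h (obs p y t z.1, z.2) -
      S.indicator h (obs p y t z.1, z.2)|) (P.prod F) :=
    Integrable.of_bound ((hm.comp hX).sub (hindm.comp hX)).abs.aestronglyMeasurable (C + C)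
      (ae_of_all _ fun z => by
        rw [Real.norm_eq_abs, abs_abs]
        exact (abs_sub _ _).trans (add_le_add (hC _) (hindC _)))
  have i2 : Integrable (fun z : Ω × ℝ => |S.indicator h (obs p y t z.1, z.2) -
      Q (obs p y t z.1, z.2)|) (P.prod F) :=
    Integrable.of_bound ((hindm.comp hX).sub
        (hQcont.measurable.comp hX)).abs.aestronglyMeasurable (C + B)
      (ae_of_all _ fun z => by
        rw [Real.norm_eq_abs, abs_abs]
        exact (abs_sub _ _).trans (add_le_add (hindC _) (hB _)))
  have i3 : Integrable (fun z : Ω × ℝ => |Q (obs p y t z.1, z.2) -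
      Q (obsTrunc a ε t m z.1, z.2)|) (P.prod F) :=
    Integrable.of_bound ((hQcont.measurable.comp hX).sub
        (hQcont.measurable.comp hXm)).abs.aestronglyMeasurable (B + B)
      (ae_of_all _ fun z => by
        rw [Real.norm_eq_abs, abs_abs]
        exact (abs_sub _ _).trans (add_le_add (hB _) (hB _)))
  have hprod : ∀ (A : Set Ω), MeasurableSet A →
      (P.prod F).real (A ×ˢ Set.univ) = P.real A * f := fun A _ => by
    rw [measureReal_prod_prod]
  -- cutting off
  have b1 : ∫ z : Ω × ℝ, |h (obs p y t z.1, z.2) - S.indicator h (obs p y t z.1, z.2)|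
      ∂(P.prod F) ≤ δ / 4 := by
    set A : Set Ω := {ω | R < ‖obs p y t ω‖} with hA
    have hAm : MeasurableSet A := measurableSet_lt measurable_const (hy.measurable_obs t).norm
    have hle : ∀ z : Ω × ℝ, |h (obs p y t z.1, z.2) - S.indicator h (obs p y t z.1, z.2)| ≤
        (A ×ˢ (Set.univ : Set ℝ)).indicator (fun _ => C) z := by
      intro z
      by_cases hz : (obs p y t z.1, z.2) ∈ S
      · rw [Set.indicator_of_mem hz, sub_self, abs_zero]
        exact Set.indicator_nonneg (fun _ _ => hC0) _
      · rw [Set.indicator_of_notMem hz, sub_zero]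
        have : z ∈ A ×ˢ (Set.univ : Set ℝ) := by
          refine ⟨?_, Set.mem_univ _⟩
          by_contra hc
          refine hz ⟨?_, Set.mem_univ _⟩
          rw [Metric.mem_closedBall, dist_zero_right]
          exact not_lt.1 hc
        rw [Set.indicator_of_mem this]
        exact hC _
    calc _ ≤ ∫ z, (A ×ˢ (Set.univ : Set ℝ)).indicator (fun _ => C) z ∂(P.prod F) :=
          integral_mono i1 ((integrable_const C).indicator (hAm.prod MeasurableSet.univ)) hle
      _ = P.real A * f * C := by
          rw [integral_indicator_const _ (hAm.prod MeasurableSet.univ), hprod A hAm, smul_eq_mul]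
      _ ≤ D / R ^ 2 * f * C := by
          gcongr
          exact hy.measureReal_norm_obs_le t hR
      _ ≤ δ / 4 := by linarith
  -- approximation in mean
  have b2 : ∫ z : Ω × ℝ, |S.indicator h (obs p y t z.1, z.2) - Q (obs p y t z.1, z.2)|
      ∂(P.prod F) ≤ δ / 4 := by
    have hmeas : Measurable fun z => ‖S.indicator h z - Q z‖ₑ :=
      (hindm.sub hQcont.measurable).enorm
    have h1 := (hy.lintegral_obs_prod_le F t hmeas).trans
      (mul_le_mul_right hQd (ENNReal.ofReal K ^ (p + 1)))
    rw [← ENNReal.ofReal_le_ofReal_iff (by linarith),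
      ofReal_integral_eq_lintegral_ofReal i2 (ae_of_all _ fun _ => abs_nonneg _)]
    calc _ = ∫⁻ z : Ω × ℝ, ‖S.indicator h (obs p y t z.1, z.2) - Q (obs p y t z.1, z.2)‖ₑ
          ∂(P.prod F) := by
          refine lintegral_congr fun z => ?_
          rw [← Real.norm_eq_abs, ofReal_norm]
      _ ≤ _ := h1
      _ ≤ ENNReal.ofReal ((|K| + 1) ^ (p + 1)) * ENNReal.ofReal κ' := by
          rw [ENNReal.ofReal_pow (by positivity)]
          gcongr
          linarith [le_abs_self K]
      _ = ENNReal.ofReal (δ / 4) := by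
          rw [← ENNReal.ofReal_mul (by positivity), hκ', mul_div_cancel₀ _ (by positivity)]
  -- truncation
  have b3 : ∫ z : Ω × ℝ, |Q (obs p y t z.1, z.2) - Q (obsTrunc a ε t m z.1, z.2)| ∂(P.prod F) ≤
      δ / 2 := by
    set A : Set Ω := {ω | r ≤ ‖obs p y t ω - obsTrunc a ε t m ω‖} with hA
    have hAm : MeasurableSet A := measurableSet_le measurable_const
      ((hy.measurable_obs t).sub (hy.measurable_obsTrunc t m)).norm
    have hle : ∀ z : Ω × ℝ, |Q (obs p y t z.1, z.2) - Q (obsTrunc a ε t m z.1, z.2)| ≤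
        δ / 4 / (f + 1) + (A ×ˢ (Set.univ : Set ℝ)).indicator (fun _ => 2 * B) z := by
      intro z
      by_cases hz : z.1 ∈ A
      · have : z ∈ A ×ˢ (Set.univ : Set ℝ) := ⟨hz, Set.mem_univ _⟩
        rw [Set.indicator_of_mem this]
        have h1 : 0 ≤ δ / 4 / (f + 1) := by positivity
        have h2 := (abs_sub (Q (obs p y t z.1, z.2)) (Q (obsTrunc a ε t m z.1, z.2))).trans
          (add_le_add (hB _) (hB _))
        linarith
      · have h1 : 0 ≤ (A ×ˢ (Set.univ : Set ℝ)).indicator (fun _ => 2 * B) z :=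
          Set.indicator_nonneg (fun _ _ => by linarith) _
        have h2 : dist (obs p y t z.1, z.2) (obsTrunc a ε t m z.1, z.2) < r := by
          rw [Prod.dist_eq, dist_self, max_eq_left dist_nonneg, dist_eq_norm]
          exact not_le.1 hz
        have h3 := (hQr h2).le
        rw [Real.dist_eq] at h3
        linarith
    have iA : Integrable ((A ×ˢ (Set.univ : Set ℝ)).indicator fun _ => 2 * B) (P.prod F) :=
      (integrable_const _).indicator (hAm.prod MeasurableSet.univ)
    have huniv : (P.prod F).real Set.univ = f := by
      rw [← Set.univ_prod_univ, hprod _ MeasurableSet.univ, probReal_univ, one_mul]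
    calc _ ≤ ∫ z, (δ / 4 / (f + 1) + (A ×ˢ (Set.univ : Set ℝ)).indicator (fun _ => 2 * B) z)
          ∂(P.prod F) := integral_mono i3 ((integrable_const _).add iA) hle
      _ = f * (δ / 4 / (f + 1)) + P.real A * f * (2 * B) := by
          rw [integral_add (integrable_const _) iA, integral_const, huniv, smul_eq_mul,
            integral_indicator_const _ (hAm.prod MeasurableSet.univ), hprod A hAm, smul_eq_mul]
      _ ≤ δ / 4 + δ / 4 := by
          refine add_le_add ?_ ?_
          · rw [mul_div_assoc', div_le_iff₀ (by positivity)]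
            nlinarith
          · have h1 := mul_le_mul_of_nonneg_right (hmt a y hy t) (by positivity : 0 ≤ 2 * B * f)
            have h2 : δ / 4 / (2 * B * f + 1) * (2 * B * f) ≤ δ / 4 := by
              rw [div_mul_eq_mul_div, div_le_iff₀ (by positivity)]
              nlinarith
            have h3 : P.real A * f * (2 * B) = P.real A * (2 * B * f) := by ring
            rw [h3]
            exact h1.trans h2
      _ = δ / 2 := by ring
  calc _ ≤ ∫ z : Ω × ℝ, (|h (obs p y t z.1, z.2) - S.indicator h (obs p y t z.1, z.2)| +
          |S.indicator h (obs p y t z.1, z.2) - Q (obs p y t z.1, z.2)| +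
          |Q (obs p y t z.1, z.2) - Q (obsTrunc a ε t m z.1, z.2)|) ∂(P.prod F) := by
        refine integral_mono_of_nonneg (ae_of_all _ fun _ => abs_nonneg _) ((i1.add i2).add i3)
          (ae_of_all _ fun z => ?_)
        exact (abs_sub_le _ (Q (obs p y t z.1, z.2)) _).trans
          (add_le_add_left (abs_sub_le _ _ _) _)
    _ = _ := (integral_add (i1.add i2) i3).trans (congrArg (· + _) (integral_add i1 i2))
    _ ≤ δ := by linarith

end IsARCH

namespace IsARCH

variable {P : Measure Ω} [IsProbabilityMeasure P] {ε : ℤ → Ω → ℝ} {v K ρ : ℝ} {a : Vec p}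
  {y : ℤ → Ω → ℝ}

lemma integral_obs (h : IsARCH P ε v K ρ a y) (t : ℤ) {E : Type*} [NormedAddCommGroup E]
    [NormedSpace ℝ E] {f : (Fin (p + 1) → ℝ) → E} (hf : StronglyMeasurable f) :
    ∫ ω, f (obs p y t ω) ∂P = ∫ ω, f (obs p y 1 ω) ∂P := by
  rw [← integral_map (h.measurable_obs t).aemeasurable hf.aestronglyMeasurable, h.map_obs t,
    integral_map (h.measurable_obs 1).aemeasurable hf.aestronglyMeasurable]

lemma measurable_integral_obs (h : IsARCH P ε v K ρ a y) {f : (Fin (p + 1) → ℝ) × ℝ → ℝ}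
    (hf : Measurable f) (t : ℤ) : Measurable fun x => ∫ ω, f (obs p y t ω, x) ∂P := by
  have : StronglyMeasurable fun z : Ω × ℝ => f (obs p y t z.1, z.2) :=
    (hf.comp (h.measurable_obs_prod t)).stronglyMeasurable
  exact this.integral_prod_left'.measurable

lemma abs_integral_obs_le {f : (Fin (p + 1) → ℝ) × ℝ → ℝ}
    {C : ℝ} (hC : ∀ z, |f z| ≤ C) (y : ℤ → Ω → ℝ) (t : ℤ) (x : ℝ) :
    |∫ ω, f (obs p y t ω, x) ∂P| ≤ C := by
  have := norm_integral_le_of_norm_le_const (μ := P) (f := fun ω => f (obs p y t ω, x)) (C := C)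
    (ae_of_all _ fun ω => hC _)
  simpa using this

/-- A weak law of large numbers, uniform over all ARCH processes with contraction factor at most
`ρ`; the extra variable is averaged with respect to a finite measure. -/
theorem exists_lln (P : Measure Ω) [IsProbabilityMeasure P] (ε : ℤ → Ω → ℝ) (v K ρ : ℝ)
    (F : Measure ℝ) [IsFiniteMeasure F] {h : (Fin (p + 1) → ℝ) × ℝ → ℝ} (hm : Measurable h)
    {C : ℝ} (hC : ∀ z, |h z| ≤ C) {κ : ℝ} (hκ : 0 < κ) :
    ∃ N : ℕ, ∀ n : ℕ, N < n → ∀ (a : Vec p) (y : ℤ → Ω → ℝ), IsARCH P ε v K ρ a y →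
      ∫ z : Ω × ℝ, |(n : ℝ)⁻¹ * ∑ t ∈ Finset.Icc (1 : ℤ) n, h (obs p y t z.1, z.2) -
        ∫ ω, h (obs p y 1 ω, z.2) ∂P| ∂(P.prod F) ≤ κ := by
  have hC0 : 0 ≤ C := (abs_nonneg _).trans (hC 0)
  set f := F.real Set.univ with hf
  have hf0 : 0 ≤ f := measureReal_nonneg
  set τ : ℝ := κ / 4 / (f + 1) with hτdef
  have hτ : 0 < τ := by positivity
  -- Gives 2Cδ ≤ κτ/4. With τ f ≤ κ/4 and the near-diagonal term below κτ/4, the final bound is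
  -- 3κ/4.
  set δ : ℝ := κ * τ / 4 / (2 * C + 1) with hδdef
  have hδ : 0 < δ := by positivity
  obtain ⟨m, Q, B, hQc, hQB, happ⟩ := exists_approx (p := p) P ε v K ρ F hm hC hδ
  have hlim : Tendsto (fun n : ℕ => 2 * m * ((2 * C) ^ 2 * f) / (n : ℝ)) atTop (𝓝 0) :=
    tendsto_const_nhds.div_atTop tendsto_natCast_atTop_atTop
  obtain ⟨N, hN⟩ := eventually_atTop.1 ((tendsto_order.1 hlim).2 (κ * τ / 4) (by positivity))
  refine ⟨N, fun n hn a y hy => ?_⟩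
  set μ : ℝ → ℝ := fun x => ∫ ω, h (obs p y 1 ω, x) ∂P with hμ
  have hμm : Measurable μ := hy.measurable_integral_obs hm 1
  have hμC : ∀ x, |μ x| ≤ C := fun x => abs_integral_obs_le hC y 1 x
  set H : ℤ → Ω × ℝ → ℝ := fun t z => h (obs p y t z.1, z.2) - μ z.2 with hH
  have hHm : ∀ t, Measurable (H t) := fun t =>
    (hm.comp (hy.measurable_obs_prod t)).sub (hμm.comp measurable_snd)
  have hHB : ∀ t z, |H t z| ≤ 2 * C := fun t z =>
    (abs_sub _ _).trans (by linarith [hC (obs p y t z.1, z.2), hμC z.2])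
  have huniv : (P.prod F).real Set.univ = f := by
    rw [← Set.univ_prod_univ, measureReal_prod_prod, probReal_univ, one_mul]
  have horth : ∀ s t : ℤ, s ≤ t - m → |∫ z, H s z * H t z ∂(P.prod F)| ≤ 2 * C * δ := by
    intro s t hst
    have hXm := hy.measurable_obsTrunc_prod t m
    set A : Ω × ℝ → ℝ := fun z => h (obs p y t z.1, z.2) - Q (obsTrunc a ε t m z.1, z.2) with hA
    have hAm : Measurable A := (hm.comp (hy.measurable_obs_prod t)).sub (hQc.measurable.comp hXm)
    have hAB : ∀ z, |A z| ≤ C + B := fun z => (abs_sub _ _).trans (add_le_add (hC _) (hQB _))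
    have hAi : Integrable A (P.prod F) :=
      Integrable.of_bound hAm.aestronglyMeasurable (C + B) (ae_of_all _ hAB)
    set D : Ω × ℝ → ℝ := fun z => Q (obsTrunc a ε t m z.1, z.2) - μ z.2 with hD
    have hDm : Measurable D := (hQc.measurable.comp hXm).sub (hμm.comp measurable_snd)
    have hDB : ∀ z, |D z| ≤ B + C := fun z => (abs_sub _ _).trans (add_le_add (hQB _) (hμC _))
    have hsum : ∀ z, H s z * H t z = H s z * A z + H s z * D z := fun z => by
      simp only [hH, hA, hD]; ring
    have iA : Integrable (fun z => H s z * A z) (P.prod F) :=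
      Integrable.bdd_mul hAi (hHm s).aestronglyMeasurable (ae_of_all _ (hHB s))
    have iD : Integrable (fun z => H s z * D z) (P.prod F) :=
      Integrable.bdd_mul (Integrable.of_bound hDm.aestronglyMeasurable (B + C) (ae_of_all _ hDB))
        (hHm s).aestronglyMeasurable (ae_of_all _ (hHB s))
    -- For fixed x, the factor `D` depends on innovations independent of the window at s. It is
    -- enough that `H s` is centred; `D` need not be.
    have hzero : ∫ z, H s z * D z ∂(P.prod F) = 0 := by
      rw [integral_prod_symm _ iD]
      refine integral_eq_zero_of_ae (ae_of_all _ fun x => ?_)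
      have hhx : Measurable fun u => h (u, x) - μ x :=
        (hm.comp (measurable_id.prodMk measurable_const)).sub measurable_const
      have hQx : Measurable fun u => Q (u, x) - μ x :=
        (hQc.measurable.comp (measurable_id.prodMk measurable_const)).sub measurable_const
      have hind := (hy.indepFun_obs hst).integral_fun_comp_mul_comp
        (hy.measurable_obs s).aemeasurable (hy.measurable_obsTrunc t m).aemeasurable
        (f := fun u => h (u, x) - μ x) (g := fun u => Q (u, x) - μ x)
        hhx.aestronglyMeasurable hQx.aestronglyMeasurable
      refine hind.trans ?_
      have h1 : ∫ ω, (h (obs p y s ω, x) - μ x) ∂P = 0 := by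
        rw [integral_sub]
        · rw [hy.integral_obs s (f := fun u => h (u, x))
            (hm.comp (measurable_id.prodMk measurable_const)).stronglyMeasurable]
          simp [hμ]
        · exact Integrable.of_bound ((hm.comp (measurable_id.prodMk measurable_const)).comp
            (hy.measurable_obs s)).aestronglyMeasurable C (ae_of_all _ fun _ => hC _)
        · exact integrable_const _
      rw [h1, zero_mul]
      rfl
    simp_rw [hsum]
    rw [integral_add iA iD, hzero, add_zero]
    calc |∫ z, H s z * A z ∂(P.prod F)| ≤ ∫ z, |H s z * A z| ∂(P.prod F) :=
          abs_integral_le_integral_abs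
      _ ≤ ∫ z, 2 * C * |A z| ∂(P.prod F) := by
          refine integral_mono iA.abs (hAi.abs.const_mul _) fun z => ?_
          rw [abs_mul]
          exact mul_le_mul_of_nonneg_right (hHB s z) (abs_nonneg _)
      _ = 2 * C * ∫ z, |A z| ∂(P.prod F) := integral_const_mul _ _
      _ ≤ 2 * C * δ := by
          gcongr
          exact happ a y hy t
  have hn0 : 0 < n := by omega
  have key := integral_abs_avg_le (P.prod F) (B := 2 * C) (δ := 2 * C * δ) (τ := τ) (m := m)
    (n := n) hHm hHB (by positivity) hτ hn0 horth
  rw [huniv] at key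
  have hn' : (n : ℝ) ≠ 0 := by positivity
  calc _ = ∫ z, |(n : ℝ)⁻¹ * ∑ t ∈ Finset.Icc (1 : ℤ) n, H t z| ∂(P.prod F) := by
        refine integral_congr_ae (ae_of_all _ fun z => ?_)
        simp only [hH, Finset.sum_sub_distrib, Finset.sum_const, Int.card_Icc, nsmul_eq_mul]
        rw [mul_sub, show ((n : ℤ) + 1 - 1).toNat = n by omega, inv_mul_cancel_left₀ hn']
    _ ≤ _ := key
    _ ≤ κ / 4 + (κ * τ / 4 + κ * τ / 4) / τ := by
        have h1 : τ * f ≤ κ / 4 := by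
          rw [hτdef, div_mul_eq_mul_div, div_le_iff₀ (by positivity)]
          nlinarith
        have h2 : 2 * C * δ ≤ κ * τ / 4 := by
          rw [hδdef, mul_div_assoc', div_le_iff₀ (by positivity)]
          nlinarith [mul_pos hκ hτ]
        have h3 := (hN n hn.le).le
        gcongr
    _ ≤ κ := by
        rw [← add_div, ← mul_add] 
        have : κ * (τ + τ) / 4 / τ = κ / 2 := by field_simp; ring
        rw [this]; linarith

end IsARCH

/-! ### Averages, and the law of large numbers uniform over a compact parameter set -/

lemma measure_ge_le_ofReal_div {α : Type*} [MeasurableSpace α] {μ : Measure α} [IsFiniteMeasure μ]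
    {f : α → ℝ} (hf : ∀ z, 0 ≤ f z) (hi : Integrable f μ) {c I : ℝ} (hc : 0 < c)
    (hI : ∫ z, f z ∂μ ≤ I) : μ {z | c ≤ f z} ≤ ENNReal.ofReal (I / c) := by
  rw [← ofReal_measureReal]
  refine ENNReal.ofReal_le_ofReal ?_
  rw [le_div_iff₀ hc, mul_comm]
  exact (mul_meas_ge_le_integral_of_nonneg (ae_of_all _ hf) hi c).trans hI

/-- The average `n⁻¹ ∑_{t=1}^n f(t)`. -/
def avg (n : ℕ) (f : ℤ → ℝ) : ℝ := (n : ℝ)⁻¹ * ∑ t ∈ Finset.Icc (1 : ℤ) n, f t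

lemma avg_mono {n : ℕ} {f g : ℤ → ℝ} (h : ∀ t, f t ≤ g t) : avg n f ≤ avg n g :=
  mul_le_mul_of_nonneg_left (Finset.sum_le_sum fun t _ => h t) (by positivity)

lemma avg_sub (n : ℕ) (f g : ℤ → ℝ) : avg n f - avg n g = avg n fun t => f t - g t := by
  simp only [avg, Finset.sum_sub_distrib, mul_sub]

lemma abs_avg_le (n : ℕ) (f : ℤ → ℝ) : |avg n f| ≤ avg n fun t => |f t| := by
  unfold avg
  rw [abs_mul, abs_of_nonneg (by positivity : (0 : ℝ) ≤ (n : ℝ)⁻¹)]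
  exact mul_le_mul_of_nonneg_left (Finset.abs_sum_le_sum_abs _ _) (by positivity)

lemma avg_const {n : ℕ} (hn : 0 < n) (c : ℝ) : avg n (fun _ => c) = c := by
  have hn' : (n : ℝ) ≠ 0 := by positivity
  simp only [avg, Finset.sum_const, Int.card_Icc, nsmul_eq_mul]
  rw [show ((n : ℤ) + 1 - 1).toNat = n by omega, inv_mul_cancel_left₀ hn']

lemma avg_const_le (n : ℕ) {c : ℝ} (hc : 0 ≤ c) : avg n (fun _ => c) ≤ c := by
  rcases Nat.eq_zero_or_pos n with rfl | hn
  · simpa [avg] using hc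
  · rw [avg_const hn]

lemma abs_avg_le_of_forall (n : ℕ) {f : ℤ → ℝ} {C : ℝ} (hC : 0 ≤ C) (h : ∀ t, |f t| ≤ C) :
    |avg n f| ≤ C :=
  (abs_avg_le n f).trans ((avg_mono h).trans (avg_const_le n hC))

lemma integral_avg {α : Type*} [MeasurableSpace α] {μ : Measure α} (n : ℕ) {f : ℤ → α → ℝ}
    (hf : ∀ t, Integrable (f t) μ) :
    ∫ x, avg n (fun t => f t x) ∂μ = avg n fun t => ∫ x, f t x ∂μ := by
  unfold avg
  rw [integral_const_mul, integral_finsetSum _ fun t _ => hf t]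

lemma integrable_avg {α : Type*} [MeasurableSpace α] {μ : Measure α} (n : ℕ) {f : ℤ → α → ℝ}
    (hf : ∀ t, Integrable (f t) μ) : Integrable (fun x => avg n fun t => f t x) μ :=
  (integrable_finsetSum _ fun t _ => hf t).const_mul _

/-- A uniform weak law of large numbers over a compact parameter set, uniform over a family of ARCH
processes, for function classes with small mean oscillation. -/
theorem exists_uniform_lln {P : Measure Ω} [IsProbabilityMeasure P] {ε : ℤ → Ω → ℝ} {v K ρ : ℝ}
    {S : Set (Vec p)} {y : Vec p → ℤ → Ω → ℝ} (hy : ∀ a ∈ S, IsARCH P ε v K ρ a (y a))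
    {T : Set (Vec p)} (hT : IsCompact T) (F : Measure ℝ) [IsFiniteMeasure F]
    {H : Vec p → (Fin (p + 1) → ℝ) × ℝ → ℝ} (hm : ∀ θ ∈ T, Measurable (H θ))
    {C : ℝ} (hC : ∀ θ ∈ T, ∀ z, |H θ z| ≤ C)
    (hosc : ∀ κ : ℝ, 0 < κ → ∃ r : ℝ, 0 < r ∧ ∀ θ' ∈ T,
      ∃ (D : (Fin (p + 1) → ℝ) → ℝ) (B : ℝ), Measurable D ∧ (∀ u, |D u| ≤ B) ∧
        (∀ᵐ u : Fin (p + 1) → ℝ, ∀ θ ∈ T, ‖θ - θ'‖ < r →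
          ∫ x, |H θ (u, x) - H θ' (u, x)| ∂F ≤ D u) ∧
        ∀ a ∈ S, ∫ ω, D (obs p (y a) 1 ω) ∂P ≤ κ)
    {κ : ℝ} (hκ : 0 < κ) :
    ∃ N : ℕ, ∀ n : ℕ, N < n → ∀ a ∈ S,
      P {ω | ∃ θ ∈ T, κ < ∫ x, |avg n (fun t => H θ (obs p (y a) t ω, x)) -
        ∫ ω', H θ (obs p (y a) 1 ω', x) ∂P| ∂F} ≤ ENNReal.ofReal κ := by
  obtain ⟨r, hr, hD⟩ := hosc (κ / 8) (by linarith)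
  choose! D B hDm hDB hDosc hDint using hD
  obtain ⟨s, hsT, hcov⟩ := hT.elim_finite_subcover_image (b := T)
    (c := fun θ' => Metric.ball θ' r) (fun _ _ => Metric.isOpen_ball)
    (fun θ hθ => Set.mem_iUnion₂.2 ⟨θ, hθ, Metric.mem_ball_self hr⟩)
  obtain ⟨hsfin, hcov⟩ := hcov
  set J := hsfin.toFinset with hJ
  have hJT : ∀ θ' ∈ J, θ' ∈ T := fun θ' h => hsT (hsfin.mem_toFinset.1 h)
  -- Markov's inequality at level κ/4 then gives each bad event probability at most κ / (2(|J| +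
  -- 1)). With two events per net point the total stays below κ.
  set κ' : ℝ := κ ^ 2 / (8 * (J.card + 1)) with hκ'
  have hκ'0 : 0 < κ' := by positivity
  have hN1 : ∀ θ' ∈ J, ∃ N : ℕ, ∀ n : ℕ, N < n → ∀ (a : Vec p) (y : ℤ → Ω → ℝ),
      IsARCH P ε v K ρ a y →
      ∫ z : Ω × ℝ, |(n : ℝ)⁻¹ * ∑ t ∈ Finset.Icc (1 : ℤ) n, H θ' (obs p y t z.1, z.2) -
        ∫ ω, H θ' (obs p y 1 ω, z.2) ∂P| ∂(P.prod F) ≤ κ' := fun θ' h =>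
    IsARCH.exists_lln P ε v K ρ F (hm θ' (hJT θ' h)) (hC θ' (hJT θ' h)) hκ'0
  -- The oscillation bound does not involve x, so the same law is applied with a Dirac mass in the
  -- extra variable.
  have hN2 : ∀ θ' ∈ J, ∃ N : ℕ, ∀ n : ℕ, N < n → ∀ (a : Vec p) (y : ℤ → Ω → ℝ),
      IsARCH P ε v K ρ a y →
      ∫ z : Ω × ℝ, |(n : ℝ)⁻¹ * ∑ t ∈ Finset.Icc (1 : ℤ) n, D θ' (obs p y t z.1) -
        ∫ ω, D θ' (obs p y 1 ω) ∂P| ∂(P.prod (Measure.dirac 0)) ≤ κ' := fun θ' h =>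
    IsARCH.exists_lln P ε v K ρ (Measure.dirac 0) (h := fun z => D θ' z.1)
      ((hDm θ' (hJT θ' h)).comp measurable_fst) (fun z => hDB θ' (hJT θ' h) z.1) hκ'0
  choose! N1 hN1 using hN1
  choose! N2 hN2 using hN2
  refine ⟨J.sup N1 + J.sup N2, fun n hn a ha => ?_⟩
  have hya := hy a ha
  have hX := fun t => hya.measurable_obs t
  have hn0 : 0 < n := by omega
  set G : Vec p → Ω → ℝ := fun θ ω => ∫ x, |avg n (fun t => H θ (obs p (y a) t ω, x)) -
    ∫ ω', H θ (obs p (y a) 1 ω', x) ∂P| ∂F with hG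
  set E : Vec p → Ω → ℝ := fun θ ω => |avg n (fun t => D θ (obs p (y a) t ω)) -
    ∫ ω', D θ (obs p (y a) 1 ω') ∂P| with hE
  -- control of the averages on the net
  have hGm : ∀ θ' ∈ J, P {ω | κ / 4 ≤ G θ' ω} ≤ ENNReal.ofReal (κ' / (κ / 4)) := by
    intro θ' h
    have hT' := hJT θ' h
    have hC0 : 0 ≤ C := (abs_nonneg _).trans (hC θ' hT' 0)
    have hi : Integrable (fun z : Ω × ℝ => |avg n (fun t => H θ' (obs p (y a) t z.1, z.2)) -
        ∫ ω', H θ' (obs p (y a) 1 ω', z.2) ∂P|) (P.prod F) := by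
      refine Integrable.of_bound (Measurable.aestronglyMeasurable ?_) (C + C)
        (ae_of_all _ fun z => ?_)
      · refine (Measurable.sub ?_ ((hya.measurable_integral_obs (hm θ' hT') 1).comp
          measurable_snd)).abs
        exact (Finset.measurable_fun_sum _ fun t _ =>
          (hm θ' hT').comp (hya.measurable_obs_prod t)).const_mul _
      · rw [Real.norm_eq_abs, abs_abs]
        exact (abs_sub _ _).trans (add_le_add
          (abs_avg_le_of_forall n hC0 fun t => hC θ' hT' _)
          (IsARCH.abs_integral_obs_le (hC θ' hT') (y a) 1 z.2))
    refine measure_ge_le_ofReal_div (fun ω => integral_nonneg fun x => abs_nonneg _)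
      hi.integral_prod_left (by linarith) ?_
    rw [← integral_prod _ hi]
    have h1 : N1 θ' ≤ J.sup N1 := Finset.le_sup h
    exact hN1 θ' h n (by omega) a (y a) hya
  have hEm : ∀ θ' ∈ J, P {ω | κ / 4 ≤ E θ' ω} ≤ ENNReal.ofReal (κ' / (κ / 4)) := by
    intro θ' h
    have hT' := hJT θ' h
    have hB0 : 0 ≤ B θ' := (abs_nonneg _).trans (hDB θ' hT' 0)
    have hmeas : Measurable fun ω => E θ' ω :=
      (((Finset.measurable_fun_sum _ fun t _ => (hDm θ' hT').comp (hX t)).const_mul _).sub_const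
        _).abs
    have hbd : ∀ ω, |E θ' ω| ≤ B θ' + B θ' := by
      intro ω
      rw [hE, abs_abs]
      refine (abs_sub _ _).trans (add_le_add (abs_avg_le_of_forall n hB0 fun t => hDB θ' hT' _) ?_)
      exact IsARCH.abs_integral_obs_le (f := fun z => D θ' z.1) (fun z => hDB θ' hT' z.1) (y a) 1 0
    have hi : Integrable (fun ω => E θ' ω) P :=
      Integrable.of_bound hmeas.aestronglyMeasurable (B θ' + B θ') (ae_of_all _ hbd)
    refine measure_ge_le_ofReal_div (fun ω => abs_nonneg _) hi (by linarith) ?_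
    have h1 : N2 θ' ≤ J.sup N2 := Finset.le_sup h
    have h2 := hN2 θ' h n (by omega) a (y a) hya
    have hi' : Integrable (fun z : Ω × ℝ => E θ' z.1) (P.prod (Measure.dirac 0)) :=
      hi.comp_fst _
    have h3 := integral_prod _ hi'
    simp only [integral_const, probReal_univ, one_smul] at h3
    rw [← h3]
    exact h2
  -- the good event
  have hosc' : ∀ θ' ∈ J, ∀ᵐ ω ∂P, ∀ t : ℤ, ∀ θ ∈ T, ‖θ - θ'‖ < r →
      ∫ x, |H θ (obs p (y a) t ω, x) - H θ' (obs p (y a) t ω, x)| ∂F ≤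
        D θ' (obs p (y a) t ω) := fun θ' h =>
    ae_all_iff.2 fun t => hya.ae_window (p + 1) t (hDosc θ' (hJT θ' h))
  have hosc'' : ∀ᵐ ω ∂P, ∀ θ' ∈ J, ∀ t : ℤ, ∀ θ ∈ T, ‖θ - θ'‖ < r →
      ∫ x, |H θ (obs p (y a) t ω, x) - H θ' (obs p (y a) t ω, x)| ∂F ≤
        D θ' (obs p (y a) t ω) :=
    (eventually_all_finset J).2 hosc'
  -- The inclusion holds only almost surely because the oscillation bound holds for almost every
  -- window. The event on the left may be non-measurable, in which case P is used as an outer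
  -- measure.
  have hsub : {ω | ∃ θ ∈ T, κ < G θ ω} ≤ᵐ[P]
      (⋃ θ' ∈ J, ({ω | κ / 4 ≤ G θ' ω} ∪ {ω | κ / 4 ≤ E θ' ω}) : Set Ω) := by
    filter_upwards [hosc''] with ω hω hmem
    obtain ⟨θ, hθ, hlt⟩ : ∃ θ ∈ T, κ < G θ ω := hmem
    obtain ⟨θ', hθ's, hball⟩ := Set.mem_iUnion₂.1 (hcov hθ)
    have hθ'J : θ' ∈ J := hsfin.mem_toFinset.2 hθ's
    have hθ'T := hJT θ' hθ'J
    have hnear : ‖θ - θ'‖ < r := by rwa [Metric.mem_ball, dist_eq_norm] at hball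
    by_contra hc
    have hc' : ω ∉ (⋃ θ' ∈ J, ({ω | κ / 4 ≤ G θ' ω} ∪ {ω | κ / 4 ≤ E θ' ω}) : Set Ω) := hc
    rw [Set.mem_iUnion₂] at hc'
    have hc1 : G θ' ω < κ / 4 := not_le.1 fun h => hc' ⟨θ', hθ'J, Or.inl h⟩
    have hc2 : E θ' ω < κ / 4 := not_le.1 fun h => hc' ⟨θ', hθ'J, Or.inr h⟩
    have hC0 : 0 ≤ C := (abs_nonneg _).trans (hC θ' hθ'T 0)
    -- integrability in `x`
    have hHx : ∀ θ ∈ T, ∀ u, Integrable (fun x => H θ (u, x)) F := fun θ hθ u =>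
      Integrable.of_bound ((hm θ hθ).comp
        (measurable_const.prodMk measurable_id)).aestronglyMeasurable C (ae_of_all _ fun x => hC θ hθ _)
    have hHavg : ∀ θ ∈ T, Integrable (fun x => avg n fun t => H θ (obs p (y a) t ω, x)) F :=
      fun θ hθ => integrable_avg n fun t => hHx θ hθ _
    have hHE : ∀ θ ∈ T, Integrable (fun x => ∫ ω', H θ (obs p (y a) 1 ω', x) ∂P) F :=
      fun θ hθ => Integrable.of_bound
        (hya.measurable_integral_obs (hm θ hθ) 1).aestronglyMeasurable C
        (ae_of_all _ fun x => IsARCH.abs_integral_obs_le (hC θ hθ) (y a) 1 x)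
    have t1 : ∫ x, |avg n (fun t => H θ (obs p (y a) t ω, x)) -
        avg n (fun t => H θ' (obs p (y a) t ω, x))| ∂F ≤
        avg n fun t => D θ' (obs p (y a) t ω) := by
      have hab : ∀ t, Integrable (fun x => |H θ (obs p (y a) t ω, x) -
          H θ' (obs p (y a) t ω, x)|) F := fun t => ((hHx θ hθ _).sub (hHx θ' hθ'T _)).abs
      calc _ ≤ ∫ x, avg n (fun t => |H θ (obs p (y a) t ω, x) - H θ' (obs p (y a) t ω, x)|) ∂F := by
            refine integral_mono ((hHavg θ hθ).sub (hHavg θ' hθ'T)).abs (integrable_avg n hab)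
              fun x => ?_
            rw [avg_sub]
            exact abs_avg_le n _
        _ = avg n fun t => ∫ x, |H θ (obs p (y a) t ω, x) - H θ' (obs p (y a) t ω, x)| ∂F :=
            integral_avg n hab
        _ ≤ _ := avg_mono fun t => hω θ' hθ'J t θ hθ hnear
    have t3 : ∫ x, |∫ ω', H θ' (obs p (y a) 1 ω', x) ∂P - ∫ ω', H θ (obs p (y a) 1 ω', x) ∂P| ∂F ≤
        κ / 8 := by
      have hi : ∀ θ ∈ T, Integrable (fun z : Ω × ℝ => H θ (obs p (y a) 1 z.1, z.2)) (P.prod F) :=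
        fun θ hθ => Integrable.of_bound
          ((hm θ hθ).comp (hya.measurable_obs_prod 1)).aestronglyMeasurable C
          (ae_of_all _ fun z => hC θ hθ _)
      have hi2 : Integrable (fun z : Ω × ℝ => |H θ (obs p (y a) 1 z.1, z.2) -
          H θ' (obs p (y a) 1 z.1, z.2)|) (P.prod F) := ((hi θ hθ).sub (hi θ' hθ'T)).abs
      have hiω : ∀ θ ∈ T, ∀ x, Integrable (fun ω' => H θ (obs p (y a) 1 ω', x)) P := fun θ hθ x =>
        Integrable.of_bound ((hm θ hθ).comp
          ((hX 1).prodMk measurable_const)).aestronglyMeasurable C (ae_of_all _ fun _ => hC θ hθ _)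
      have hB0 : 0 ≤ B θ' := (abs_nonneg _).trans (hDB θ' hθ'T 0)
      calc _ ≤ ∫ x, ∫ ω', |H θ (obs p (y a) 1 ω', x) - H θ' (obs p (y a) 1 ω', x)| ∂P ∂F := by
            refine integral_mono ((hHE θ' hθ'T).sub (hHE θ hθ)).abs hi2.integral_prod_right
              fun x => ?_
            rw [abs_sub_comm, ← integral_sub (hiω θ hθ x) (hiω θ' hθ'T x)]
            exact abs_integral_le_integral_abs
        _ = ∫ ω', ∫ x, |H θ (obs p (y a) 1 ω', x) - H θ' (obs p (y a) 1 ω', x)| ∂F ∂P := by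
            rw [← integral_prod_symm _ hi2, integral_prod _ hi2]
        _ ≤ ∫ ω', D θ' (obs p (y a) 1 ω') ∂P := by
            refine integral_mono_ae hi2.integral_prod_left ?_ ?_
            · exact Integrable.of_bound ((hDm θ' hθ'T).comp (hX 1)).aestronglyMeasurable (B θ')
                (ae_of_all _ fun _ => hDB θ' hθ'T _)
            · filter_upwards [hosc' θ' hθ'J] with ω' hω'
              exact hω' 1 θ hθ hnear
        _ ≤ κ / 8 := hDint θ' hθ'T a ha
    have t4 := hDint θ' hθ'T a ha
    have t5 : avg n (fun t => D θ' (obs p (y a) t ω)) ≤ κ / 8 + κ / 4 := by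
      have := (abs_lt.1 hc2).2
      linarith
    have i1 : Integrable (fun x => |avg n (fun t => H θ (obs p (y a) t ω, x)) -
        avg n (fun t => H θ' (obs p (y a) t ω, x))|) F :=
      ((hHavg θ hθ).sub (hHavg θ' hθ'T)).abs
    have i2 : Integrable (fun x => |avg n (fun t => H θ' (obs p (y a) t ω, x)) -
        ∫ ω', H θ' (obs p (y a) 1 ω', x) ∂P|) F := ((hHavg θ' hθ'T).sub (hHE θ' hθ'T)).abs
    have i3 : Integrable (fun x => |∫ ω', H θ' (obs p (y a) 1 ω', x) ∂P -
        ∫ ω', H θ (obs p (y a) 1 ω', x) ∂P|) F := ((hHE θ' hθ'T).sub (hHE θ hθ)).abs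
    have hfinal : G θ ω ≤ _ + G θ' ω + _ :=
      (integral_mono ((hHavg θ hθ).sub (hHE θ hθ)).abs ((i1.add i2).add i3) fun x =>
        (abs_sub_le _ (∫ ω', H θ' (obs p (y a) 1 ω', x) ∂P) _).trans
          (add_le_add_left (abs_sub_le _ _ _) _)).trans_eq
        ((integral_add (i1.add i2) i3).trans (congrArg (· + _) (integral_add i1 i2)))
    -- Oscillation of the averages κ/8 + κ/4, deviation at the net point κ/4, oscillation of the
    -- means κ/8: together 3κ/4, contradicting the value above κ.
    linarith
  calc P {ω | ∃ θ ∈ T, κ < G θ ω}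
      ≤ P (⋃ θ' ∈ J, ({ω | κ / 4 ≤ G θ' ω} ∪ {ω | κ / 4 ≤ E θ' ω})) := measure_mono_ae hsub
    _ ≤ ∑ θ' ∈ J, P ({ω | κ / 4 ≤ G θ' ω} ∪ {ω | κ / 4 ≤ E θ' ω}) := measure_biUnion_finset_le _ _
    _ ≤ ∑ θ' ∈ J, ENNReal.ofReal (κ' / (κ / 4) + κ' / (κ / 4)) := by
        refine Finset.sum_le_sum fun θ' h => (measure_union_le _ _).trans ?_
        rw [ENNReal.ofReal_add (by positivity) (by positivity)]
        exact add_le_add (hGm θ' h) (hEm θ' h)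
    _ = ENNReal.ofReal (J.card * (κ' / (κ / 4) + κ' / (κ / 4))) := by
        rw [Finset.sum_const, nsmul_eq_mul, ENNReal.ofReal_mul (by positivity),
          ENNReal.ofReal_natCast]
    _ ≤ ENNReal.ofReal κ := by
        refine ENNReal.ofReal_le_ofReal ?_
        have : κ' / (κ / 4) + κ' / (κ / 4) = κ / (J.card + 1) := by
          rw [hκ']; field_simp; ring
        rw [this, mul_div_assoc', div_le_iff₀ (by positivity)]
        nlinarith

/-! ### Residuals as functions of the window, and their local concentration -/

/-- The lag vector `(u_1, …, u_p)` contained in a window `(u_0, …, u_p)`. -/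
def lagOf (u : Fin (p + 1) → ℝ) : Vec p := WithLp.toLp 2 fun k : Fin p => u k.succ

/-- The residual computed from a window. -/
def residOf (θ : Vec p) (u : Fin (p + 1) → ℝ) : ℝ := u 0 / √(volSq θ (lagOf u))

lemma lag_eq_lagOf (y : ℤ → Ω → ℝ) (t : ℤ) (ω : Ω) :
    lag p (fun i => y i ω) (t - 1) = lagOf (obs p y t ω) := by
  ext k
  simp only [lag, lagOf, obs, window, past, Fin.val_succ]
  congr 1
  push_cast; ring

lemma resid_eq_residOf (y : ℤ → Ω → ℝ) (θ : Vec p) (t : ℤ) (ω : Ω) :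
    resid (fun i => y i ω) θ t = residOf θ (obs p y t ω) := by
  unfold resid residOf
  rw [lag_eq_lagOf]
  simp [obs, window, past]

lemma measurable_lagOf : Measurable (lagOf (p := p)) :=
  (WithLp.measurable_toLp 2 _).comp (measurable_pi_lambda _ fun _ => measurable_pi_apply _)

lemma measurable_residOf (θ : Vec p) : Measurable (residOf θ) := by
  unfold residOf volSq lagOf
  fun_prop

lemma one_le_volSq {θ : Vec p} (hθ : ∀ k, 0 ≤ θ k) (U : Vec p) : 1 ≤ volSq θ U := by
  unfold volSq
  have : 0 ≤ ∑ k, θ k * U k ^ 2 :=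
    Finset.sum_nonneg fun k _ => mul_nonneg (hθ k) (sq_nonneg _)
  linarith

lemma abs_inv_sqrt_sub_le {s t : ℝ} (hs : 1 ≤ s) (ht : 1 ≤ t) : |1 / √s - 1 / √t| ≤ |s - t| := by
  have h1 : 1 ≤ √s := Real.one_le_sqrt.2 hs
  have h2 : 1 ≤ √t := Real.one_le_sqrt.2 ht
  have e : s - t = (√s - √t) * (√s + √t) := by
    have := Real.sq_sqrt (by linarith : 0 ≤ s)
    have := Real.sq_sqrt (by linarith : 0 ≤ t)
    nlinarith
  have e2 : 1 / √s - 1 / √t = -((√s - √t) / (√s * √t)) := by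
    have : √s ≠ 0 := by linarith
    have : √t ≠ 0 := by linarith
    field_simp
    ring
  rw [e, e2, abs_neg, abs_div, abs_mul (√s - √t)]
  have h3 : 1 ≤ |√s + √t| := by rw [abs_of_nonneg (by linarith)]; linarith
  have h4 : 1 ≤ |√s * √t| := by rw [abs_of_nonneg (by positivity)]; nlinarith
  calc |√s - √t| / |√s * √t| ≤ |√s - √t| := div_le_self (abs_nonneg _) h4
    _ ≤ _ := le_mul_of_one_le_right (abs_nonneg _) h3

/-- The inverse volatility is Lipschitz in θ because s ≥ 1. The constant grows with the window as T
· T², so this is used only on bounded windows. -/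
lemma abs_residOf_sub_le {θ θ' : Vec p} (hθ : ∀ k, 0 ≤ θ k) (hθ' : ∀ k, 0 ≤ θ' k)
    {u : Fin (p + 1) → ℝ} {T : ℝ} (hu : ‖u‖ ≤ T) :
    |residOf θ u - residOf θ' u| ≤ p * T ^ 3 * ‖θ - θ'‖ := by
  have hT : 0 ≤ T := (norm_nonneg _).trans hu
  have hk : ∀ k, |u k| ≤ T := fun k => (norm_le_pi_norm u k).trans hu
  have h1 : |volSq θ (lagOf u) - volSq θ' (lagOf u)| ≤ p * (‖θ - θ'‖ * T ^ 2) := by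
    unfold volSq
    rw [add_sub_add_left_eq_sub, ← Finset.sum_sub_distrib]
    refine (Finset.abs_sum_le_sum_abs _ _).trans ?_
    calc _ ≤ ∑ _k : Fin p, ‖θ - θ'‖ * T ^ 2 := by
          refine Finset.sum_le_sum fun k _ => ?_
          rw [← sub_mul, abs_mul, abs_of_nonneg (sq_nonneg (lagOf u k))]
          have e1 : |θ k - θ' k| ≤ ‖θ - θ'‖ := by
            have := PiLp.norm_apply_le (θ - θ') k
            simpa using this
          have e2 : (lagOf u) k ^ 2 ≤ T ^ 2 := by
            rw [← sq_abs]
            exact pow_le_pow_left₀ (abs_nonneg _) (hk k.succ) 2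
          exact mul_le_mul e1 e2 (sq_nonneg _) (norm_nonneg _)
      _ = _ := by simp
  have h2 := abs_inv_sqrt_sub_le (one_le_volSq hθ (lagOf u)) (one_le_volSq hθ' (lagOf u))
  unfold residOf
  rw [div_eq_mul_one_div, div_eq_mul_one_div (u 0) √(volSq θ' _), ← mul_sub, abs_mul]
  calc _ ≤ T * (p * (‖θ - θ'‖ * T ^ 2)) :=
        mul_le_mul (hk 0) (h2.trans h1) (abs_nonneg _) hT
    _ = _ := by ring

lemma measurable_measure_Icc (ν : Measure ℝ) [IsFiniteMeasure ν] (κ : ℝ) :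
    Measurable fun c => ν (Set.Icc (c - κ) (c + κ)) := by
  have hs : MeasurableSet {z : ℝ × ℝ | z.1 - κ ≤ z.2 ∧ z.2 ≤ z.1 + κ} :=
    (measurableSet_le (measurable_fst.sub_const κ) measurable_snd).inter
      (measurableSet_le measurable_snd (measurable_fst.add_const κ))
  exact measurable_measure_prodMk_left (ν := ν) hs

/-- By Fubini, short intervals have small mass on average over their centres even when ν has atoms.
Hence neither F nor ψ has to be continuous. -/
lemma lintegral_measure_Icc (ν : Measure ℝ) [IsFiniteMeasure ν] (κ : ℝ) :
    ∫⁻ c, ν (Set.Icc (c - κ) (c + κ)) = ENNReal.ofReal (2 * κ) * ν Set.univ := by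
  have hs : MeasurableSet {z : ℝ × ℝ | z.1 - κ ≤ z.2 ∧ z.2 ≤ z.1 + κ} :=
    (measurableSet_le (measurable_fst.sub_const κ) measurable_snd).inter
      (measurableSet_le measurable_snd (measurable_fst.add_const κ))
  have h1 := Measure.prod_apply (μ := (volume : Measure ℝ)) (ν := ν) hs
  have h2 := Measure.prod_apply_symm (μ := (volume : Measure ℝ)) (ν := ν) hs
  have e1 : ∀ c : ℝ, Prod.mk c ⁻¹' {z : ℝ × ℝ | z.1 - κ ≤ z.2 ∧ z.2 ≤ z.1 + κ} =
      Set.Icc (c - κ) (c + κ) := fun c => by ext x; simp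
  have e2 : ∀ x : ℝ, (fun c => (c, x)) ⁻¹' {z : ℝ × ℝ | z.1 - κ ≤ z.2 ∧ z.2 ≤ z.1 + κ} =
      Set.Icc (x - κ) (x + κ) := fun x => by
    ext c
    simp only [Set.mem_preimage, Set.mem_ofPred_eq, Set.mem_Icc]
    constructor <;> rintro ⟨_, _⟩ <;> constructor <;> linarith
  simp_rw [e1] at h1
  simp_rw [e2] at h2
  rw [← h1, h2]
  have e3 : ∀ x : ℝ, x + κ - (x - κ) = 2 * κ := fun x => by ring
  simp only [Real.volume_Icc, e3, lintegral_const]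

lemma lintegral_comp_div_const {c : ℝ} (hc : 0 < c) {f : ℝ → ENNReal} (hf : Measurable f) :
    ∫⁻ z, f (z / c) = ENNReal.ofReal c * ∫⁻ z, f z := by
  have h : (fun z : ℝ => f (z / c)) = fun z => f (c⁻¹ * z) := by
    funext z; rw [div_eq_inv_mul]
  rw [h, ← lintegral_map hf (measurable_const_mul c⁻¹),
    Real.map_volume_mul_left (inv_ne_zero hc.ne'), lintegral_smul_measure, smul_eq_mul, inv_inv,
    abs_of_pos hc]

namespace IsARCH

variable {P : Measure Ω} [IsProbabilityMeasure P] {ε : ℤ → Ω → ℝ} {v K ρ : ℝ} {a : Vec p}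
  {y : ℤ → Ω → ℝ}

/-- The crude inequality √s ≤ s for s ≥ 1 makes the mean volatility finite from second moments
alone. -/
lemma sqrt_volSq_le {θ : Vec p} {b : ℝ} (hθ : ∀ k, 0 ≤ θ k) (hb : ∀ k, θ k ≤ b) (hb0 : 0 ≤ b)
    (π : ℕ → ℝ) : √(1 + ∑ k : Fin p, θ k * π k ^ 2) ≤ 1 + b * pastSq p π := by
  have h0 : 0 ≤ ∑ k : Fin p, θ k * π k ^ 2 :=
    Finset.sum_nonneg fun k _ => mul_nonneg (hθ k) (sq_nonneg _)
  have h1 : ∑ k : Fin p, θ k * π k ^ 2 ≤ b * pastSq p π := by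
    unfold pastSq
    rw [Finset.sum_range_succ, mul_add, Finset.mul_sum, ← Fin.sum_univ_eq_sum_range
      (fun k => b * π k ^ 2)]
    have : 0 ≤ b * π p ^ 2 := by positivity
    have h2 : ∑ k : Fin p, θ k * π k ^ 2 ≤ ∑ k : Fin p, b * π k ^ 2 :=
      Finset.sum_le_sum fun k _ => mul_le_mul_of_nonneg_right (hb k) (sq_nonneg _)
    linarith
  calc _ ≤ 1 + ∑ k : Fin p, θ k * π k ^ 2 := by
        rw [Real.sqrt_le_left (by linarith)]
        nlinarith
    _ ≤ _ := by linarith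

/-- Residuals fall into short intervals with small probability, on average over the location of
the interval. -/
lemma lintegral_measure_Icc_residOf_le (h : IsARCH P ε v K ρ a y) (ν : Measure ℝ)
    [IsFiniteMeasure ν] {θ : Vec p} {b : ℝ} (hθ : ∀ k, 0 ≤ θ k) (hb : ∀ k, θ k ≤ b) (hb0 : 0 ≤ b)
    {κ : ℝ} (hκ : 0 ≤ κ) :
    ∫⁻ ω, ν (Set.Icc (residOf θ (obs p y 1 ω) - κ) (residOf θ (obs p y 1 ω) + κ)) ∂P ≤
      ENNReal.ofReal (|K| * ((1 + b * ((p + 1) * (v / (1 - ρ)))) * (2 * κ * ν.real Set.univ))) := by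
  set σ : (ℕ → ℝ) → ℝ := fun π => √(1 + ∑ k : Fin p, θ k * π k ^ 2) with hσ
  have hσm : Measurable σ := by fun_prop
  have hσ1 : ∀ π, 1 ≤ σ π := fun π => by
    rw [hσ, Real.one_le_sqrt]
    have : 0 ≤ ∑ k : Fin p, θ k * π k ^ 2 :=
      Finset.sum_nonneg fun k _ => mul_nonneg (hθ k) (sq_nonneg _)
    linarith
  have hr : ∀ ω, residOf θ (obs p y 1 ω) = y (0 + 1) ω / σ (past (fun i => y i ω) 0) := by
    intro ω
    have h1 : obs p y 1 ω 0 = y (0 + 1) ω := by simp [obs, window, past]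
    have h2 : volSq θ (lagOf (obs p y 1 ω)) = 1 + ∑ k : Fin p, θ k * past (fun i => y i ω) 0 k ^ 2 := by
      unfold volSq
      congr 1
      refine Finset.sum_congr rfl fun k _ => ?_
      simp only [lagOf, obs, window, past, Fin.val_succ]
      congr 3
      push_cast; ring
    rw [residOf, h1, h2]
  simp_rw [hr]
  have hnm := measurable_measure_Icc ν κ
  have hfm : Measurable fun z : ℝ × (ℕ → ℝ) =>
      ν (Set.Icc (z.1 / σ z.2 - κ) (z.1 / σ z.2 + κ)) :=
    hnm.comp (measurable_fst.div (hσm.comp measurable_snd))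
  refine (h.lintegral_succ_past_le 0 hfm).trans ?_
  -- Given the past, the residual is y_1 divided by a constant, so passing to its scale produces a
  -- factor equal to the volatility.
  have hinner : ∀ π : ℕ → ℝ, ∫⁻ z, ν (Set.Icc (z / σ π - κ) (z / σ π + κ)) =
      ENNReal.ofReal (σ π) * (ENNReal.ofReal (2 * κ) * ν Set.univ) := fun π => by
    rw [← lintegral_measure_Icc ν κ]
    exact lintegral_comp_div_const (lt_of_lt_of_le one_pos (hσ1 π)) hnm
  simp_rw [hinner]
  have hσp : Measurable fun ω => ENNReal.ofReal (σ (past (fun i => y i ω) 0)) :=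
    ENNReal.measurable_ofReal.comp (hσm.comp (h.measurable_past 0))
  rw [lintegral_mul_const _ hσp, ENNReal.ofReal_mul (abs_nonneg _)]
  refine mul_le_mul' (ENNReal.ofReal_le_ofReal (le_abs_self K)) ?_
  have hpi := h.integral_pastSq_le 0
  have hi : Integrable (fun ω => 1 + b * pastSq p (past (fun i => y i ω) 0)) P :=
    (integrable_const _).add (hpi.1.const_mul b)
  have hC : 0 ≤ v / (1 - ρ) := div_nonneg h.noise.variance_nonneg (by linarith [h.rho_lt])
  rw [ENNReal.ofReal_mul (p := 1 + b * ((p + 1) * (v / (1 - ρ)))) (by positivity)]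
  refine mul_le_mul' ?_ ?_
  · calc _ ≤ ∫⁻ ω, ENNReal.ofReal (1 + b * pastSq p (past (fun i => y i ω) 0)) ∂P :=
          lintegral_mono fun ω => ENNReal.ofReal_le_ofReal (sqrt_volSq_le hθ hb hb0 _)
      _ = ENNReal.ofReal (∫ ω, (1 + b * pastSq p (past (fun i => y i ω) 0)) ∂P) :=
          (ofReal_integral_eq_lintegral_ofReal hi (ae_of_all _ fun ω => by
            have := pastSq_nonneg p (past (fun i => y i ω) 0)
            change (0 : ℝ) ≤ 1 + b * pastSq p (past (fun i => y i ω) 0)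
            positivity)).symm
      _ ≤ _ := by
          refine ENNReal.ofReal_le_ofReal ?_
          rw [integral_add (integrable_const _) (hpi.1.const_mul b), integral_const,
            probReal_univ, one_smul, integral_const_mul]
          gcongr
          exact hpi.2
  · rw [ENNReal.ofReal_mul (p := 2 * κ) (by positivity), ofReal_measureReal]

end IsARCH

/-! ### Scores and weights, and their mean oscillation in the parameter -/

/-- A bounded family of functions of the residual, indexed by `x` and averaged with respect to `F`,
whose oscillation is controlled by a measure `ν`. -/
structure IsScore (F ν : Measure ℝ) (q : ℝ × ℝ → ℝ) (Q : ℝ) : Prop where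
  measurable : Measurable q
  bound : ∀ z, |q z| ≤ Q
  osc : ∀ u v κ : ℝ, |v - u| ≤ κ →
    ∫ x, |q (v, x) - q (u, x)| ∂F ≤ ν.real (Set.Icc (u - κ) (u + κ))

/-- A bounded weight function of the lag vector that is Lipschitz in the parameter, with a Lipschitz
constant whose mean is bounded over a family of processes. -/
structure IsWeight (T S : Set (Vec p)) (P : Measure Ω) (y : Vec p → ℤ → Ω → ℝ)
    (w : Vec p → Vec p → ℝ) (L : ℝ) : Prop where
  measurable : ∀ θ ∈ T, Measurable fun U => w U θ
  nonneg : 0 ≤ L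
  bound : ∀ U, ∀ θ ∈ T, |w U θ| ≤ L
  lipschitz : ∃ (M : Vec p → ℝ) (C : ℝ), Measurable M ∧ (∀ U, 0 ≤ M U) ∧
    (∀ᵐ U : Vec p, ∀ θ ∈ T, ∀ θ' ∈ T, |w U θ - w U θ'| ≤ M U * ‖θ - θ'‖) ∧
    ∀ a ∈ S, Integrable (fun ω => M (lagOf (obs p (y a) 1 ω))) P ∧
      ∫ ω, M (lagOf (obs p (y a) 1 ω)) ∂P ≤ C

/-- Pulls null sets of lag vectors back to null sets of windows, because the weight is regular in θ
only for almost every lag vector. -/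
lemma quasiMeasurePreserving_lagOf :
    Measure.QuasiMeasurePreserving (lagOf (p := p)) volume volume := by
  have h1 := (volume_preserving_piFinSuccAbove (fun _ : Fin (p + 1) => ℝ) 0).quasiMeasurePreserving
  have h2 : Measure.QuasiMeasurePreserving (Prod.snd : ℝ × (Fin p → ℝ) → Fin p → ℝ)
      volume volume := Measure.quasiMeasurePreserving_snd
  have h3 := (PiLp.volume_preserving_toLp (Fin p)).quasiMeasurePreserving
  exact h3.comp (h2.comp h1)

lemma ae_lagOf {s : Vec p → Prop} (hs : ∀ᵐ U, s U) : ∀ᵐ u : Fin (p + 1) → ℝ, s (lagOf u) :=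
  quasiMeasurePreserving_lagOf.ae hs

/-- The summand `q(ε(θ), x) w(U, θ)` as a function of the observed window. -/
def scoreWeight (q : ℝ × ℝ → ℝ) (w : Vec p → Vec p → ℝ) (θ : Vec p) (z : (Fin (p + 1) → ℝ) × ℝ) :
    ℝ := q (residOf θ z.1, z.2) * w (lagOf z.1) θ

lemma measurable_scoreWeight {q : ℝ × ℝ → ℝ} {w : Vec p → Vec p → ℝ} {θ : Vec p}
    (hq : Measurable q) (hw : Measurable fun U => w U θ) : Measurable (scoreWeight q w θ) :=
  (hq.comp (((measurable_residOf θ).comp measurable_fst).prodMk measurable_snd)).mul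
    (hw.comp (measurable_lagOf.comp measurable_fst))

lemma exists_pos_mul_le (c : ℝ) {κ : ℝ} (hκ : 0 < κ) : ∃ r : ℝ, 0 < r ∧ c * r ≤ κ := by
  refine ⟨κ / (|c| + 1), by positivity, ?_⟩
  rw [mul_div_assoc', div_le_iff₀ (by positivity)]
  nlinarith [le_abs_self c]

lemma exists_oscillation {P : Measure Ω} [IsProbabilityMeasure P] {ε : ℤ → Ω → ℝ} {v K ρ : ℝ}
    {S : Set (Vec p)} {y : Vec p → ℤ → Ω → ℝ} (hy : ∀ a ∈ S, IsARCH P ε v K ρ a (y a))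
    {T : Set (Vec p)} {b : ℝ} (hb : 0 ≤ b) (hT0 : ∀ θ ∈ T, ∀ k, 0 ≤ θ k)
    (hTb : ∀ θ ∈ T, ∀ k, θ k ≤ b) {F ν : Measure ℝ} [IsFiniteMeasure F] [IsFiniteMeasure ν]
    {q : ℝ × ℝ → ℝ} {Q : ℝ} (hq : IsScore F ν q Q) {w : Vec p → Vec p → ℝ} {L : ℝ}
    (hw : IsWeight T S P y w L) {κ : ℝ} (hκ : 0 < κ) :
    ∃ r : ℝ, 0 < r ∧ ∀ θ' ∈ T,
      ∃ (D : (Fin (p + 1) → ℝ) → ℝ) (B : ℝ), Measurable D ∧ (∀ u, |D u| ≤ B) ∧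
        (∀ᵐ u : Fin (p + 1) → ℝ, ∀ θ ∈ T, ‖θ - θ'‖ < r →
          ∫ x, |scoreWeight q w θ (u, x) - scoreWeight q w θ' (u, x)| ∂F ≤ D u) ∧
        ∀ a ∈ S, ∫ ω, D (obs p (y a) 1 ω) ∂P ≤ κ := by
  obtain ⟨M, C, hMm, hM0, hMlip, hMint⟩ := hw.lipschitz
  have hL := hw.nonneg
  have hQ : 0 ≤ Q := (abs_nonneg _).trans (hq.bound 0)
  set f := F.real Set.univ with hf
  have hf0 : 0 ≤ f := measureReal_nonneg
  -- The ν-mass of an interval of half-width τ around the residual has mean at most c₁ τ.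
  set c₁ : ℝ := |K| * ((1 + b * ((p + 1) * (v / (1 - ρ)))) * (2 * ν.real Set.univ)) with hc₁
  obtain ⟨τ, hτ, hτ'⟩ := exists_pos_mul_le (L * c₁) (κ := κ / 3) (by linarith)
  obtain ⟨R, hR, hR'⟩ : ∃ R : ℝ, 0 < R ∧
      L * (2 * Q * f * ((p + 1) * (v / (1 - ρ)) / R ^ 2)) ≤ κ / 3 := by
    have hlim : Tendsto (fun R : ℝ => L * (2 * Q * f * ((p + 1) * (v / (1 - ρ)) / R ^ 2)))
        atTop (𝓝 0) := by
      have : Tendsto (fun R : ℝ => (p + 1) * (v / (1 - ρ)) / R ^ 2) atTop (𝓝 0) :=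
        tendsto_const_nhds.div_atTop (tendsto_pow_atTop two_ne_zero)
      simpa using (this.const_mul (2 * Q * f)).const_mul L
    obtain ⟨R, h1, h2⟩ := (((tendsto_order.1 hlim).2 (κ / 3) (by linarith)).and
      (eventually_gt_atTop 0)).exists
    exact ⟨R, h2, h1.le⟩
  obtain ⟨r₁, hr₁, hr₁'⟩ := exists_pos_mul_le (p * R ^ 3) hτ
  obtain ⟨r₂, hr₂, hr₂'⟩ := exists_pos_mul_le (Q * f * |C|) (κ := κ / 3) (by linarith)
  set r := min r₁ r₂ with hrdef
  have hr : 0 < r := lt_min hr₁ hr₂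
  refine ⟨r, hr, fun θ' hθ' => ?_⟩
  set N : (Fin (p + 1) → ℝ) → ℝ := fun u =>
    ν.real (Set.Icc (residOf θ' u - τ) (residOf θ' u + τ)) with hN
  have hNm : Measurable N :=
    ((measurable_measure_Icc ν τ).comp (measurable_residOf θ')).ennreal_toReal
  have hN0 : ∀ u, 0 ≤ N u := fun u => measureReal_nonneg
  have hNν : ∀ u, N u ≤ ν.real Set.univ := fun u =>
    measureReal_mono (Set.subset_univ _) (measure_ne_top _ _)
  set A : Set (Fin (p + 1) → ℝ) := {u | R < ‖u‖} with hA
  have hAm : MeasurableSet A := measurableSet_lt measurable_const measurable_norm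
  set I : (Fin (p + 1) → ℝ) → ℝ := A.indicator fun _ => 2 * Q * f with hI
  have hIm : Measurable I := measurable_const.indicator hAm
  have hI0 : ∀ u, 0 ≤ I u := fun u => Set.indicator_nonneg (fun _ _ => by positivity) u
  have hIB : ∀ u, I u ≤ 2 * Q * f := fun u =>
    Set.indicator_le_self' (fun _ _ => by positivity) u
  -- The Lipschitz constant M is unbounded; the minimum with 2L keeps the oscillation bound bounded,
  -- as the law of large numbers requires.
  set W : (Fin (p + 1) → ℝ) → ℝ := fun u => min (2 * L) (r * M (lagOf u)) with hW
  have hWm : Measurable W := measurable_const.min ((hMm.comp measurable_lagOf).const_mul r)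
  have hW0 : ∀ u, 0 ≤ W u := fun u => le_min (by positivity) (mul_nonneg hr.le (hM0 _))
  have hWB : ∀ u, W u ≤ 2 * L := fun u => min_le_left _ _
  refine ⟨fun u => L * (N u + I u) + Q * f * W u,
    L * (ν.real Set.univ + 2 * Q * f) + Q * f * (2 * L),
    ((hNm.add hIm).const_mul L).add (hWm.const_mul _), fun u => ?_, ?_, fun a ha => ?_⟩
  · have h1 := hN0 u
    have h2 := hI0 u
    have h3 := hW0 u
    rw [abs_of_nonneg (by positivity)]
    exact add_le_add (mul_le_mul_of_nonneg_left (add_le_add (hNν u) (hIB u)) hL)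
      (mul_le_mul_of_nonneg_left (hWB u) (by positivity))
  · filter_upwards [ae_lagOf hMlip] with u hu θ hθ hlt
    have hqi : ∀ c : ℝ, Integrable (fun x => q (c, x)) F := fun c =>
      Integrable.of_bound (hq.measurable.comp
        (measurable_const.prodMk measurable_id)).aestronglyMeasurable Q
        (ae_of_all _ fun x => hq.bound _)
    have hdi : Integrable (fun x => |q (residOf θ u, x) - q (residOf θ' u, x)|) F :=
      ((hqi _).sub (hqi _)).abs
    have hwd : |w (lagOf u) θ - w (lagOf u) θ'| ≤ W u := by
      refine le_min ?_ ?_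
      · exact (abs_sub _ _).trans (by linarith [hw.bound (lagOf u) θ hθ, hw.bound (lagOf u) θ' hθ'])
      · refine (hu θ hθ θ' hθ').trans ?_
        rw [mul_comm]
        exact mul_le_mul_of_nonneg_right hlt.le (hM0 _)
    have hqd : ∫ x, |q (residOf θ u, x) - q (residOf θ' u, x)| ∂F ≤ N u + I u := by
      by_cases hbig : R < ‖u‖
      · have : I u = 2 * Q * f := Set.indicator_of_mem (show u ∈ A from hbig) _
        rw [this]
        have h1 : ∫ x, |q (residOf θ u, x) - q (residOf θ' u, x)| ∂F ≤ ∫ _x, 2 * Q ∂F :=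
          integral_mono hdi (integrable_const _) fun x => (abs_sub _ _).trans
            (by linarith [hq.bound (residOf θ u, x), hq.bound (residOf θ' u, x)])
        rw [integral_const, smul_eq_mul] at h1
        have := hN0 u
        linarith
      · have h1 := abs_residOf_sub_le (hT0 θ hθ) (hT0 θ' hθ') (not_lt.1 hbig)
        have h2 : |residOf θ u - residOf θ' u| ≤ τ := by
          refine h1.trans (le_trans ?_ hr₁')
          exact mul_le_mul_of_nonneg_left (hlt.le.trans (min_le_left _ _)) (by positivity)
        have := hq.osc _ _ _ h2
        have := hI0 u
        linarith
    calc ∫ x, |scoreWeight q w θ (u, x) - scoreWeight q w θ' (u, x)| ∂F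
        ≤ ∫ x, (L * |q (residOf θ u, x) - q (residOf θ' u, x)| + Q * W u) ∂F := by
          refine integral_mono_of_nonneg (ae_of_all _ fun _ => abs_nonneg _)
            ((hdi.const_mul L).add (integrable_const _)) (ae_of_all _ fun x => ?_)
          have e : scoreWeight q w θ (u, x) - scoreWeight q w θ' (u, x) =
              w (lagOf u) θ * (q (residOf θ u, x) - q (residOf θ' u, x)) +
                q (residOf θ' u, x) * (w (lagOf u) θ - w (lagOf u) θ') := by
            simp only [scoreWeight]; ring
          simp only [e]
          refine (abs_add_le _ _).trans ?_
          rw [abs_mul, abs_mul]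
          exact add_le_add (mul_le_mul_of_nonneg_right (hw.bound _ _ hθ) (abs_nonneg _))
            (mul_le_mul (hq.bound _) hwd (abs_nonneg _) hQ)
      _ = L * ∫ x, |q (residOf θ u, x) - q (residOf θ' u, x)| ∂F + f * (Q * W u) := by
          rw [integral_add (hdi.const_mul L) (integrable_const _), integral_const_mul,
            integral_const, smul_eq_mul]
      _ ≤ L * (N u + I u) + f * (Q * W u) := by gcongr
      _ = _ := by ring
  · have hya := hy a ha
    have hX := hya.measurable_obs 1
    have bd : ∀ {g : (Fin (p + 1) → ℝ) → ℝ} {B : ℝ}, Measurable g → (∀ u, 0 ≤ g u) →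
        (∀ u, g u ≤ B) → Integrable (fun ω => g (obs p (y a) 1 ω)) P := fun hg h0 hB =>
      Integrable.of_bound (hg.comp hX).aestronglyMeasurable _ (ae_of_all _ fun ω => by
        rw [Real.norm_eq_abs, abs_of_nonneg (h0 _)]; exact hB _)
    have iN := bd hNm hN0 hNν
    have iI := bd hIm hI0 hIB
    have iW := bd hWm hW0 hWB
    have hC : 0 ≤ v / (1 - ρ) :=
      div_nonneg hya.noise.variance_nonneg (by linarith [hya.rho_lt])
    have eN : ∫ ω, N (obs p (y a) 1 ω) ∂P ≤ c₁ * τ := by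
      have h1 := hya.lintegral_measure_Icc_residOf_le ν (hT0 θ' hθ') (hTb θ' hθ') hb hτ.le
      rw [← ENNReal.ofReal_le_ofReal_iff (by positivity),
        ofReal_integral_eq_lintegral_ofReal iN (ae_of_all _ fun _ => hN0 _)]
      refine (lintegral_congr fun ω => ofReal_measureReal).trans_le (h1.trans_eq ?_)
      congr 1
      rw [hc₁]; ring
    have eI : ∫ ω, I (obs p (y a) 1 ω) ∂P ≤ 2 * Q * f * ((p + 1) * (v / (1 - ρ)) / R ^ 2) := by
      have h1 : ∫ ω, I (obs p (y a) 1 ω) ∂P = P.real {ω | R < ‖obs p (y a) 1 ω‖} * (2 * Q * f) := by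
        have : (fun ω => I (obs p (y a) 1 ω)) =
            {ω | R < ‖obs p (y a) 1 ω‖}.indicator fun _ => 2 * Q * f := rfl
        rw [this, integral_indicator_const _ (measurableSet_lt measurable_const hX.norm),
          smul_eq_mul]
      rw [h1, mul_comm]
      exact mul_le_mul_of_nonneg_left (hya.measureReal_norm_obs_le 1 hR) (by positivity)
    have eW : ∫ ω, W (obs p (y a) 1 ω) ∂P ≤ |C| * r₂ := by
      calc _ ≤ ∫ ω, r * M (lagOf (obs p (y a) 1 ω)) ∂P :=
            integral_mono iW ((hMint a ha).1.const_mul r) fun ω => min_le_right _ _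
        _ = r * ∫ ω, M (lagOf (obs p (y a) 1 ω)) ∂P := integral_const_mul _ _
        _ ≤ r₂ * |C| := mul_le_mul (min_le_right _ _) ((hMint a ha).2.trans (le_abs_self C))
            (integral_nonneg fun _ => hM0 _) hr₂.le
        _ = _ := mul_comm _ _
    have iNI : Integrable (fun ω => N (obs p (y a) 1 ω) + I (obs p (y a) 1 ω)) P := iN.add iI
    have hsum : ∫ ω, (L * (N (obs p (y a) 1 ω) + I (obs p (y a) 1 ω)) +
        Q * f * W (obs p (y a) 1 ω)) ∂P =
        L * (∫ ω, N (obs p (y a) 1 ω) ∂P + ∫ ω, I (obs p (y a) 1 ω) ∂P) +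
          Q * f * ∫ ω, W (obs p (y a) 1 ω) ∂P := by
      rw [integral_add (iNI.const_mul L) (iW.const_mul _), integral_const_mul,
        integral_const_mul, integral_add iN iI]
    rw [hsum]
    have a1 := mul_le_mul_of_nonneg_left eN hL
    have a2 := mul_le_mul_of_nonneg_left eI hL
    have a3 := mul_le_mul_of_nonneg_left eW (by positivity : 0 ≤ Q * f)
    have a4 : Q * f * (|C| * r₂) = Q * f * |C| * r₂ := by ring
    have a5 : L * (c₁ * τ) = L * c₁ * τ := by ring
    rw [mul_add]
    linarith

/-- The uniform weak law of large numbers for averages of `q(ε_t(θ), x) w(Y_{t-1}, θ)`. -/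
theorem exists_uniform_lln_scoreWeight {P : Measure Ω} [IsProbabilityMeasure P] {ε : ℤ → Ω → ℝ}
    {v K ρ : ℝ} {S : Set (Vec p)} {y : Vec p → ℤ → Ω → ℝ}
    (hy : ∀ a ∈ S, IsARCH P ε v K ρ a (y a))
    {T : Set (Vec p)} (hT : IsCompact T) {b : ℝ} (hb : 0 ≤ b) (hT0 : ∀ θ ∈ T, ∀ k, 0 ≤ θ k)
    (hTb : ∀ θ ∈ T, ∀ k, θ k ≤ b) {F ν : Measure ℝ} [IsFiniteMeasure F] [IsFiniteMeasure ν]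
    {q : ℝ × ℝ → ℝ} {Q : ℝ} (hq : IsScore F ν q Q) {w : Vec p → Vec p → ℝ} {L : ℝ}
    (hw : IsWeight T S P y w L) {κ : ℝ} (hκ : 0 < κ) :
    ∃ N : ℕ, ∀ n : ℕ, N < n → ∀ a ∈ S,
      P {ω | ∃ θ ∈ T, κ < ∫ x, |avg n (fun t => scoreWeight q w θ (obs p (y a) t ω, x)) -
        ∫ ω', scoreWeight q w θ (obs p (y a) 1 ω', x) ∂P| ∂F} ≤ ENNReal.ofReal κ :=
  exists_uniform_lln hy hT F
    (fun θ hθ => measurable_scoreWeight hq.measurable (hw.measurable θ hθ)) (C := Q * L)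
    (fun θ hθ z => by
      rw [scoreWeight, abs_mul]
      exact mul_le_mul (hq.bound _) (hw.bound _ θ hθ) (abs_nonneg _)
        ((abs_nonneg _).trans (hq.bound 0)))
    (fun _ hκ => exists_oscillation hy hb hT0 hTb hq hw hκ) hκ

/-! ### Uniform convergence of empirical covariances without contamination -/

/-- The empirical covariance of `q(ε_t(θ), x)` and `w(Y_{t-1}, θ)`. -/
def empCov (q : ℝ × ℝ → ℝ) (w : Vec p → Vec p → ℝ) (n : ℕ) (y : ℤ → ℝ) (x : ℝ) (θ : Vec p) : ℝ :=
  avg n (fun t => q (resid y θ t, x) * w (lag p y (t - 1)) θ) -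
    avg n (fun t => q (resid y θ t, x)) * avg n (fun t => w (lag p y (t - 1)) θ)

/-- The covariance of `q(ε_1(θ), x)` and `w(Y_0, θ)`. -/
def popCov (P : Measure Ω) (q : ℝ × ℝ → ℝ) (w : Vec p → Vec p → ℝ) (y : ℤ → Ω → ℝ) (x : ℝ)
    (θ : Vec p) : ℝ :=
  ∫ ω, q (residOf θ (obs p y 1 ω), x) * w (lagOf (obs p y 1 ω)) θ ∂P -
    (∫ ω, q (residOf θ (obs p y 1 ω), x) ∂P) * ∫ ω, w (lagOf (obs p y 1 ω)) θ ∂P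

/-- Constant scores, like the constant weights below, let the law for products also cover the two
marginal averages in a covariance. -/
lemma isScore_one (F ν : Measure ℝ) : IsScore F ν (fun _ => 1) 1 where
  measurable := measurable_const
  bound _ := by simp
  osc _ _ _ _ := by simp

lemma isWeight_one (T S : Set (Vec p)) (P : Measure Ω) (y : Vec p → ℤ → Ω → ℝ) :
    IsWeight T S P y (fun _ _ => 1) 1 where
  measurable _ _ := measurable_const
  nonneg := zero_le_one
  bound _ _ _ := by simp
  lipschitz := ⟨0, 0, measurable_zero, fun _ => le_rfl, by simp, fun _ _ => by simp⟩

/-- The data shared by the consistency theorems: a compact parameter set and a family of stationary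
ARCH processes on which score and weight functions are evaluated. -/
structure ARCHFamily (P : Measure Ω) (ε : ℤ → Ω → ℝ) (v K ρ b : ℝ) (T S : Set (Vec p))
    (y : Vec p → ℤ → Ω → ℝ) : Prop where
  arch : ∀ a ∈ S, IsARCH P ε v K ρ a (y a)
  compact : IsCompact T
  b_nonneg : 0 ≤ b
  coord_nonneg : ∀ θ ∈ T, ∀ k, 0 ≤ θ k
  coord_le : ∀ θ ∈ T, ∀ k, θ k ≤ b

section

variable {P : Measure Ω} [IsProbabilityMeasure P] {ε : ℤ → Ω → ℝ} {v K ρ b : ℝ}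
  {T S : Set (Vec p)} {y : Vec p → ℤ → Ω → ℝ} {F ν : Measure ℝ} [IsFiniteMeasure F]
  [IsFiniteMeasure ν] {q : ℝ × ℝ → ℝ} {Q L : ℝ} {w : Vec p → Vec p → ℝ}

lemma abs_avg_mul_sub_le {A A' B B' D D' L Q : ℝ} (hB : |B'| ≤ Q) (hD : |D| ≤ L) :
    |(A - B * D) - (A' - B' * D')| ≤ |A - A'| + L * |B - B'| + Q * |D - D'| := by
  have e : (A - B * D) - (A' - B' * D') = (A - A') - D * (B - B') - B' * (D - D') := by ring
  rw [e]
  refine (abs_sub _ _).trans (add_le_add ((abs_sub _ _).trans (add_le_add_right ?_ _)) ?_)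
  · rw [abs_mul]; exact mul_le_mul_of_nonneg_right hD (abs_nonneg _)
  · rw [abs_mul]; exact mul_le_mul_of_nonneg_right hB (abs_nonneg _)

lemma integrable_avg_scoreWeight (hq : Measurable q) (hQ : ∀ z, |q z| ≤ Q) (n : ℕ) (θ : Vec p)
    (u : ℤ → Fin (p + 1) → ℝ) :
    Integrable (fun x => avg n fun t => scoreWeight q w θ (u t, x)) F := by
  refine integrable_avg n fun t => ?_
  have h : Integrable (fun x => q (residOf θ (u t), x)) F :=
    Integrable.of_bound (hq.comp (measurable_const.prodMk measurable_id)).aestronglyMeasurable Q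
      (ae_of_all _ fun x => hQ _)
  exact h.mul_const (w (lagOf (u t)) θ)

lemma integrable_integral_scoreWeight {a : Vec p} {y : ℤ → Ω → ℝ} (hy : IsARCH P ε v K ρ a y)
    (hq : Measurable q) (hQ : ∀ z, |q z| ≤ Q) {θ : Vec p} (hwm : Measurable fun U => w U θ)
    (hL : ∀ U, |w U θ| ≤ L) :
    Integrable (fun x => ∫ ω, scoreWeight q w θ (obs p y 1 ω, x) ∂P) F := by
  refine Integrable.of_bound
    (hy.measurable_integral_obs (measurable_scoreWeight hq hwm) 1).aestronglyMeasurable (Q * L)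
    (ae_of_all _ fun x => IsARCH.abs_integral_obs_le (fun z => ?_) y 1 x)
  rw [scoreWeight, abs_mul]
  exact mul_le_mul (hQ _) (hL _) (abs_nonneg _) ((abs_nonneg _).trans (hQ 0))

/-- Uniform convergence of empirical covariances for uncontaminated observations. -/
theorem exists_uniform_empCov (hA : ARCHFamily P ε v K ρ b T S y) (hq : IsScore F ν q Q)
    (hw : IsWeight T S P y w L) {κ : ℝ} (hκ : 0 < κ) :
    ∃ N : ℕ, ∀ n : ℕ, N < n → ∀ a ∈ S,
      P {ω | ∃ θ ∈ T, κ < ∫ x, |empCov q w n (fun i => y a i ω) x θ - popCov P q w (y a) x θ| ∂F}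
        ≤ ENNReal.ofReal κ := by
  have hQ0 : 0 ≤ Q := (abs_nonneg _).trans (hq.bound 0)
  have hL0 := hw.nonneg
  set κ' : ℝ := κ / (3 * (1 + L + Q)) with hκ'
  have hκ'0 : 0 < κ' := by positivity
  have hκ'κ : κ' * (1 + L + Q) ≤ κ := by
    have : κ' * (1 + L + Q) = κ / 3 := by rw [hκ']; field_simp
    rw [this]; linarith
  have hκ'3 : κ' + κ' + κ' ≤ κ := by
    have : 0 ≤ κ' * (L + Q) := by positivity
    have : κ' * (1 + L + Q) = κ / 3 := by rw [hκ']; field_simp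
    nlinarith
  obtain ⟨N1, hN1⟩ := exists_uniform_lln_scoreWeight hA.arch hA.compact hA.b_nonneg
    hA.coord_nonneg hA.coord_le hq hw hκ'0
  obtain ⟨N2, hN2⟩ := exists_uniform_lln_scoreWeight hA.arch hA.compact hA.b_nonneg
    hA.coord_nonneg hA.coord_le hq (isWeight_one T S P y) hκ'0
  obtain ⟨N3, hN3⟩ := exists_uniform_lln_scoreWeight hA.arch hA.compact hA.b_nonneg
    hA.coord_nonneg hA.coord_le (isScore_one F ν) hw hκ'0
  refine ⟨N1 + N2 + N3, fun n hn a ha => ?_⟩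
  have h1 := hN1 n (by omega) a ha
  have h2 := hN2 n (by omega) a ha
  have h3 := hN3 n (by omega) a ha
  have hya := hA.arch a ha
  refine (measure_mono fun ω hω => ?_).trans ((measure_union_le _ _).trans (add_le_add
    ((measure_union_le _ _).trans (add_le_add h1 h2)) h3)) |>.trans ?_
  · obtain ⟨θ, hθ, hlt⟩ : ∃ θ ∈ T, κ <
      ∫ x, |empCov q w n (fun i => y a i ω) x θ - popCov P q w (y a) x θ| ∂F := hω
    by_contra hc
    rw [Set.mem_union, Set.mem_union, not_or, not_or] at hc
    obtain ⟨⟨hc1, hc2⟩, hc3⟩ := hc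
    have g1 : ∫ x, |avg n (fun t => scoreWeight q w θ (obs p (y a) t ω, x)) -
        ∫ ω', scoreWeight q w θ (obs p (y a) 1 ω', x) ∂P| ∂F ≤ κ' :=
      not_lt.1 fun h => hc1 ⟨θ, hθ, h⟩
    have g2 : ∫ x, |avg n (fun t => scoreWeight q (fun _ _ => 1) θ (obs p (y a) t ω, x)) -
        ∫ ω', scoreWeight q (fun _ _ => 1) θ (obs p (y a) 1 ω', x) ∂P| ∂F ≤ κ' :=
      not_lt.1 fun h => hc2 ⟨θ, hθ, h⟩
    have g3 : ∫ x, |avg n (fun t => scoreWeight (fun _ => 1) w θ (obs p (y a) t ω, x)) -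
        ∫ ω', scoreWeight (fun _ => 1) w θ (obs p (y a) 1 ω', x) ∂P| ∂F ≤ κ' :=
      not_lt.1 fun h => hc3 ⟨θ, hθ, h⟩
    have hwm := hw.measurable θ hθ
    have hwL := fun U => hw.bound U θ hθ
    have i1 := ((integrable_avg_scoreWeight (F := F) (w := w) hq.measurable hq.bound n θ
      fun t => obs p (y a) t ω).sub (integrable_integral_scoreWeight (F := F) hya hq.measurable
        hq.bound hwm hwL)).abs
    have i2 := ((integrable_avg_scoreWeight (F := F) (w := fun _ _ => 1) hq.measurable hq.bound n θ
      fun t => obs p (y a) t ω).sub (integrable_integral_scoreWeight (F := F) (L := 1) (θ := θ) hya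
        hq.measurable hq.bound (w := fun _ _ => 1) measurable_const (by simp))).abs
    have i3 := ((integrable_avg_scoreWeight (F := F) (w := w) (isScore_one F ν).measurable
      (isScore_one F ν).bound n θ
      fun t => obs p (y a) t ω).sub (integrable_integral_scoreWeight (F := F) hya
        (isScore_one F ν).measurable (isScore_one F ν).bound hwm hwL)).abs
    have hpt : ∀ x, |empCov q w n (fun i => y a i ω) x θ - popCov P q w (y a) x θ| ≤
        |avg n (fun t => scoreWeight q w θ (obs p (y a) t ω, x)) -
          ∫ ω', scoreWeight q w θ (obs p (y a) 1 ω', x) ∂P| +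
        L * |avg n (fun t => scoreWeight q (fun _ _ => 1) θ (obs p (y a) t ω, x)) -
          ∫ ω', scoreWeight q (fun _ _ => 1) θ (obs p (y a) 1 ω', x) ∂P| +
        Q * |avg n (fun t => scoreWeight (fun _ => 1) w θ (obs p (y a) t ω, x)) -
          ∫ ω', scoreWeight (fun _ => 1) w θ (obs p (y a) 1 ω', x) ∂P| := by
      intro x
      unfold empCov popCov
      simp only [scoreWeight, mul_one, one_mul, resid_eq_residOf, lag_eq_lagOf]
      refine abs_avg_mul_sub_le ?_ (abs_avg_le_of_forall n hL0 fun t => hwL _)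
      exact IsARCH.abs_integral_obs_le (f := fun z => q (residOf θ z.1, z.2))
        (fun z => hq.bound _) (y a) 1 x
    have hle : ∫ x, |empCov q w n (fun i => y a i ω) x θ - popCov P q w (y a) x θ| ∂F ≤
        _ + L * _ + Q * _ :=
      (integral_mono_of_nonneg (ae_of_all _ fun _ => abs_nonneg _)
        ((i1.add (i2.const_mul L)).add (i3.const_mul Q)) (ae_of_all _ hpt)).trans_eq
        ((integral_add (i1.add (i2.const_mul L)) (i3.const_mul Q)).trans
          (congrArg₂ (· + ·) ((integral_add i1 (i2.const_mul L)).trans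
            (congrArg (_ + ·) (integral_const_mul _ _))) (integral_const_mul _ _)))
    have j2 := mul_le_mul_of_nonneg_left g2 hL0
    have j3 := mul_le_mul_of_nonneg_left g3 hQ0
    have : κ' * (1 + L + Q) = κ' + L * κ' + Q * κ' := by ring
    exact absurd hlt (not_lt.2 (hle.trans ((add_le_add (add_le_add g1 j2) j3).trans (by linarith))))
  · rw [← ENNReal.ofReal_add hκ'0.le hκ'0.le, ← ENNReal.ofReal_add (by positivity) hκ'0.le]
    exact ENNReal.ofReal_le_ofReal hκ'3

end

/-! ### Effect of contamination on empirical covariances -/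

lemma abs_avg_sub_avg_le {n : ℕ} {f f' e : ℤ → ℝ} {C : ℝ} (hf : ∀ t, |f t| ≤ C)
    (hf' : ∀ t, |f' t| ≤ C) (he : ∀ t, 0 ≤ e t) (h : ∀ t, f t = f' t ∨ 1 ≤ e t) :
    |avg n f - avg n f'| ≤ 2 * C * avg n e := by
  have hC : 0 ≤ C := (abs_nonneg _).trans (hf 0)
  rw [avg_sub]
  refine (abs_avg_le n _).trans ?_
  have : 2 * C * avg n e = avg n fun t => 2 * C * e t := by
    unfold avg
    rw [← Finset.mul_sum]; ring
  rw [this]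
  refine avg_mono fun t => ?_
  rcases h t with h | h
  · rw [h, sub_self, abs_zero]
    exact mul_nonneg (by positivity) (he t)
  · refine (abs_sub _ _).trans ?_
    nlinarith [hf t, hf' t]

lemma lag_congr {y y' : ℤ → ℝ} {t : ℤ} (h : ∀ k ∈ Finset.range (p + 1), y (t - k) = y' (t - k)) :
    lag p y (t - 1) = lag p y' (t - 1) := by
  ext k
  have := h (k + 1) (by have := k.2; simp)
  simp only [lag]
  rw [show t - 1 - ((k : ℕ) : ℤ) = t - (((k : ℕ) + 1 : ℕ) : ℤ) by push_cast; ring]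
  exact this

lemma resid_congr {y y' : ℤ → ℝ} {t : ℤ} (h : ∀ k ∈ Finset.range (p + 1), y (t - k) = y' (t - k))
    (θ : Vec p) : resid y θ t = resid y' θ t := by
  have := h 0 (by simp)
  simp only [Nat.cast_zero, sub_zero] at this
  rw [resid, resid, lag_congr h, this]

/-- Changing a small proportion of the observations has a small effect on the empirical
covariance. -/
lemma abs_empCov_sub_le {q : ℝ × ℝ → ℝ} {w : Vec p → Vec p → ℝ} {Q L : ℝ} {θ : Vec p}
    (hq : ∀ z, |q z| ≤ Q) (hw : ∀ U, |w U θ| ≤ L) {n : ℕ} {y y' e : ℤ → ℝ} (he : ∀ t, 0 ≤ e t)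
    (h : ∀ t, (∀ k ∈ Finset.range (p + 1), y (t - k) = y' (t - k)) ∨ 1 ≤ e t) (x : ℝ) :
    |empCov q w n y x θ - empCov q w n y' x θ| ≤ 6 * Q * L * avg n e := by
  have hQ : 0 ≤ Q := (abs_nonneg _).trans (hq 0)
  have hL : 0 ≤ L := (abs_nonneg _).trans (hw 0)
  have hqw : ∀ (r : ℝ × ℝ) (U : Vec p), |q r * w U θ| ≤ Q * L := fun r U => by
    rw [abs_mul]; exact mul_le_mul (hq _) (hw _) (abs_nonneg _) hQ
  have hr : ∀ t, resid y θ t = resid y' θ t ∨ 1 ≤ e t := fun t =>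
    (h t).imp_left fun h => resid_congr h θ
  have hl : ∀ t, lag p y (t - 1) = lag p y' (t - 1) ∨ 1 ≤ e t := fun t =>
    (h t).imp_left fun h => lag_congr h
  have h1 := abs_avg_sub_avg_le (n := n) (f := fun t => q (resid y θ t, x) * w (lag p y (t - 1)) θ)
    (f' := fun t => q (resid y' θ t, x) * w (lag p y' (t - 1)) θ) (fun t => hqw _ _)
    (fun t => hqw _ _) he fun t => (h t).imp_left fun h => by
      simp only [resid_congr h θ, lag_congr h]
  have h2 := abs_avg_sub_avg_le (n := n) (f := fun t => q (resid y θ t, x))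
    (f' := fun t => q (resid y' θ t, x)) (fun t => hq _)
    (fun t => hq _) he fun t => (hr t).imp_left fun h => by simp only [h]
  have h3 := abs_avg_sub_avg_le (n := n) (f := fun t => w (lag p y (t - 1)) θ)
    (f' := fun t => w (lag p y' (t - 1)) θ) (fun t => hw _)
    (fun t => hw _) he fun t => (hl t).imp_left fun h => by simp only [h]
  refine (abs_avg_mul_sub_le (Q := Q) (L := L) (abs_avg_le_of_forall n hQ fun t => hq _)
    (abs_avg_le_of_forall n hL fun t => hw _)).trans ?_
  have := mul_le_mul_of_nonneg_left h2 hL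
  have := mul_le_mul_of_nonneg_left h3 hQ
  linarith

/-- The number of contaminated observations among `y_t, …, y_{t-p}`. -/
def badCount (p : ℕ) (z : ℤ → Ω → ℝ) (ω : Ω) (t : ℤ) : ℝ :=
  ∑ k ∈ Finset.range (p + 1), Set.indicator {ω | z (t - k) ω ≠ 0} (fun _ => (1 : ℝ)) ω

lemma badCount_nonneg (p : ℕ) (z : ℤ → Ω → ℝ) (ω : Ω) (t : ℤ) : 0 ≤ badCount p z ω t :=
  Finset.sum_nonneg fun _ _ => Set.indicator_nonneg (fun _ _ => zero_le_one) _

/-- A window with no active z is untouched. The values ξ play no role, which is the source of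
uniformity in the outlier law. -/
lemma contaminated_eq_or (p : ℕ) (y z ξ : ℤ → Ω → ℝ) (ω : Ω) (t : ℤ) :
    (∀ k ∈ Finset.range (p + 1), contaminated y z ξ ω (t - k) = y (t - k) ω) ∨
      1 ≤ badCount p z ω t := by
  by_cases h : ∀ k ∈ Finset.range (p + 1), z (t - k) ω = 0
  · left
    intro k hk
    simp [contaminated, h k hk]
  · right
    push Not at h
    obtain ⟨k, hk, hz⟩ := h
    have h1 : Set.indicator {ω | z (t - k) ω ≠ 0} (fun _ => (1 : ℝ)) ω = 1 :=
      Set.indicator_of_mem (show ω ∈ {ω | z (t - k) ω ≠ 0} from hz) _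
    rw [← h1]
    exact Finset.single_le_sum (f := fun k : ℕ =>
      Set.indicator {ω | z (t - k) ω ≠ 0} (fun _ => (1 : ℝ)) ω)
      (fun _ _ => Set.indicator_nonneg (fun _ _ => zero_le_one) _) hk

section

variable {P : Measure Ω} [IsProbabilityMeasure P] {n : ℕ} {γ : ℝ} {μξ : Measure ℝ}
  {y z ξ : ℤ → Ω → ℝ}

lemma IsContamination.measureReal_ne_zero (h : IsContamination p P n γ μξ y z ξ) (hγ : 0 ≤ γ)
    {t : ℤ} (ht : t ∈ Set.Icc (1 - (p : ℤ)) n) :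
    P.real {ω | z t ω ≠ 0} = γ := by
  have h1 : P {ω | z t ω ≠ 0} = P.map (z t) {0}ᶜ :=
    (Measure.map_apply (h.z_measurable t ht) (measurableSet_singleton 0).compl).symm
  rw [measureReal_def, h1, h.z_law t ht]
  simp [hγ]

/-- Linearity of expectation, using only the individual laws of the z_t. For 1 ≤ t ≤ n and k ≤ p the
times t - k fill exactly the range from 1 - p to n on which the contamination is specified. -/
lemma IsContamination.integral_avg_badCount (h : IsContamination p P n γ μξ y z ξ) (hγ : 0 ≤ γ) :
    Integrable (fun ω => avg n (badCount p z ω)) P ∧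
      ∫ ω, avg n (badCount p z ω) ∂P ≤ (p + 1) * γ := by
  have hmem : ∀ t ∈ Finset.Icc (1 : ℤ) n, ∀ k ∈ Finset.range (p + 1),
      t - (k : ℤ) ∈ Set.Icc (1 - (p : ℤ)) n := fun t ht k hk => by
    rw [Finset.mem_Icc] at ht
    rw [Finset.mem_range] at hk
    constructor <;> omega
  have hms : ∀ t ∈ Set.Icc (1 - (p : ℤ)) n, MeasurableSet {ω | z t ω ≠ 0} := fun t ht =>
    (h.z_measurable t ht) (measurableSet_singleton 0).compl
  have hi : ∀ t ∈ Finset.Icc (1 : ℤ) n, ∀ k ∈ Finset.range (p + 1),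
      Integrable (fun ω => Set.indicator {ω | z (t - k) ω ≠ 0} (fun _ => (1 : ℝ)) ω) P :=
    fun t ht k hk => (integrable_const (1 : ℝ)).indicator (hms _ (hmem t ht k hk))
  have hi2 : ∀ t ∈ Finset.Icc (1 : ℤ) n, Integrable (fun ω => badCount p z ω t) P := fun t ht =>
    integrable_finsetSum _ fun k hk => hi t ht k hk
  refine ⟨(integrable_finsetSum _ hi2).const_mul _, ?_⟩
  unfold avg
  rw [integral_const_mul, integral_finsetSum _ hi2]
  have h1 : ∀ t ∈ Finset.Icc (1 : ℤ) n, ∫ ω, badCount p z ω t ∂P = (p + 1) * γ := by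
    intro t ht
    unfold badCount
    rw [integral_finsetSum _ (hi t ht), Finset.sum_congr rfl fun k hk =>
      (integral_indicator_const (1 : ℝ) (hms _ (hmem t ht k hk))).trans
        (by rw [h.measureReal_ne_zero hγ (hmem t ht k hk), smul_eq_mul, mul_one])]
    simp
  rw [Finset.sum_congr rfl h1]
  exact avg_const_le n (by positivity)

end

section

variable {P : Measure Ω} [IsProbabilityMeasure P] {ε : ℤ → Ω → ℝ} {v K ρ b : ℝ}
  {T S : Set (Vec p)} {y : Vec p → ℤ → Ω → ℝ} {F ν : Measure ℝ} [IsFiniteMeasure F]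
  [IsFiniteMeasure ν] {q : ℝ × ℝ → ℝ} {Q L : ℝ} {w : Vec p → Vec p → ℝ}

lemma integrable_empCov (hq : Measurable q) (hQ : ∀ z, |q z| ≤ Q) (n : ℕ) (y : ℤ → ℝ) (θ : Vec p) :
    Integrable (fun x => empCov q w n y x θ) F := by
  have h : ∀ r : ℝ, Integrable (fun x => q (r, x)) F := fun r =>
    Integrable.of_bound (hq.comp (measurable_const.prodMk measurable_id)).aestronglyMeasurable Q
      (ae_of_all _ fun x => hQ _)
  exact (integrable_avg n fun t => (h _).mul_const _).sub
    ((integrable_avg n fun t => h _).mul_const _)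

lemma integrable_popCov {a : Vec p} {y : ℤ → Ω → ℝ} (hy : IsARCH P ε v K ρ a y)
    (hq : Measurable q) (hQ : ∀ z, |q z| ≤ Q) {θ : Vec p} (hwm : Measurable fun U => w U θ)
    (hL : ∀ U, |w U θ| ≤ L) : Integrable (fun x => popCov P q w y x θ) F := by
  have h1 := integrable_integral_scoreWeight (F := F) hy hq hQ hwm hL
  have h2 := integrable_integral_scoreWeight (F := F) (w := fun _ _ => 1) (L := 1) (θ := θ) hy hq hQ
    measurable_const (by simp)
  simp only [scoreWeight, mul_one] at h1 h2
  exact h1.sub (h2.mul_const _)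

/-- Uniform convergence of empirical covariances for contaminated observations, as the sample size
tends to infinity and the contamination rate tends to zero. -/
theorem eventually_uniform_empCov_contaminated (hA : ARCHFamily P ε v K ρ b T S y)
    (hq : IsScore F ν q Q) (hw : IsWeight T S P y w L) {κ : ℝ} (hκ : 0 < κ) :
    ∀ᶠ c : ℕ × ℝ in atTop ×ˢ 𝓝[≥] 0, ∀ a ∈ S, ∀ (μξ : Measure ℝ) (z ξ : ℤ → Ω → ℝ),
      IsContamination p P c.1 c.2 μξ (y a) z ξ →
      P {ω | ∃ θ ∈ T, κ < ∫ x, |empCov q w c.1 (contaminated (y a) z ξ ω) x θ -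
        popCov P q w (y a) x θ| ∂F} ≤ ENNReal.ofReal κ := by
  have hQ0 : 0 ≤ Q := (abs_nonneg _).trans (hq.bound 0)
  have hL0 := hw.nonneg
  obtain ⟨N, hN⟩ := exists_uniform_empCov hA hq hw (half_pos hκ)
  set B : ℝ := F.real Set.univ * (6 * Q * L) with hB
  have hB0 : 0 ≤ B := by positivity
  -- If the average number of bad entries per window is below c₀, the integrated covariances move by
  -- at most B c₀ ≤ κ/2.
  set c₀ : ℝ := κ / 2 / (B + 1) with hc₀
  have hc₀0 : 0 < c₀ := by positivity
  have hBc : B * c₀ ≤ κ / 2 := by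
    rw [hc₀, mul_div_assoc', div_le_iff₀ (by positivity)]
    nlinarith
  have hlim : Tendsto (fun γ : ℝ => (p + 1) * γ / c₀) (𝓝[≥] 0) (𝓝 0) := by
    have h : Continuous fun γ : ℝ => (p + 1) * γ / c₀ := by fun_prop
    have h' := (h.tendsto 0).mono_left (nhdsWithin_le_nhds (s := Set.Ici 0))
    simpa using h'
  have hγ := (((tendsto_order.1 hlim).2 (κ / 2) (half_pos hκ)).and
    (self_mem_nhdsWithin : ∀ᶠ γ : ℝ in 𝓝[≥] 0, γ ∈ Set.Ici 0))
  filter_upwards [(eventually_gt_atTop N).prod_mk hγ]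
  rintro ⟨n, γ⟩ ⟨hn, hγ', hγ0⟩ a ha μξ z ξ hcont
  obtain ⟨hbi, hbe⟩ := hcont.integral_avg_badCount (show 0 ≤ γ from hγ0)
  have h1 := hN n hn a ha
  have h2 := measure_ge_le_ofReal_div (fun ω => mul_nonneg (by positivity)
    (Finset.sum_nonneg fun t _ => badCount_nonneg p z ω t)) hbi hc₀0 hbe
  refine (measure_mono fun ω hω => ?_).trans ((measure_union_le _ _).trans (add_le_add h1 h2))
    |>.trans ?_
  · obtain ⟨θ, hθ, hlt⟩ : ∃ θ ∈ T, κ < ∫ x, |empCov q w n (contaminated (y a) z ξ ω) x θ -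
      popCov P q w (y a) x θ| ∂F := hω
    by_contra hc
    rw [Set.mem_union, not_or] at hc
    have g1 : ∫ x, |empCov q w n (fun i => y a i ω) x θ - popCov P q w (y a) x θ| ∂F ≤ κ / 2 :=
      not_lt.1 fun h => hc.1 ⟨θ, hθ, h⟩
    have g2 : avg n (badCount p z ω) < c₀ := not_le.1 fun h => hc.2 h
    have i1 : Integrable (fun x => |empCov q w n (fun i => y a i ω) x θ - popCov P q w (y a) x θ|) F :=
      ((integrable_empCov (F := F) (w := w) hq.measurable hq.bound n
      (fun i => y a i ω) θ).sub (integrable_popCov (F := F) (hA.arch a ha) hq.measurable hq.bound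
        (hw.measurable θ hθ) fun U => hw.bound U θ hθ)).abs
    have hle : ∫ x, |empCov q w n (contaminated (y a) z ξ ω) x θ - popCov P q w (y a) x θ| ∂F ≤
        ∫ x, (6 * Q * L * avg n (badCount p z ω) +
          |empCov q w n (fun i => y a i ω) x θ - popCov P q w (y a) x θ|) ∂F := by
      refine integral_mono_of_nonneg (ae_of_all _ fun _ => abs_nonneg _)
        ((integrable_const _).add i1) (ae_of_all _ fun x => ?_)
      exact (abs_sub_le _ (empCov q w n (fun i => y a i ω) x θ) _).trans (add_le_add_left
        (abs_empCov_sub_le hq.bound (fun U => hw.bound U θ hθ) (badCount_nonneg p z ω)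
          (contaminated_eq_or p (y a) z ξ ω) x) _)
    rw [integral_add (integrable_const _) i1, integral_const, smul_eq_mul, ← mul_assoc, ← hB] at hle
    have := mul_le_mul_of_nonneg_left g2.le hB0
    linarith
  · rw [← ENNReal.ofReal_add (by positivity) (by
      have : (0 : ℝ) ≤ γ := hγ0
      positivity)]
    exact ENNReal.ofReal_le_ofReal (by
      have : (p + 1) * γ / c₀ < κ / 2 := hγ'
      linarith)

end

/-! ### The assumptions of the theorem supply densities, a common contraction and weights -/

lemma DensityCondition.exists_le {g : ℝ → ℝ} (hg : DensityCondition g) : ∃ K : ℝ, ∀ x, g x ≤ K := by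
  have hc : Continuous g := hg.differentiable.continuous
  -- Where |x| ≥ 1 and |x g(x)| < 1 one has g(x) ≤ 1; the rest lies in a compact set, on which
  -- continuity bounds g.
  have h1 : ∀ᶠ x in cocompact ℝ, |x * g x| < 1 := by
    have := (hg.tendsto.abs)
    rw [abs_zero] at this
    exact (tendsto_order.1 this).2 1 one_pos
  have h2 : ∀ᶠ x : ℝ in cocompact ℝ, 1 ≤ ‖x‖ :=
    tendsto_norm_cocompact_atTop.eventually (eventually_ge_atTop 1)
  obtain ⟨k, hk, hsub⟩ := (hasBasis_cocompact.eventually_iff).1 (h1.and h2)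
  obtain ⟨C, hC⟩ := hk.exists_bound_of_continuousOn hc.continuousOn
  refine ⟨max C 1, fun x => ?_⟩
  by_cases hx : x ∈ k
  · exact ((le_abs_self _).trans (hC x hx)).trans (le_max_left _ _)
  · obtain ⟨h3, h4⟩ := hsub hx
    refine le_trans ?_ (le_max_right _ _)
    rw [abs_mul] at h3
    rw [Real.norm_eq_abs] at h4
    nlinarith [le_abs_self (g x), abs_nonneg (g x)]

lemma IsInnovation.isNoise {P : Measure Ω} {g : ℝ → ℝ} {ε : ℤ → Ω → ℝ} (h : IsInnovation P g ε)
    (hi : Integrable (fun x : ℝ => x ^ 2) (densityLaw g)) {K : ℝ} (hK : ∀ x, g x ≤ K) :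
    IsNoise P ε (innovVar g) K where
  measurable := h.measurable
  indep := h.indep
  sq_integrable t := by
    rw [← h.law t] at hi
    exact hi.comp_measurable (h.measurable t)
  sq_integral t := by
    rw [innovVar, ← h.law t]
    exact (integral_map (h.measurable t).aemeasurable (f := fun x : ℝ => x ^ 2)
      (by fun_prop : Measurable fun x : ℝ => x ^ 2).aestronglyMeasurable).symm
  law_le t := by
    rw [h.law t, densityLaw, ← withDensity_const]
    exact withDensity_mono (ae_of_all _ fun x => ENNReal.ofReal_le_ofReal (hK x))

lemma l1Norm_le_add (a b : Vec p) : l1Norm a ≤ l1Norm b + l1Norm (a - b) := by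
  unfold l1Norm
  rw [← Finset.sum_add_distrib]
  refine Finset.sum_le_sum fun k _ => ?_
  have := abs_add_le (b k) (a k - b k)
  rw [add_sub_cancel] at this
  exact this

lemma Theta.l1Norm_eq {β : ℝ} {a : Vec p} (ha : a ∈ Theta p β) : l1Norm a = ∑ k, a k :=
  Finset.sum_congr rfl fun k _ => abs_of_nonneg (ha.1 k)

lemma Theta.coord_le {β : ℝ} {a : Vec p} (ha : a ∈ Theta p β) (k : Fin p) : a k ≤ β⁻¹ :=
  ((le_abs_self _).trans (Finset.single_le_sum (f := fun k => |a k|)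
    (fun _ _ => abs_nonneg _) (Finset.mem_univ k))).trans ha.2

lemma isCompact_Theta (p : ℕ) (β : ℝ) : IsCompact (Theta p β) := by
  have hcl : IsClosed (Theta p β) := by
    have h1 : IsClosed {a : Vec p | ∀ k, 0 ≤ a k} := by
      have : {a : Vec p | ∀ k, 0 ≤ a k} = ⋂ k, {a : Vec p | 0 ≤ a k} := by ext; simp
      rw [this]
      exact isClosed_iInter fun k => isClosed_le continuous_const (by fun_prop)
    have h2 : IsClosed {a : Vec p | l1Norm a ≤ β⁻¹} :=
      isClosed_le (by unfold l1Norm; fun_prop) continuous_const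
    exact h1.inter h2
  refine Metric.isCompact_of_isClosed_isBounded hcl ?_
  refine (Metric.isBounded_iff_subset_closedBall 0).2 ⟨β⁻¹, fun a ha => ?_⟩
  rw [mem_closedBall_zero_iff]
  have h := ha.2
  have h0 : 0 ≤ l1Norm a := Finset.sum_nonneg fun _ _ => abs_nonneg _
  refine le_trans ?_ h
  rw [EuclideanSpace.norm_eq, Real.sqrt_le_left h0, l1Norm]
  simp only [Real.norm_eq_abs]
  exact Finset.sum_sq_le_sq_sum_of_nonneg fun _ _ => abs_nonneg _

/-- The triangle inequality ‖a‖₁ ≤ ‖b‖₁ + η gives one contraction factor for all admissible a. All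
later uniformity in a rests on it. -/
lemma archFamily {P : Measure Ω} [IsProbabilityMeasure P] {g : ℝ → ℝ} {ε : ℤ → Ω → ℝ} {β : ℝ}
    {b : Vec p} {η : ℝ} {y : Vec p → ℤ → Ω → ℝ} (hε : IsInnovation P g ε)
    (hstat : StationarityCondition g β b η)
    (hy : ∀ a ∈ ThetaLoc β b η, IsStationarySolution P ε a (y a)) {K : ℝ} (hK : ∀ x, g x ≤ K) :
    ARCHFamily P ε (innovVar g) K (innovVar g * (l1Norm b + η)) β⁻¹ (Theta p β) (ThetaLoc β b η)
      y where
  arch a ha :=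
    { noise := hε.isNoise hstat.sq_integrable hK
      nonneg := ha.2.1
      contraction := by
        rw [← Theta.l1Norm_eq ha.2]
        refine mul_le_mul_of_nonneg_left ?_ (hstat.beta_pos.le.trans hstat.beta_le)
        have : l1Norm (a - b) ≤ η := ha.1
        linarith [l1Norm_le_add a b]
      rho_pos := mul_pos (hstat.beta_pos.trans_le hstat.beta_le)
        (add_pos_of_nonneg_of_pos (Finset.sum_nonneg fun _ _ => abs_nonneg _) hstat.eta_pos)
      rho_lt := hstat.contraction
      solution := hy a ha }
  compact := isCompact_Theta p β
  b_nonneg := inv_nonneg.2 hstat.beta_pos.le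
  coord_nonneg _ hθ := hθ.1
  coord_le _ hθ := Theta.coord_le hθ

/-- Lowering coordinates without crossing zero never leaves Θ. This decides along which paths
partial derivatives may be integrated. -/
lemma Theta.of_le {β : ℝ} {θ θ' : Vec p} (hθ : θ ∈ Theta p β) (h0 : ∀ k, 0 ≤ θ' k)
    (hle : ∀ k, θ' k ≤ θ k) : θ' ∈ Theta p β := by
  refine ⟨h0, le_trans (Finset.sum_le_sum fun k _ => ?_) hθ.2⟩
  exact abs_le_abs_of_nonneg (h0 k) (hle k)

/-- A function on `Θ` with partial derivatives, taken within `Θ`, bounded by `M`. -/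
def HasBoundedPartials (β : ℝ) (f : Vec p → ℝ) (M : ℝ) : Prop :=
  ∀ k, ∀ θ ∈ Theta p β, ∃ d : ℝ,
    HasDerivWithinAt (fun s : ℝ => f (WithLp.toLp 2 (Function.update (θ : Fin p → ℝ) k s))) d
      {s : ℝ | WithLp.toLp 2 (Function.update (θ : Fin p → ℝ) k s) ∈ Theta p β} (θ k) ∧ |d| ≤ M

namespace HasBoundedPartials

variable {β M : ℝ} {f : Vec p → ℝ}

lemma abs_update_sub_le (h : HasBoundedPartials β f M) {θ : Vec p} (hθ : θ ∈ Theta p β) (k : Fin p)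
    {c : ℝ} (hc0 : 0 ≤ c) (hc : c ≤ θ k) :
    |f (WithLp.toLp 2 (Function.update (θ : Fin p → ℝ) k c)) - f θ| ≤ M * (θ k - c) := by
  have hmem : ∀ s ∈ Set.Icc c (θ k),
      WithLp.toLp 2 (Function.update (θ : Fin p → ℝ) k s) ∈ Theta p β := by
    intro s hs
    refine Theta.of_le hθ (fun i => ?_) fun i => ?_
    · change 0 ≤ Function.update (θ : Fin p → ℝ) k s i
      rcases eq_or_ne i k with rfl | hi
      · rw [Function.update_self]; exact hc0.trans hs.1
      · rw [Function.update_of_ne hi]; exact hθ.1 i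
    · change Function.update (θ : Fin p → ℝ) k s i ≤ θ i
      rcases eq_or_ne i k with rfl | hi
      · rw [Function.update_self]; exact hs.2
      · rw [Function.update_of_ne hi]
  have hd : ∀ s ∈ Set.Icc c (θ k), ∃ d : ℝ, HasDerivWithinAt
      (fun s : ℝ => f (WithLp.toLp 2 (Function.update (θ : Fin p → ℝ) k s))) d
        (Set.Icc c (θ k)) s ∧ |d| ≤ M := by
    intro s hs
    obtain ⟨d, h1, h2⟩ := h k _ (hmem s hs)
    simp only [Function.update_idem, Function.update_self] at h1
    exact ⟨d, h1.mono fun r hr => hmem r hr, h2⟩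
  choose! d hd1 hd2 using hd
  have := (convex_Icc c (θ k)).norm_image_sub_le_of_norm_hasDerivWithin_le (C := M)
    (fun s hs => hd1 s hs) (fun s hs => hd2 s hs) (Set.right_mem_Icc.2 hc) (Set.left_mem_Icc.2 hc)
  rw [Function.update_eq_self, Real.norm_eq_abs, Real.norm_eq_abs, abs_sub_comm c,
    abs_of_nonneg (sub_nonneg.2 hc)] at this
  exact this

/-- Coordinates are lowered one at a time, and every intermediate point stays in Θ. The mean value
inequality applies on each coordinate segment. -/
lemma abs_sub_le_of_le (h : HasBoundedPartials β f M) {θ θ' : Vec p} (hθ : θ ∈ Theta p β)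
    (h0 : ∀ k, 0 ≤ θ' k) (hle : ∀ k, θ' k ≤ θ k) :
    |f θ' - f θ| ≤ ∑ k, M * (θ k - θ' k) := by
  classical
  have key : ∀ s : Finset (Fin p), |f (WithLp.toLp 2 (s.piecewise θ' θ)) - f θ| ≤
      ∑ k ∈ s, M * (θ k - θ' k) := by
    intro s
    induction s using Finset.induction_on with
    | empty => simp
    | insert k s hk ih =>
      rw [Finset.sum_insert hk, Finset.piecewise_insert]
      have hm : WithLp.toLp 2 (s.piecewise θ' θ) ∈ Theta p β := by
        refine Theta.of_le hθ (fun i => ?_) fun i => ?_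
        · change 0 ≤ s.piecewise θ' θ i
          by_cases hi : i ∈ s
          · rw [Finset.piecewise_eq_of_mem _ _ _ hi]; exact h0 i
          · rw [Finset.piecewise_eq_of_notMem _ _ _ hi]; exact hθ.1 i
        · change s.piecewise θ' θ i ≤ θ i
          by_cases hi : i ∈ s
          · rw [Finset.piecewise_eq_of_mem _ _ _ hi]; exact hle i
          · rw [Finset.piecewise_eq_of_notMem _ _ _ hi]
      have hkk : s.piecewise θ' θ k = θ k := Finset.piecewise_eq_of_notMem _ _ _ hk
      have h1 := h.abs_update_sub_le hm k (h0 k) (by change θ' k ≤ s.piecewise θ' θ k; rw [hkk]; exact hle k)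
      change |f (WithLp.toLp 2 (Function.update (s.piecewise θ' θ) k (θ' k))) -
        f (WithLp.toLp 2 (s.piecewise θ' θ))| ≤ M * (s.piecewise θ' θ k - θ' k) at h1
      rw [hkk] at h1
      exact (abs_sub_le _ _ _).trans (add_le_add h1 ih)
  have := key Finset.univ
  rwa [Finset.piecewise_univ] at this

/-- Replacing coordinates of θ by those of θ' one by one could violate the ℓ¹ constraint. Passing
through the coordinatewise minimum compares each endpoint with a lower point; the two legs account
for the factor 2. -/
lemma lipschitz (h : HasBoundedPartials β f M) (hM : 0 ≤ M) {θ θ' : Vec p} (hθ : θ ∈ Theta p β)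
    (hθ' : θ' ∈ Theta p β) : |f θ - f θ'| ≤ 2 * p * M * ‖θ - θ'‖ := by
  set m : Vec p := WithLp.toLp 2 fun k => min (θ k) (θ' k) with hm
  have hm0 : ∀ k, 0 ≤ m k := fun k => le_min (hθ.1 k) (hθ'.1 k)
  have hk : ∀ k, |θ k - θ' k| ≤ ‖θ - θ'‖ := fun k => by simpa using PiLp.norm_apply_le (θ - θ') k
  have bd : ∀ τ : Vec p, τ ∈ Theta p β → (∀ k, m k ≤ τ k) →
      (∀ k, τ k - m k ≤ |θ k - θ' k|) → |f m - f τ| ≤ p * (M * ‖θ - θ'‖) := by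
    intro τ hτ h1 h2
    refine (h.abs_sub_le_of_le hτ hm0 h1).trans ?_
    calc _ ≤ ∑ _k : Fin p, M * ‖θ - θ'‖ :=
          Finset.sum_le_sum fun k _ => mul_le_mul_of_nonneg_left ((h2 k).trans (hk k)) hM
      _ = _ := by simp
  have b1 := bd θ hθ (fun k => min_le_left _ _) fun k => by
    change θ k - min (θ k) (θ' k) ≤ _
    rcases min_cases (θ k) (θ' k) with ⟨e, _⟩ | ⟨e, _⟩ <;> rw [e]
    · simp
    · exact le_abs_self _
  have b2 := bd θ' hθ' (fun k => min_le_right _ _) fun k => by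
    change θ' k - min (θ k) (θ' k) ≤ _
    rcases min_cases (θ k) (θ' k) with ⟨e, _⟩ | ⟨e, _⟩ <;> rw [e]
    · rw [abs_sub_comm]; exact le_abs_self _
    · simp
  rw [abs_sub_comm] at b1
  linarith [abs_sub_le (f θ) (f m) (f θ')]

end HasBoundedPartials

lemma lag_zero_eq_lagOf (y : ℤ → Ω → ℝ) (ω : Ω) :
    lag p (fun i => y i ω) 0 = lagOf (obs p y 1 ω) := lag_eq_lagOf y 1 ω

lemma Theta.zero_mem {β : ℝ} (hβ : 0 ≤ β) : (0 : Vec p) ∈ Theta p β :=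
  ⟨fun _ => le_rfl, by simpa [l1Norm] using hβ⟩

/-- The coordinates of the weight function are admissible weights. -/
lemma exists_isWeight [NeZero p] {P : Measure Ω} [IsProbabilityMeasure P] {ε : ℤ → Ω → ℝ}
    {v K ρ β c : ℝ} {b : Vec p} {η : ℝ} {y : Vec p → ℤ → Ω → ℝ} (hβ : 0 ≤ β)
    (hA : ARCHFamily P ε v K ρ c (Theta p β) (ThetaLoc β b η) y) {φ : Vec p → Vec p → Vec p}
    (hφ : WeightCondition P y β b η φ) (hbdd : BoundedWeight β φ) :
    ∃ L : ℝ, ∀ j, IsWeight (Theta p β) (ThetaLoc β b η) P y (fun U θ => φ U θ j) L := by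
  obtain ⟨L, hL⟩ := hbdd
  obtain ⟨hm, Φ, M, β₀, -, hMm, hβ₀, -, -, hder, C, hC⟩ := hφ
  refine ⟨L, fun j => ?_⟩
  have hj : ∀ (u : Vec p), |u j| ≤ ‖u‖ := fun u => PiLp.norm_apply_le u j
  have hder' : ∀ᵐ U : Vec p, 0 ≤ M U ∧ HasBoundedPartials β (fun θ => φ U θ j) (M U) := by
    filter_upwards [hder] with U hU
    obtain ⟨d, hd⟩ := hU
    -- M dominates an absolute value at one pair of indices, hence is nonnegative; such a pair
    -- exists because p is nonzero.
    exact ⟨(abs_nonneg _).trans ((hd 0 0).2 0 (Theta.zero_mem hβ)).2,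
      fun k θ hθ => ⟨d j k θ, (hd j k).2 θ hθ⟩⟩
  refine
    { measurable := fun θ hθ => (by fun_prop : Measurable fun u : Vec p => u j).comp (hm θ hθ)
      nonneg := (norm_nonneg _).trans (hL 0 0 (Theta.zero_mem hβ))
      bound := fun U θ hθ => (hj _).trans (hL U θ hθ)
      lipschitz := ⟨fun U => 2 * p * max (M U) 0, 2 * p * (1 + C), by fun_prop,
        fun U => by positivity, ?_, fun a ha => ?_⟩ }
  · filter_upwards [hder'] with U hU θ hθ θ' hθ'
    rw [max_eq_left hU.1]
    exact hU.2.lipschitz hU.1 hθ hθ'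
  · have hya := hA.arch a ha
    obtain ⟨hi, hC⟩ := hC a ha
    simp only [lag_zero_eq_lagOf] at hi hC
    have hM0 : ∀ᵐ ω ∂P, 0 ≤ M (lagOf (obs p (y a) 1 ω)) :=
      hya.ae_window (p + 1) 1 (ae_lagOf (hder'.mono fun U hU => hU.1))
    -- The moment of order 2 + β₀ dominates the first moment up to the additive constant 1.
    have hle : ∀ᵐ ω ∂P, max (M (lagOf (obs p (y a) 1 ω))) 0 ≤
        1 + M (lagOf (obs p (y a) 1 ω)) ^ (2 + β₀) := by
      filter_upwards [hM0] with ω hω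
      rw [max_eq_left hω]
      rcases le_total (M (lagOf (obs p (y a) 1 ω))) 1 with h1 | h1
      · linarith [Real.rpow_nonneg hω (2 + β₀)]
      · have := Real.rpow_le_rpow_of_exponent_le h1 (by linarith : 1 ≤ 2 + β₀)
        rw [Real.rpow_one] at this
        linarith
    have hi2 : Integrable (fun ω => 1 + M (lagOf (obs p (y a) 1 ω)) ^ (2 + β₀)) P :=
      (integrable_const _).add hi
    have hi3 : Integrable (fun ω => max (M (lagOf (obs p (y a) 1 ω))) 0) P := by
      refine hi2.mono' ?_ (hle.mono fun ω hω => ?_)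
      · exact ((hMm.comp (measurable_lagOf.comp (hya.measurable_obs 1))).max
          measurable_const).aestronglyMeasurable
      · rw [Real.norm_eq_abs, abs_of_nonneg (le_max_right _ _)]; exact hω
    refine ⟨hi3.const_mul _, ?_⟩
    rw [integral_const_mul]
    refine mul_le_mul_of_nonneg_left ((integral_mono_ae hi3 hi2 hle).trans ?_) (by positivity)
    rw [integral_add (integrable_const _) hi]
    simpa using hC

/-! ### The indicator score, population covariances and the drift -/

/-- The indicator `I{u ≤ x}` as a function of the pair `(u, x)`. -/
def leScore (z : ℝ × ℝ) : ℝ := leInd z.1 z.2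

lemma leScore_eq_indicator : leScore = Set.indicator {z : ℝ × ℝ | z.1 ≤ z.2} fun _ => (1 : ℝ) := by
  classical
  funext z
  rw [Set.indicator_apply]
  exact if_congr Iff.rfl rfl rfl

lemma measurable_leScore : Measurable leScore := by
  rw [leScore_eq_indicator]
  exact measurable_const.indicator (measurableSet_le measurable_fst measurable_snd)

lemma leInd_of_le {u x : ℝ} (h : u ≤ x) : leInd u x = 1 := if_pos h

lemma leInd_of_lt {u x : ℝ} (h : x < u) : leInd u x = 0 := if_neg (not_le.2 h)

lemma abs_leScore_le (z : ℝ × ℝ) : |leScore z| ≤ 1 := by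
  unfold leScore
  rcases le_or_gt z.1 z.2 with h | h
  · rw [leInd_of_le h, abs_one]
  · rw [leInd_of_lt h, abs_zero]; exact zero_le_one

/-- The two indicators differ only for x between u and v, hence inside the interval of half-width κ
around u. So F itself controls the oscillation. -/
lemma isScore_leScore (F : Measure ℝ) [IsFiniteMeasure F] : IsScore F F leScore 1 where
  measurable := measurable_leScore
  bound := abs_leScore_le
  osc u v κ h := by
    rw [← integral_indicator_one measurableSet_Icc]
    refine integral_mono_of_nonneg (ae_of_all _ fun _ => abs_nonneg _)
      ((integrable_const (1 : ℝ)).indicator measurableSet_Icc) (ae_of_all _ fun x => ?_)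
    obtain ⟨h1, h2⟩ := abs_le.1 h
    change |leInd v x - leInd u x| ≤ Set.indicator (Set.Icc (u - κ) (u + κ)) 1 x
    by_cases hx : x ∈ Set.Icc (u - κ) (u + κ)
    · rw [Set.indicator_of_mem hx, Pi.one_apply]
      rcases le_or_gt v x with h3 | h3 <;> rcases le_or_gt u x with h4 | h4 <;>
        simp [h3, h4, leInd_of_le, leInd_of_lt]
    · rw [Set.indicator_of_notMem hx]
      rw [Set.mem_Icc, not_and_or, not_le, not_le] at hx
      rcases hx with hx | hx
      · rw [leInd_of_lt (by linarith), leInd_of_lt (by linarith)]; simp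
      · rw [leInd_of_le (by linarith), leInd_of_le (by linarith)]; simp

lemma abs_empCov_le {q : ℝ × ℝ → ℝ} {w : Vec p → Vec p → ℝ} {Q L : ℝ} {θ : Vec p}
    (hq : ∀ z, |q z| ≤ Q) (hw : ∀ U, |w U θ| ≤ L) (n : ℕ) (y : ℤ → ℝ) (x : ℝ) :
    |empCov q w n y x θ| ≤ 2 * (Q * L) := by
  have hQ : 0 ≤ Q := (abs_nonneg _).trans (hq 0)
  have hL : 0 ≤ L := (abs_nonneg _).trans (hw 0)
  have h1 : |avg n fun t => q (resid y θ t, x) * w (lag p y (t - 1)) θ| ≤ Q * L :=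
    abs_avg_le_of_forall n (by positivity) fun t => by
      rw [abs_mul]; exact mul_le_mul (hq _) (hw _) (abs_nonneg _) hQ
  have h2 : |avg n (fun t => q (resid y θ t, x)) * avg n fun t => w (lag p y (t - 1)) θ| ≤ Q * L := by
    rw [abs_mul]
    exact mul_le_mul (abs_avg_le_of_forall n hQ fun t => hq _)
      (abs_avg_le_of_forall n hL fun t => hw _) (abs_nonneg _) hQ
  exact (abs_sub _ _).trans (by linarith)

section

variable {P : Measure Ω} [IsProbabilityMeasure P] {ε : ℤ → Ω → ℝ} {v K ρ : ℝ} {a : Vec p}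
  {y : ℤ → Ω → ℝ} {q : ℝ × ℝ → ℝ} {Q L : ℝ} {w : Vec p → Vec p → ℝ} {θ : Vec p}

lemma abs_popCov_le (hq : ∀ z, |q z| ≤ Q) (hw : ∀ U, |w U θ| ≤ L) (x : ℝ) :
    |popCov P q w y x θ| ≤ 2 * (Q * L) := by
  have hQ : 0 ≤ Q := (abs_nonneg _).trans (hq 0)
  have h1 := IsARCH.abs_integral_obs_le (P := P) (f := scoreWeight q w θ) (C := Q * L)
    (fun z => by
      rw [scoreWeight, abs_mul]; exact mul_le_mul (hq _) (hw _) (abs_nonneg _) hQ) y 1 x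
  have h2 := IsARCH.abs_integral_obs_le (P := P)
    (f := fun z : (Fin (p + 1) → ℝ) × ℝ => q (residOf θ z.1, z.2)) (C := Q) (fun z => hq _) y 1 x
  have h3 := IsARCH.abs_integral_obs_le (P := P)
    (f := fun z : (Fin (p + 1) → ℝ) × ℝ => w (lagOf z.1) θ) (C := L) (fun z => hw _) y 1 x
  refine (abs_sub _ _).trans ?_
  rw [abs_mul]
  have := mul_le_mul h2 h3 (abs_nonneg _) hQ
  simp only [scoreWeight] at h1 this
  linarith

lemma IsARCH.ae_residOf_self (h : IsARCH P ε v K ρ a y) :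
    ∀ᵐ ω ∂P, residOf a (obs p y 1 ω) = ε 1 ω := by
  filter_upwards [h.solution.equation 1] with ω hω
  rw [← resid_eq_residOf, resid, hω, mul_div_cancel_left₀]
  exact (Real.sqrt_pos.2 (one_pos.trans_le (one_le_volSq h.nonneg _))).ne'

/-- At the true parameter the residual is independent of the lag vector. -/
lemma IsARCH.popCov_self (h : IsARCH P ε v K ρ a y) (hq : Measurable q)
    (hw : Measurable fun U => w U a) (x : ℝ) : popCov P q w y x a = 0 := by
  have hqx : Measurable fun u => q (u, x) := hq.comp (measurable_id.prodMk measurable_const)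
  set G : (ℕ → ℝ) → ℝ := fun π => w (WithLp.toLp 2 fun k : Fin p => π k) a with hG
  have hGm : Measurable G := hw.comp ((WithLp.measurable_toLp 2 _).comp
    (measurable_pi_lambda _ fun k => measurable_pi_apply _))
  have hind := (h.indepFun_past_succ 0).comp hGm hqx
  have hl : ∀ ω, w (lagOf (obs p y 1 ω)) a = G (past (fun i => y i ω) 0) := fun ω => by
    rw [← lag_zero_eq_lagOf]
    rfl
  have e1 : ∫ ω, q (residOf a (obs p y 1 ω), x) * w (lagOf (obs p y 1 ω)) a ∂P =
      ∫ ω, (G ∘ fun ω => past (fun i => y i ω) 0) ω * ((fun u => q (u, x)) ∘ ε (0 + 1)) ω ∂P := by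
    refine integral_congr_ae ?_
    filter_upwards [h.ae_residOf_self] with ω hω
    rw [hω, hl, mul_comm]
    rfl
  have e2 : ∫ ω, q (residOf a (obs p y 1 ω), x) ∂P =
      ∫ ω, ((fun u => q (u, x)) ∘ ε (0 + 1)) ω ∂P := by
    refine integral_congr_ae ?_
    filter_upwards [h.ae_residOf_self] with ω hω
    rw [hω]
    rfl
  have e3 : ∫ ω, w (lagOf (obs p y 1 ω)) a ∂P =
      ∫ ω, (G ∘ fun ω => past (fun i => y i ω) 0) ω ∂P :=
    integral_congr_ae (ae_of_all _ hl)
  rw [popCov, e1, e2, e3, hind.integral_fun_mul_eq_mul_integral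
    (hGm.comp (h.measurable_past 0)).aestronglyMeasurable
    (hqx.comp (h.noise.measurable _)).aestronglyMeasurable, mul_comm, sub_self]

/-- Coordinates commute with the Bochner integral and a probability is the mean of an indicator. The
vector drift thus reduces to scalar covariances. -/
lemma IsARCH.drift_apply (h : IsARCH P ε v K ρ a y) {φ : Vec p → Vec p → Vec p}
    (hm : Measurable fun U => φ U θ) (hL : ∀ U, ‖φ U θ‖ ≤ L) (x : ℝ) (j : Fin p) :
    drift P φ y x θ j = popCov P leScore (fun U θ => φ U θ j) y x θ := by
  have hobs := h.measurable_obs 1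
  have hφm : Measurable fun ω => φ (lagOf (obs p y 1 ω)) θ := hm.comp (measurable_lagOf.comp hobs)
  have hrm : Measurable fun ω => residOf θ (obs p y 1 ω) := (measurable_residOf θ).comp hobs
  have hsm : Measurable fun ω => leInd (residOf θ (obs p y 1 ω)) x :=
    measurable_leScore.comp (hrm.prodMk measurable_const)
  have hi1 : Integrable (fun ω => φ (lagOf (obs p y 1 ω)) θ) P :=
    Integrable.of_bound hφm.aestronglyMeasurable L (ae_of_all _ fun ω => hL _)
  have hi2 : Integrable (fun ω => leInd (residOf θ (obs p y 1 ω)) x • φ (lagOf (obs p y 1 ω)) θ) P :=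
    hi1.bdd_smul 1 hsm.aestronglyMeasurable (ae_of_all _ fun ω => abs_leScore_le (_, x))
  have hP : P.real {ω | residOf θ (obs p y 1 ω) ≤ x} =
      ∫ ω, leInd (residOf θ (obs p y 1 ω)) x ∂P := by
    have hs : MeasurableSet {ω | residOf θ (obs p y 1 ω) ≤ x} :=
      measurableSet_le hrm measurable_const
    rw [← integral_indicator_one hs]
    refine integral_congr_ae (ae_of_all _ fun ω => ?_)
    by_cases hω : residOf θ (obs p y 1 ω) ≤ x
    · exact (Set.indicator_of_mem (show ω ∈ {ω | residOf θ (obs p y 1 ω) ≤ x} from hω) _).trans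
        (leInd_of_le hω).symm
    · exact (Set.indicator_of_notMem
        (show ω ∉ {ω | residOf θ (obs p y 1 ω) ≤ x} from hω) _).trans (leInd_of_lt (not_le.1 hω)).symm
  simp only [drift, popCov, resid_eq_residOf, lag_zero_eq_lagOf, hP, leScore]
  rw [PiLp.sub_apply, PiLp.smul_apply, eval_integral_piLp fun i => ?_,
    eval_integral_piLp fun i => ?_]
  · rfl
  · exact (EuclideanSpace.proj (𝕜 := ℝ) i).integrable_comp hi1
  · exact (EuclideanSpace.proj (𝕜 := ℝ) i).integrable_comp hi2

end

/-! ### Minimum distance estimates -/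

lemma residProc_apply (φ : Vec p → Vec p → Vec p) (n : ℕ) (y : ℤ → ℝ) (x : ℝ) (θ : Vec p)
    (j : Fin p) :
    residProc φ n y x θ j = √n * empCov leScore (fun U θ => φ U θ j) n y x θ := by
  have e : residProc φ n y x θ j = (√n)⁻¹ * ∑ t ∈ Finset.Icc (1 : ℤ) n,
      (leInd (resid y θ t) x - residEDF n y x θ) * φ (lag p y (t - 1)) θ j := by
    simp [residProc]
  rw [e]
  simp only [sub_mul, Finset.sum_sub_distrib, ← Finset.mul_sum]
  rcases Nat.eq_zero_or_pos n with rfl | hn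
  · simp
  · have hs : √(n : ℝ) ≠ 0 := by positivity
    have hn' : (n : ℝ) ≠ 0 := by positivity
    have hss : √(n : ℝ) * √n = n := Real.mul_self_sqrt (by positivity)
    simp only [empCov, avg, leScore, residEDF]
    field_simp
    rw [pow_two, hss]

lemma mdFunctional_eq (φ : Vec p → Vec p → Vec p) (F : Measure ℝ) (n : ℕ) (y : ℤ → ℝ) (θ : Vec p) :
    mdFunctional φ F n y θ =
      n * ∫ x, ∑ j, empCov leScore (fun U θ => φ U θ j) n y x θ ^ 2 ∂F := by
  unfold mdFunctional
  rw [← integral_const_mul]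
  congr 1
  funext x
  rw [EuclideanSpace.real_norm_sq_eq, Finset.mul_sum]
  refine Finset.sum_congr rfl fun j _ => ?_
  rw [residProc_apply, mul_pow, Real.sq_sqrt (by positivity)]

lemma measure_lt_of_subset_iUnion {P : Measure Ω} {A : Set Ω} {E : Fin p → Set Ω} {κ δ : ℝ}
    (hsub : A ⊆ ⋃ j, E j) (hE : ∀ j, P (E j) ≤ ENNReal.ofReal κ) (hδ : 0 < δ) (hκ : p * κ < δ) :
    P A < ENNReal.ofReal δ := by
  calc P A ≤ ∑ j, P (E j) := (measure_mono hsub).trans (measure_iUnion_fintype_le _ _)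
    _ ≤ ∑ _j : Fin p, ENNReal.ofReal κ := Finset.sum_le_sum fun j _ => hE j
    _ = ENNReal.ofReal (p * κ) := by
        rw [ENNReal.ofReal_mul (by positivity)]
        simp
    _ < ENNReal.ofReal δ := (ENNReal.ofReal_lt_ofReal_iff hδ).2 hκ

lemma exists_pos_mul_le_and_lt (c d : ℝ) {κ δ : ℝ} (hκ : 0 < κ) (hδ : 0 < δ) :
    ∃ r : ℝ, 0 < r ∧ c * r ≤ κ ∧ d * r < δ := by
  obtain ⟨r, hr, h1⟩ := exists_pos_mul_le |c| hκ
  obtain ⟨s, hs, h2⟩ := exists_pos_mul_le |d| (half_pos hδ)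
  refine ⟨min r s, lt_min hr hs, ?_, ?_⟩
  · calc c * min r s ≤ |c| * min r s :=
          mul_le_mul_of_nonneg_right (le_abs_self c) (lt_min hr hs).le
      _ ≤ |c| * r := mul_le_mul_of_nonneg_left (min_le_left _ _) (abs_nonneg _)
      _ ≤ κ := h1
  · calc d * min r s ≤ |d| * min r s :=
          mul_le_mul_of_nonneg_right (le_abs_self d) (lt_min hr hs).le
      _ ≤ |d| * s := mul_le_mul_of_nonneg_left (min_le_right _ _) (abs_nonneg _)
      _ < δ := by linarith

/-- The law of large numbers is in L¹(F), while the MD objective is an L² quantity; boundedness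
bridges the two. -/
lemma integral_sq_le_of_abs_le {F : Measure ℝ} {f : ℝ → ℝ} {B : ℝ} (hf : Integrable f F)
    (hB : ∀ x, |f x| ≤ B) : ∫ x, f x ^ 2 ∂F ≤ B * ∫ x, |f x| ∂F := by
  rw [← integral_const_mul]
  refine integral_mono_of_nonneg (ae_of_all _ fun _ => sq_nonneg _) (hf.abs.const_mul B)
    (ae_of_all _ fun x => ?_)
  change f x ^ 2 ≤ B * |f x|
  rw [← sq_abs]
  nlinarith [hB x, abs_nonneg (f x)]

lemma integrable_sq_of_abs_le {F : Measure ℝ} [IsFiniteMeasure F] {f : ℝ → ℝ} {B : ℝ}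
    (hf : Integrable f F) (hB : ∀ x, |f x| ≤ B) : Integrable (fun x => f x ^ 2) F :=
  Integrable.of_bound (hf.aestronglyMeasurable.pow 2) (B ^ 2) (ae_of_all _ fun x => by
    change ‖f x ^ 2‖ ≤ B ^ 2
    rw [norm_pow]
    exact pow_le_pow_left₀ (norm_nonneg _) (hB x) 2)

lemma integral_sq_le_add {F : Measure ℝ} [IsFiniteMeasure F] {f g : ℝ → ℝ} {B : ℝ}
    (hf : Integrable f F) (hg : Integrable g F) (hfB : ∀ x, |f x| ≤ B) (hgB : ∀ x, |g x| ≤ B) :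
    ∫ x, g x ^ 2 ∂F ≤ ∫ x, f x ^ 2 ∂F + 2 * B * ∫ x, |f x - g x| ∂F := by
  have hf2 := integrable_sq_of_abs_le hf hfB
  have hd : Integrable (fun x => 2 * B * |f x - g x|) F := (hf.sub hg).abs.const_mul _
  rw [← integral_const_mul, ← integral_add hf2 hd]
  refine integral_mono (integrable_sq_of_abs_le hg hgB) (hf2.add hd) fun x => ?_
  change g x ^ 2 ≤ f x ^ 2 + 2 * B * |f x - g x|
  have h1 : g x ^ 2 - f x ^ 2 ≤ |g x + f x| * |f x - g x| := by
    rw [← abs_mul]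
    refine le_trans (le_of_eq ?_) (neg_le_abs _)
    ring
  have h2 : |g x + f x| ≤ 2 * B := (abs_add_le _ _).trans (by linarith [hfB x, hgB x])
  have := mul_le_mul_of_nonneg_right h2 (abs_nonneg (f x - g x))
  linarith

section

variable {P : Measure Ω} [IsProbabilityMeasure P] {ε : ℤ → Ω → ℝ} {v K ρ c β : ℝ} {b : Vec p} {η : ℝ}
  {y : Vec p → ℤ → Ω → ℝ} {φ : Vec p → Vec p → Vec p} {L : ℝ}

/-- Consistency of the minimum distance estimates under contamination. -/
theorem eventually_isMDEstimate {F : Measure ℝ} [IsFiniteMeasure F]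
    (hA : ARCHFamily P ε v K ρ c (Theta p β) (ThetaLoc β b η) y)
    (hw : ∀ j, IsWeight (Theta p β) (ThetaLoc β b η) P y (fun U θ => φ U θ j) L)
    (hm : ∀ θ ∈ Theta p β, Measurable fun U => φ U θ) (hbdd : BoundedWeight β φ)
    (hMD : MDIdentifiable P y β b η φ F) {δ : ℝ} (hδ : 0 < δ) :
    ∀ᶠ c : ℕ × ℝ in atTop ×ˢ 𝓝[≥] 0, ∀ a ∈ ThetaLoc β b η, ∀ (μξ : Measure ℝ) (z ξ : ℤ → Ω → ℝ),
      IsContamination p P c.1 c.2 μξ (y a) z ξ →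
      P {ω | ∃ θ, IsMDEstimate β φ F c.1 (contaminated (y a) z ξ ω) θ ∧ δ < ‖θ - a‖}
        < ENNReal.ofReal δ := by
  obtain ⟨L', hL'⟩ := hbdd
  obtain ⟨δ₀, hδ₀, hid⟩ := hMD
  -- Per coordinate, 2Lκ bounds the objective at the true parameter and 4Lκ pays for replacing
  -- empirical by population covariances at θ. The condition pκ < δ is the union bound over
  -- coordinates.
  obtain ⟨κ, hκ, hκ1, hκ2⟩ := exists_pos_mul_le_and_lt (p * (6 * L)) p
    (by positivity : 0 < δ₀ * δ ^ 2) hδ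
  have hev := eventually_all.2 fun j =>
    eventually_uniform_empCov_contaminated hA (isScore_leScore F) (hw j) hκ
  have hn : ∀ᶠ c : ℕ × ℝ in atTop ×ˢ 𝓝[≥] 0, 0 < c.1 :=
    (eventually_gt_atTop 0).prod_inl _
  filter_upwards [hev, hn]
  rintro ⟨n, γ⟩ h hn a ha μξ z ξ hc
  have hn0 : (0 : ℝ) < n := Nat.cast_pos.2 hn
  refine measure_lt_of_subset_iUnion (fun ω hω => ?_) (fun j => h j a ha μξ z ξ hc) hδ hκ2
  obtain ⟨θ, ⟨hθ, hmin⟩, hlt⟩ : ∃ θ, IsMDEstimate β φ F n (contaminated (y a) z ξ ω) θ ∧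
    δ < ‖θ - a‖ := hω
  by_contra hnot
  rw [Set.mem_iUnion, not_exists] at hnot
  have hgood : ∀ j, ∀ θ ∈ Theta p β, ∫ x, |empCov leScore (fun U θ => φ U θ j) n
      (contaminated (y a) z ξ ω) x θ - popCov P leScore (fun U θ => φ U θ j) (y a) x θ| ∂F ≤ κ :=
    fun j θ hθ => not_lt.1 fun h => hnot j ⟨θ, hθ, h⟩
  have hya := hA.arch a ha
  set Y := contaminated (y a) z ξ ω with hY
  set e : Fin p → Vec p → ℝ → ℝ := fun j θ x =>
    empCov leScore (fun U θ => φ U θ j) n Y x θ with he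
  set d : Fin p → Vec p → ℝ → ℝ := fun j θ x =>
    popCov P leScore (fun U θ => φ U θ j) (y a) x θ with hd
  have hei : ∀ j θ, Integrable (e j θ) F := fun j θ =>
    integrable_empCov measurable_leScore abs_leScore_le n Y θ
  have hdi : ∀ j, ∀ θ ∈ Theta p β, Integrable (d j θ) F := fun j θ hθ =>
    integrable_popCov hya measurable_leScore abs_leScore_le ((hw j).measurable θ hθ)
      fun U => (hw j).bound U θ hθ
  have heB : ∀ j, ∀ θ ∈ Theta p β, ∀ x, |e j θ x| ≤ 2 * L := fun j θ hθ x =>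
    (abs_empCov_le abs_leScore_le (fun U => (hw j).bound U θ hθ) n Y x).trans_eq (by ring)
  have hdB : ∀ j, ∀ θ ∈ Theta p β, ∀ x, |d j θ x| ≤ 2 * L := fun j θ hθ x =>
    (abs_popCov_le abs_leScore_le (fun U => (hw j).bound U θ hθ) x).trans_eq (by ring)
  have hmd : ∀ θ ∈ Theta p β, mdFunctional φ F n Y θ = n * ∑ j, ∫ x, e j θ x ^ 2 ∂F := by
    intro θ hθ
    rw [mdFunctional_eq, integral_finsetSum _ fun j _ =>
      integrable_sq_of_abs_le (hei j θ) (heB j θ hθ)]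
  -- Minimality is used only against the true parameter, where the population covariances vanish.
  have hle : ∑ j, ∫ x, e j θ x ^ 2 ∂F ≤ ∑ j, ∫ x, e j a x ^ 2 ∂F := by
    have := hmin a ha.2
    rw [hmd θ hθ, hmd a ha.2] at this
    exact le_of_mul_le_mul_left this hn0
  have ha2 : ∑ j, ∫ x, e j a x ^ 2 ∂F ≤ ∑ _j : Fin p, 2 * L * κ := by
    refine Finset.sum_le_sum fun j _ => ?_
    have h0 : ∀ x, d j a x = 0 := fun x =>
      hya.popCov_self measurable_leScore ((hw j).measurable a ha.2) x
    have h1 := hgood j a ha.2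
    change ∫ x, |e j a x - d j a x| ∂F ≤ κ at h1
    simp only [h0, sub_zero] at h1
    exact (integral_sq_le_of_abs_le (hei j a) (heB j a ha.2)).trans
      (mul_le_mul_of_nonneg_left h1 (by linarith [(hw j).nonneg]))
  have hdr : ∫ x, ‖drift P φ (y a) x θ‖ ^ 2 ∂F = ∑ j, ∫ x, d j θ x ^ 2 ∂F := by
    rw [← integral_finsetSum _ fun j _ => integrable_sq_of_abs_le (hdi j θ hθ) (hdB j θ hθ)]
    congr 1
    funext x
    rw [EuclideanSpace.real_norm_sq_eq]
    refine Finset.sum_congr rfl fun j _ => ?_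
    rw [hya.drift_apply (hm θ hθ) (fun U => hL' U θ hθ) x j]
  have hdle : ∑ j, ∫ x, d j θ x ^ 2 ∂F ≤ ∑ j, ((∫ x, e j θ x ^ 2 ∂F) + 4 * L * κ) := by
    refine Finset.sum_le_sum fun j _ => ?_
    refine (integral_sq_le_add (hei j θ) (hdi j θ hθ) (heB j θ hθ) (hdB j θ hθ)).trans ?_
    have := mul_le_mul_of_nonneg_left (hgood j θ hθ)
      (by linarith [(hw j).nonneg] : 0 ≤ 2 * (2 * L))
    change 2 * (2 * L) * ∫ x, |e j θ x - d j θ x| ∂F ≤ 2 * (2 * L) * κ at this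
    linarith
  have hfin := hid a ha θ hθ
  rw [hdr] at hfin
  rw [Finset.sum_add_distrib] at hdle
  simp only [Finset.sum_const, Finset.card_univ, Fintype.card_fin, nsmul_eq_mul] at hdle ha2
  have hpow : δ₀ * δ ^ 2 < δ₀ * ‖θ - a‖ ^ 2 :=
    mul_lt_mul_of_pos_left (pow_lt_pow_left₀ hlt hδ.le two_ne_zero) hδ₀
  nlinarith

end

/-! ### Functions of bounded variation as scores -/

section BoundedVariation

variable {ψ : ℝ → ℝ}

/-- The variation of `ψ` from `0` to `x`. -/
def bvVar (ψ : ℝ → ℝ) (x : ℝ) : ℝ := variationOnFromTo ψ Set.univ 0 x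

lemma bvVar_mono (hψ : BoundedVariationOn ψ Set.univ) : Monotone (bvVar ψ) :=
  monotoneOn_univ.1 (variationOnFromTo.monotoneOn hψ.locallyBoundedVariationOn (Set.mem_univ 0))

lemma abs_bvVar_le (hψ : BoundedVariationOn ψ Set.univ) (x : ℝ) :
    |bvVar ψ x| ≤ (eVariationOn ψ Set.univ).toReal :=
  variationOnFromTo.abs_le_eVariationOn hψ

lemma abs_sub_le_bvVar (hψ : BoundedVariationOn ψ Set.univ) {u v : ℝ} (h : u ≤ v) :
    |ψ v - ψ u| ≤ bvVar ψ v - bvVar ψ u :=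
  variationOnFromTo.abs_sub_le_sub_of_le hψ.locallyBoundedVariationOn (Set.mem_univ 0)
    (Set.mem_univ u) (Set.mem_univ v) h

/-- Jordan decomposition: ψ is a difference of two monotone functions. -/
lemma measurable_of_boundedVariationOn (hψ : BoundedVariationOn ψ Set.univ) : Measurable ψ := by
  have h : Monotone (bvVar ψ - ψ) :=
    monotoneOn_univ.1 (variationOnFromTo.sub_self_monotoneOn hψ.locallyBoundedVariationOn
      (Set.mem_univ 0))
  have e : ψ = bvVar ψ - (bvVar ψ - ψ) := by rw [sub_sub_cancel]
  rw [e]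
  exact (bvVar_mono hψ).measurable.sub h.measurable

lemma abs_le_of_boundedVariationOn (hψ : BoundedVariationOn ψ Set.univ) (x : ℝ) :
    |ψ x| ≤ |ψ 0| + (eVariationOn ψ Set.univ).toReal := by
  have h : |ψ x - ψ 0| ≤ (eVariationOn ψ Set.univ).toReal := by
    rw [← Real.dist_eq]
    exact hψ.dist_le (Set.mem_univ x) (Set.mem_univ 0)
  have h2 := abs_add_le (ψ 0) (ψ x - ψ 0)
  rw [add_sub_cancel] at h2
  linarith

/-- The Stieltjes measure of the variation of `ψ`. -/
def bvMeasure (hψ : BoundedVariationOn ψ Set.univ) : Measure ℝ :=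
  (bvVar_mono hψ).stieltjesFunction.measure

instance isFiniteMeasure_bvMeasure (hψ : BoundedVariationOn ψ Set.univ) :
    IsFiniteMeasure (bvMeasure hψ) := by
  refine StieltjesFunction.isFiniteMeasure_of_forall_abs_le _
    (C := (eVariationOn ψ Set.univ).toReal) fun x => ?_
  rw [Monotone.stieltjesFunction_eq]
  have h1 := (bvVar_mono hψ).le_rightLim (le_refl x)
  have h2 := (bvVar_mono hψ).rightLim_le (lt_add_one x)
  have h3 := abs_le.1 (abs_bvVar_le hψ x)
  have h4 := abs_le.1 (abs_bvVar_le hψ (x + 1))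
  exact abs_le.2 ⟨h3.1.trans h1, h2.trans h4.2⟩

/-- This score ignores x, so F is a Dirac mass and averaging over x is evaluation. The increment of
ψ is at most the increment of its variation over the interval. That is at most the Stieltjes mass of
the closed interval, whose endpoint atoms absorb the passage to the right-continuous version. -/
lemma isScore_of_boundedVariationOn (hψ : BoundedVariationOn ψ Set.univ) :
    IsScore (Measure.dirac 0) (bvMeasure hψ) (fun z => ψ z.1)
      (|ψ 0| + (eVariationOn ψ Set.univ).toReal) where
  measurable := (measurable_of_boundedVariationOn hψ).comp measurable_fst
  bound _ := abs_le_of_boundedVariationOn hψ _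
  osc u v κ h := by
    obtain ⟨h1, h2⟩ := abs_le.1 h
    have hV := bvVar_mono hψ
    have hκ : 0 ≤ κ := (abs_nonneg _).trans h
    have h3 : |ψ v - ψ u| ≤ bvVar ψ (u + κ) - bvVar ψ (u - κ) := by
      rcases le_total u v with huv | huv
      · refine (abs_sub_le_bvVar hψ huv).trans (sub_le_sub (hV (by linarith)) (hV (by linarith)))
      · rw [abs_sub_comm]
        refine (abs_sub_le_bvVar hψ huv).trans (sub_le_sub (hV (by linarith)) (hV (by linarith)))
    have h4 : (Function.leftLim hV.stieltjesFunction (u - κ)) ≤ bvVar ψ (u - κ) := by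
      refine le_of_tendsto (hV.stieltjesFunction.mono.tendsto_leftLim (u - κ)) ?_
      filter_upwards [self_mem_nhdsWithin] with x hx
      rw [Monotone.stieltjesFunction_eq]
      exact hV.rightLim_le hx
    have h5 : bvVar ψ (u + κ) ≤ hV.stieltjesFunction (u + κ) := by
      rw [Monotone.stieltjesFunction_eq]
      exact hV.le_rightLim le_rfl
    rw [integral_dirac, measureReal_def, bvMeasure, StieltjesFunction.measure_Icc]
    refine le_trans ?_ (le_max_left _ _)
    linarith

/-- A function of bounded variation is left continuous off a countable set. -/
lemma countable_leftLim_ne (hψ : BoundedVariationOn ψ Set.univ) :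
    {x | Function.leftLim ψ x ≠ ψ x}.Countable := by
  refine (bvVar_mono hψ).countable_not_continuousAt.mono fun x (hx : Function.leftLim ψ x ≠ ψ x) => ?_
  change ¬ContinuousAt (bvVar ψ) x
  refine fun hc => hx ?_
  have h1 : Function.leftLim (bvVar ψ) x = bvVar ψ x :=
    (bvVar_mono hψ).continuousWithinAt_Iio_iff_leftLim_eq.1 hc.continuousWithinAt
  -- The left jump of the variation equals that of ψ, so continuity of the former forces the latter
  -- to vanish. A monotone function has only countably many discontinuities.
  have h2 := variationOnFromTo.leftLim_eq (a := 0) (b := x) hψ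
  change Function.leftLim (bvVar ψ) x = bvVar ψ x - _ at h2
  exact (dist_eq_zero.1 (by linarith)).symm

end BoundedVariation

/-! ### The Stieltjes integral of the drift -/

section

variable {P : Measure Ω} [IsProbabilityMeasure P] {ε : ℤ → Ω → ℝ} {v K ρ : ℝ} {a : Vec p}
  {y : ℤ → Ω → ℝ} {L : ℝ} {w : Vec p → Vec p → ℝ} {θ : Vec p}

/-- The local concentration bound with half-width zero and a Dirac mass at d shows that the law of
the residual has no atom there. -/
lemma IsARCH.ae_residOf_ne (h : IsARCH P ε v K ρ a y) {c : ℝ} (hθ : ∀ k, 0 ≤ θ k)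
    (hc : ∀ k, θ k ≤ c) (hc0 : 0 ≤ c) (d : ℝ) : ∀ᵐ ω ∂P, residOf θ (obs p y 1 ω) ≠ d := by
  have h1 := h.lintegral_measure_Icc_residOf_le (Measure.dirac d) hθ hc hc0 le_rfl
  simp only [mul_zero, zero_mul, ENNReal.ofReal_zero, nonpos_iff_eq_zero] at h1
  have hm : Measurable fun ω => Measure.dirac d (Set.Icc (residOf θ (obs p y 1 ω) - 0)
      (residOf θ (obs p y 1 ω) + 0)) :=
    (measurable_measure_Icc _ 0).comp ((measurable_residOf θ).comp (h.measurable_obs 1))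
  rw [lintegral_eq_zero_iff hm] at h1
  filter_upwards [h1] with ω hω hd
  have h2 : Measure.dirac d (Set.Icc (residOf θ (obs p y 1 ω) - 0)
    (residOf θ (obs p y 1 ω) + 0)) = 0 := hω
  rw [hd] at h2
  simp at h2

lemma IsARCH.ae_residOf_notMem (h : IsARCH P ε v K ρ a y) {c : ℝ} (hθ : ∀ k, 0 ≤ θ k)
    (hc : ∀ k, θ k ≤ c) (hc0 : 0 ≤ c) {D : Set ℝ} (hD : D.Countable) :
    ∀ᵐ ω ∂P, residOf θ (obs p y 1 ω) ∉ D := by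
  filter_upwards [(ae_ball_iff hD).2 fun d _ => h.ae_residOf_ne hθ hc hc0 d] with ω hω hmem
  exact hω _ hmem rfl

/-- Integrating the indicator covariance over `x` gives the covariance with the measure of the
half-line to the right of the residual. -/
lemma IsARCH.integral_popCov_leScore (h : IsARCH P ε v K ρ a y) (m : Measure ℝ) [IsFiniteMeasure m]
    (hwm : Measurable fun U => w U θ) (hL : ∀ U, |w U θ| ≤ L) :
    ∫ x, popCov P leScore w y x θ ∂m = popCov P (fun z => m.real (Set.Ici z.1)) w y 0 θ := by
  have hobs := h.measurable_obs 1
  have key : ∀ {w : Vec p → Vec p → ℝ} {L : ℝ}, (Measurable fun U => w U θ) →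
      (∀ U, |w U θ| ≤ L) →
      ∫ x, ∫ ω, leScore (residOf θ (obs p y 1 ω), x) * w (lagOf (obs p y 1 ω)) θ ∂P ∂m =
        ∫ ω, m.real (Set.Ici (residOf θ (obs p y 1 ω))) * w (lagOf (obs p y 1 ω)) θ ∂P := by
    intro w L hwm hL
    rw [integral_integral_swap]
    · refine integral_congr_ae (ae_of_all _ fun ω => ?_)
      change ∫ x, leScore (residOf θ (obs p y 1 ω), x) * w (lagOf (obs p y 1 ω)) θ ∂m = _
      rw [integral_mul_const]
      congr 1
      rw [← integral_indicator_one measurableSet_Ici]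
      refine integral_congr_ae (ae_of_all _ fun x => ?_)
      change leInd _ x = _
      rcases le_or_gt (residOf θ (obs p y 1 ω)) x with hx | hx
      · rw [leInd_of_le hx, Set.indicator_of_mem (Set.mem_Ici.2 hx), Pi.one_apply]
      · rw [leInd_of_lt hx, Set.indicator_of_notMem (by simpa using hx)]
    · have hmeas : Measurable fun z : ℝ × Ω => leScore (residOf θ (obs p y 1 z.2), z.1) *
          w (lagOf (obs p y 1 z.2)) θ :=
        (measurable_scoreWeight measurable_leScore hwm).comp
          ((hobs.comp measurable_snd).prodMk measurable_fst)
      refine Integrable.of_bound hmeas.aestronglyMeasurable (1 * L) (ae_of_all _ fun z => ?_)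
      change |leScore (residOf θ (obs p y 1 z.2), z.1) * w (lagOf (obs p y 1 z.2)) θ| ≤ _
      rw [abs_mul]
      exact mul_le_mul (abs_leScore_le _) (hL _) (abs_nonneg _) zero_le_one
  have k1 := key hwm hL
  have k2 := key (w := fun _ _ => 1) (L := 1) measurable_const (by simp)
  have i1 := integrable_integral_scoreWeight (F := m) h measurable_leScore abs_leScore_le hwm hL
  have i2 := integrable_integral_scoreWeight (F := m) (w := fun _ _ => 1) (L := 1) (θ := θ) h
    measurable_leScore abs_leScore_le measurable_const (by simp)
  simp only [scoreWeight, mul_one] at i1 i2 k2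
  unfold popCov
  rw [integral_sub i1 (i2.mul_const _), integral_mul_const, k1, k2]

/-- Covariance is linear in the score and annihilates constants. -/
lemma IsARCH.popCov_sub (h : IsARCH P ε v K ρ a y) {q₁ q₂ q : ℝ × ℝ → ℝ} {Q c : ℝ}
    (h1m : Measurable q₁) (h2m : Measurable q₂) (hqm : Measurable q) (hQ1 : ∀ z, |q₁ z| ≤ Q)
    (hQ2 : ∀ z, |q₂ z| ≤ Q) (hQ : ∀ z, |q z| ≤ Q)
    (hwm : Measurable fun U => w U θ) (hL : ∀ U, |w U θ| ≤ L) {x : ℝ}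
    (he : ∀ᵐ ω ∂P, q₁ (residOf θ (obs p y 1 ω), x) - q₂ (residOf θ (obs p y 1 ω), x) =
      c - q (residOf θ (obs p y 1 ω), x)) :
    popCov P q₁ w y x θ - popCov P q₂ w y x θ = -popCov P q w y x θ := by
  have hobs := h.measurable_obs 1
  have hres : Measurable fun ω => (residOf θ (obs p y 1 ω), x) :=
    ((measurable_residOf θ).comp hobs).prodMk measurable_const
  have hw : Integrable (fun ω => w (lagOf (obs p y 1 ω)) θ) P :=
    Integrable.of_bound (hwm.comp (measurable_lagOf.comp hobs)).aestronglyMeasurable L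
      (ae_of_all _ fun ω => hL _)
  have hi : ∀ {q : ℝ × ℝ → ℝ}, Measurable q → (∀ z, |q z| ≤ Q) →
      Integrable (fun ω => q (residOf θ (obs p y 1 ω), x)) P := fun hm hQ =>
    Integrable.of_bound (hm.comp hres).aestronglyMeasurable Q (ae_of_all _ fun ω => hQ _)
  have hi2 : ∀ {q : ℝ × ℝ → ℝ}, Measurable q → (∀ z, |q z| ≤ Q) →
      Integrable (fun ω => q (residOf θ (obs p y 1 ω), x) * w (lagOf (obs p y 1 ω)) θ) P :=
    fun hm hQ => hw.bdd_mul (hm.comp hres).aestronglyMeasurable (ae_of_all _ fun ω => hQ _)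
  have e1 : (∫ ω, q₁ (residOf θ (obs p y 1 ω), x) ∂P) - ∫ ω, q₂ (residOf θ (obs p y 1 ω), x) ∂P =
      c - ∫ ω, q (residOf θ (obs p y 1 ω), x) ∂P := by
    rw [← integral_sub (hi h1m hQ1) (hi h2m hQ2), integral_congr_ae he,
      integral_sub (integrable_const _) (hi hqm hQ)]
    simp
  have e2 : (∫ ω, q₁ (residOf θ (obs p y 1 ω), x) * w (lagOf (obs p y 1 ω)) θ ∂P) -
      ∫ ω, q₂ (residOf θ (obs p y 1 ω), x) * w (lagOf (obs p y 1 ω)) θ ∂P =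
      c * (∫ ω, w (lagOf (obs p y 1 ω)) θ ∂P) -
        ∫ ω, q (residOf θ (obs p y 1 ω), x) * w (lagOf (obs p y 1 ω)) θ ∂P := by
    rw [← integral_sub (hi2 h1m hQ1) (hi2 h2m hQ2), ← integral_const_mul,
      ← integral_sub (hw.const_mul c) (hi2 hqm hQ)]
    refine integral_congr_ae ?_
    filter_upwards [he] with ω hω
    rw [← sub_mul, hω, sub_mul]
  unfold popCov
  linear_combination e2 - (∫ ω, w (lagOf (obs p y 1 ω)) θ ∂P) * e1

end

/-- The Jordan decomposition turns the vector measure integral into two integrals against finite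
measures, to which Fubini applies. -/
lemma signedMeasure_integral_eq {E : Type*} [NormedAddCommGroup E] [NormedSpace ℝ E]
    (μ : SignedMeasure ℝ) {f : ℝ → E}
    (hf : ∀ m : Measure ℝ, IsFiniteMeasure m → Integrable f m) :
    VectorMeasure.integral μ f (ContinuousLinearMap.lsmul ℝ ℝ).flip =
      ∫ x, f x ∂μ.toJordanDecomposition.posPart - ∫ x, f x ∂μ.toJordanDecomposition.negPart := by
  have hi : ∀ m : Measure ℝ, ∀ [IsFiniteMeasure m], m.toSignedMeasure.Integrable f := by
    intro m _
    change Integrable f m.toSignedMeasure.variation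
    rw [Measure.variation_toSignedMeasure]
    exact hf m inferInstance
  conv_lhs => rw [← μ.toSignedMeasure_toJordanDecomposition, JordanDecomposition.toSignedMeasure]
  rw [VectorMeasure.integral_sub_vectorMeasure (hi _) (hi _), VectorMeasure.integral_toSignedMeasure,
    VectorMeasure.integral_toSignedMeasure]

lemma norm_le_sum_abs (u : Vec p) : ‖u‖ ≤ ∑ j, |u j| := by
  have h0 : 0 ≤ ∑ j, |u j| := Finset.sum_nonneg fun _ _ => abs_nonneg _
  rw [EuclideanSpace.norm_eq, Real.sqrt_le_left h0]
  simp only [Real.norm_eq_abs]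
  exact Finset.sum_sq_le_sq_sum_of_nonneg fun _ _ => abs_nonneg _

section

variable {P : Measure Ω} [IsProbabilityMeasure P] {ε : ℤ → Ω → ℝ} {v K ρ : ℝ} {a : Vec p}
  {y : ℤ → Ω → ℝ} {L : ℝ} {θ : Vec p} {φ : Vec p → Vec p → Vec p} {ψ : ℝ → ℝ}

/-- The Stieltjes integral of the drift with respect to `ψ` is, up to sign, the covariance of
`ψ(ε_1(θ))` and `φ(Y_0, θ)`. -/
lemma IsARCH.integral_drift_apply (h : IsARCH P ε v K ρ a y) {c : ℝ} (hθ : ∀ k, 0 ≤ θ k)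
    (hc : ∀ k, θ k ≤ c) (hc0 : 0 ≤ c) (hm : Measurable fun U => φ U θ) (hL : ∀ U, ‖φ U θ‖ ≤ L)
    (hψ : BoundedVariationOn ψ Set.univ) (j : Fin p) :
    hψ.vectorMeasure.integral (fun x => drift P φ y x θ) (ContinuousLinearMap.lsmul ℝ ℝ).flip j =
      -popCov P (fun z => ψ z.1) (fun U θ => φ U θ j) y 0 θ := by
  have hwm : ∀ j, Measurable fun U => φ U θ j := fun j =>
    (by fun_prop : Measurable fun u : Vec p => u j).comp hm
  have hwL : ∀ j U, |φ U θ j| ≤ L := fun j U => (PiLp.norm_apply_le _ j).trans (hL U)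
  have hid : ∀ m : Measure ℝ, IsFiniteMeasure m → ∀ j,
      Integrable (fun x => drift P φ y x θ j) m := by
    intro m _ j
    simp only [fun x => h.drift_apply hm hL x j]
    exact integrable_popCov h measurable_leScore abs_leScore_le (hwm j) (hwL j)
  rw [signedMeasure_integral_eq hψ.vectorMeasure fun m hm => Integrable.of_eval_piLp (hid m hm)]
  set m₁ := (SignedMeasure.toJordanDecomposition hψ.vectorMeasure).posPart with hm₁
  set m₂ := (SignedMeasure.toJordanDecomposition hψ.vectorMeasure).negPart with hm₂
  rw [PiLp.sub_apply, eval_integral_piLp (hid m₁ inferInstance),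
    eval_integral_piLp (hid m₂ inferInstance)]
  simp only [fun x => h.drift_apply hm hL x j]
  rw [h.integral_popCov_leScore m₁ (hwm j) (hwL j), h.integral_popCov_leScore m₂ (hwm j) (hwL j)]
  have hIci : ∀ m : Measure ℝ, IsFiniteMeasure m →
      Measurable fun z : ℝ × ℝ => m.real (Set.Ici z.1) := fun m _ => by
    have : Antitone fun u : ℝ => m.real (Set.Ici u) := fun u v huv =>
      measureReal_mono (Set.Ici_subset_Ici.2 huv) (measure_ne_top _ _)
    exact this.measurable.comp measurable_fst
  set Q := |ψ 0| + (eVariationOn ψ Set.univ).toReal with hQ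
  have hQ0 : 0 ≤ Q := by positivity
  have hreal : ∀ (m : Measure ℝ) [IsFiniteMeasure m] (z : ℝ × ℝ),
      |m.real (Set.Ici z.1)| ≤ m.real Set.univ := fun m _ z => by
    rw [abs_of_nonneg measureReal_nonneg]
    exact measureReal_mono (Set.subset_univ _) (measure_ne_top _ _)
  have n1 : 0 ≤ m₁.real Set.univ := measureReal_nonneg
  have n2 : 0 ≤ m₂.real Set.univ := measureReal_nonneg
  -- The signed measure of ψ gives the half-line [r, ∞) the mass ψ(∞) - ψ(r-), so the constant c is
  -- the limit of ψ at infinity.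
  refine h.popCov_sub (Q := Q + m₁.real Set.univ + m₂.real Set.univ) (c := limUnder atTop ψ)
    (hIci m₁ inferInstance) (hIci m₂ inferInstance)
    ((measurable_of_boundedVariationOn hψ).comp measurable_fst)
    (fun z => (hreal m₁ z).trans (by linarith)) (fun z => (hreal m₂ z).trans (by linarith))
    (fun z => (abs_le_of_boundedVariationOn hψ _).trans (by linarith)) (hwm j) (hwL j) ?_
  -- Almost surely the residual avoids the countable set of left discontinuities, so ψ(r-) may be
  -- replaced by ψ(r).
  filter_upwards [h.ae_residOf_notMem hθ hc hc0 (countable_leftLim_ne hψ)] with ω hω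
  have h1 : Function.leftLim ψ (residOf θ (obs p y 1 ω)) = ψ (residOf θ (obs p y 1 ω)) :=
    not_not.1 fun hne => hω hne
  have h2 := SignedMeasure.apply_eq_posPart_real_sub_negPart_real hψ.vectorMeasure
    (measurableSet_Ici (a := residOf θ (obs p y 1 ω)))
  rw [hψ.vectorMeasure_Ici, h1] at h2
  exact h2.symm

end

/-! ### Generalized M estimates -/

lemma gmFunctional_apply (φ : Vec p → Vec p → Vec p) (ψ : ℝ → ℝ) (n : ℕ) (y : ℤ → ℝ) (x : ℝ)
    (θ : Vec p) (j : Fin p) :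
    (n : ℝ)⁻¹ * gmFunctional φ ψ n y θ j =
      empCov (fun z => ψ z.1) (fun U θ => φ U θ j) n y x θ := by
  have e : gmFunctional φ ψ n y θ j =
      (∑ t ∈ Finset.Icc (1 : ℤ) n, ψ (resid y θ t) * φ (lag p y (t - 1)) θ j) -
        ((n : ℝ)⁻¹ * ∑ t ∈ Finset.Icc (1 : ℤ) n, ψ (resid y θ t)) *
          ∑ t ∈ Finset.Icc (1 : ℤ) n, φ (lag p y (t - 1)) θ j := by
    simp [gmFunctional]
  rw [e]
  simp only [empCov, avg]
  ring

section

variable {P : Measure Ω} [IsProbabilityMeasure P] {ε : ℤ → Ω → ℝ} {v K ρ c β : ℝ} {b : Vec p} {η : ℝ}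
  {y : Vec p → ℤ → Ω → ℝ} {φ : Vec p → Vec p → Vec p} {L : ℝ} {ψ : ℝ → ℝ}

/-- Consistency of the generalized M estimates under contamination. -/
theorem eventually_isGMEstimate (hψ : BoundedVariationOn ψ Set.univ)
    (hA : ARCHFamily P ε v K ρ c (Theta p β) (ThetaLoc β b η) y)
    (hw : ∀ j, IsWeight (Theta p β) (ThetaLoc β b η) P y (fun U θ => φ U θ j) L)
    (hm : ∀ θ ∈ Theta p β, Measurable fun U => φ U θ) (hbdd : BoundedWeight β φ)
    (hGM : GMIdentifiable P y β b η φ hψ) {δ : ℝ} (hδ : 0 < δ) :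
    ∀ᶠ c : ℕ × ℝ in atTop ×ˢ 𝓝[≥] 0, ∀ a ∈ ThetaLoc β b η, ∀ (μξ : Measure ℝ) (z ξ : ℤ → Ω → ℝ),
      IsContamination p P c.1 c.2 μξ (y a) z ξ →
      P {ω | ∃ θ, IsGMEstimate β φ ψ c.1 (contaminated (y a) z ξ ω) θ ∧ δ < ‖θ - a‖}
        < ENNReal.ofReal δ := by
  obtain ⟨L', hL'⟩ := hbdd
  obtain ⟨δ₀, hδ₀, hid⟩ := hGM
  -- Summing p coordinates of size at most κ must not exceed δ₀ δ; the second condition is again the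
  -- union bound over coordinates.
  obtain ⟨κ, hκ, hκ1, hκ2⟩ := exists_pos_mul_le_and_lt p p (mul_pos hδ₀ hδ) hδ
  have hev := eventually_all.2 fun j =>
    eventually_uniform_empCov_contaminated hA (isScore_of_boundedVariationOn hψ) (hw j) hκ
  filter_upwards [hev]
  rintro ⟨n, γ⟩ h a ha μξ z ξ hc
  refine measure_lt_of_subset_iUnion (fun ω hω => ?_) (fun j => h j a ha μξ z ξ hc) hδ hκ2
  obtain ⟨θ, ⟨hθ, hzero⟩, hlt⟩ : ∃ θ, IsGMEstimate β φ ψ n (contaminated (y a) z ξ ω) θ ∧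
    δ < ‖θ - a‖ := hω
  by_contra hnot
  rw [Set.mem_iUnion, not_exists] at hnot
  have hya := hA.arch a ha
  have hgood : ∀ j, |popCov P (fun z => ψ z.1) (fun U θ => φ U θ j) (y a) 0 θ| ≤ κ := by
    intro j
    have h1 := not_lt.1 fun h => hnot j ⟨θ, hθ, h⟩
    -- The estimating equation makes the empirical covariance zero, so the deviation bound directly
    -- bounds the population covariance at θ.
    rw [integral_dirac, ← gmFunctional_apply, hzero, PiLp.zero_apply, mul_zero, zero_sub,
      abs_neg] at h1
    exact h1
  have hnorm := (norm_le_sum_abs (hψ.vectorMeasure.integral (fun x => drift P φ (y a) x θ)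
    (ContinuousLinearMap.lsmul ℝ ℝ).flip)).trans (Finset.sum_le_sum (g := fun _ => κ) fun j _ => by
      rw [hya.integral_drift_apply (hA.coord_nonneg θ hθ) (hA.coord_le θ hθ) hA.b_nonneg
        (hm θ hθ) (fun U => hL' U θ hθ) hψ j, abs_neg]
      exact hgood j)
  simp only [Finset.sum_const, Finset.card_univ, Fintype.card_fin, nsmul_eq_mul] at hnorm
  have := hid a ha θ hθ
  have := mul_lt_mul_of_pos_left hlt hδ₀
  linarith

end

end RobustARCH

end

/-! ### The theorem -/

open RobustARCH in
theorem mainTheorem4 {p : ℕ} {Ω : Type*} [MeasurableSpace Ω] (P : Measure Ω)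
    [IsProbabilityMeasure P] (g : ℝ → ℝ) (ε : ℤ → Ω → ℝ) (β : ℝ) (b : Vec p) (η : ℝ)
    (y : Vec p → ℤ → Ω → ℝ) (φ : Vec p → Vec p → Vec p) (F : Measure ℝ) [IsFiniteMeasure F]
    (ψ : ℝ → ℝ) (hψ : BoundedVariationOn ψ Set.univ)
    (hε : IsInnovation P g ε)
    (hstat : StationarityCondition g β b η)
    (hy : ∀ a ∈ ThetaLoc β b η, IsStationarySolution P ε a (y a))
    (hg : DensityCondition g)
    (hφ : WeightCondition P y β b η φ)
    (hmom : InnovationMomentCondition g)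
    (hbdd : BoundedWeight β φ)
    (hMD : MDIdentifiable P y β b η φ F)
    (hGM : GMIdentifiable P y β b η φ hψ) :
    ∀ δ : ℝ, 0 < δ → ∃ γ₀ : ℝ, 0 < γ₀ ∧ ∃ N : ℕ, ∀ n : ℕ, N < n → ∀ γ : ℝ, 0 ≤ γ → γ < γ₀ →
      ∀ a : ℕ → Vec p, (∀ m, a m ∈ ThetaLoc β b η) →
      ∀ μξ : Measure ℝ, IsProbabilityMeasure μξ →
      ∀ z ξ : ℤ → Ω → ℝ, IsContamination p P n γ μξ (y (a n)) z ξ →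
        P {ω | ∃ θ, IsMDEstimate β φ F n (contaminated (y (a n)) z ξ ω) θ ∧ δ < ‖θ - a n‖}
            < ENNReal.ofReal δ ∧
        P {ω | ∃ θ, IsGMEstimate β φ ψ n (contaminated (y (a n)) z ξ ω) θ ∧ δ < ‖θ - a n‖}
            < ENNReal.ofReal δ := by
  intro δ hδ
  rcases Nat.eq_zero_or_pos p with rfl | hp
  -- Without lags the parameter space is a single point, so no estimate can be far from the truth.
  · refine ⟨1, one_pos, 0, fun n _ γ _ _ a _ μξ _ z ξ _ => ?_⟩
    have h0 : ∀ θ : Vec 0, ¬δ < ‖θ - a n‖ := fun θ => by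
      rw [Subsingleton.elim θ (a n), sub_self, norm_zero]
      exact not_lt.2 hδ.le
    simp [h0, hδ]
  have : NeZero p := ⟨hp.ne'⟩
  obtain ⟨K, hK⟩ := hg.exists_le
  have hA := archFamily hε hstat hy hK
  obtain ⟨L, hw⟩ := exists_isWeight hstat.beta_pos.le hA hφ hbdd
  have hev := (eventually_isMDEstimate hA hw hφ.1 hbdd hMD hδ).and
    (eventually_isGMEstimate hψ hA hw hφ.1 hbdd hGM hδ)
  -- An event along the product filter splits into separate conditions on n and γ, giving N and γ₀
  -- independently of each other.
  obtain ⟨pn, hpn, pγ, hpγ, hall⟩ := eventually_prod_iff.1 hev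
  obtain ⟨N, hN⟩ := eventually_atTop.1 hpn
  obtain ⟨γ₀, hγ₀, hsub⟩ := mem_nhdsGE_iff_exists_Ico_subset.1 hpγ
  refine ⟨γ₀, hγ₀, N, fun n hn γ hγ hγ' a ha μξ _ z ξ hc => ?_⟩
  have h := hall (hN n hn.le) (hsub ⟨hγ, hγ'⟩)
  exact ⟨h.1 (a n) (ha n) μξ z ξ hc, h.2 (a n) (ha n) μξ z ξ hc⟩
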